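/- **Notation.** For $f:\mathbb{R}^d\to\mathbb{R}$ ($d\ge1$): $f$ is $l$-smooth if $\nabla f$ is $l$-Lipschitz; $\rho$-Hessian Lipschitz if $f$ is twice differentiable and $\nabla^2 f$ is $\rho$-Lipschitz in spectral norm; $x$ is an $\epsilon$-second-order stationary point if $\|\nabla f(x)\|\le\epsilon$ and $\lambda_{\min}(\nabla^2f(x))\ge-\sqrt{\rho\epsilon}$. **Gradient estimate** $GE(x)$: with $v=\frac{\hat\epsilon}{c'l(d+3)^{1.5}}$, $\sigma^2=2c'^2(d+4)B^2$, $m=\big\lceil\frac{32\sigma^2}{\hat\epsilon^2}(\log\frac1{\hat\epsilon}+\frac14)\big\rceil$, draw fresh independent $u_1,\dots,u_m\sim\mathcal N(0,I_d)$ and return $\frac1m\sum_{i=1}^m\frac{f(x+vu_i)-f(x)}{v}u_i$ (this costs $2m$ function queries). **Algorithm EGD.** Put $\chi=\max\{(1+\frac\theta4)\log\frac{2dl\Delta_f}{c\epsilon^2\delta},\chi_1\}$, $\eta=\frac cl$, $g_{thres}=\frac{\sqrt c}{\chi^2}\epsilon$, $f_{thres}=\frac{c}{\chi^3}\sqrt{\epsilon^3/\rho}$,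 $t_{thres}=\big\lceil\frac{\chi}{c^2}\frac{l}{\sqrt{\rho\epsilon}}\big\rceil$, $r=g_{thres}/l$, $t_{temp}=-t_{thres}-1$. For $t=0,1,2,\dots$: (i) $g\leftarrow GE(x_t)$; (ii) if $\|g\|\le g_{thres}$ and $t-t_{temp}>t_{thres}$, then $x_t\leftarrow x_t+\xi_t$ with $\xi_t$ uniform on the ball of radius $r$ about $0$ (independent of everything else), and $t_{temp}\leftarrow t$; (iii) if $t-t_{temp}=t_{thres}$ and $f(x_t)-f(x_{t-t_{thres}})>-f_{thres}$, return $x_{t-t_{thres}}$; (iv) $x_{t+1}\leftarrow x_t-\eta g$. **Theorem 1.** There are absolute constants $c_{\max}>0$ and $c'_{\min}>0$ such that for all $0<c\le c_{\max}$, $c'\ge c'_{\min}$, $\theta>0$ and $\chi_1$ with $\chi^3e^{-\chi}\le e^{-\chi/(1+\theta/4)}$ for all $\chi\ge\chi_1$, there are constants $a,M>0$ (depending only on $c,c',\theta,\chi_1$) with the following property. Let $l,\rho,\delta,\Delta_f>0$, $B>\frac32$, $0<b\le1$, and write $$E=a\cdot\min\Big\{1,\ \frac{\epsilon}{\chi^2},\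 \frac{\sqrt d\,\epsilon}{\chi^3}e^{-\chi},\ \frac{\epsilon^2\delta}{\chi^4l\Delta_f},\ \frac{\delta\sqrt{\rho\epsilon}}{\chi l}\Big\},\qquad g(d,\epsilon)=\frac{d^{2+\theta/2}}{\epsilon^{8+\theta}} .$$ Then there are $C,\epsilon_0>0$ and $k\in\mathbb{N}$, depending only on $c,c',\theta,\chi_1,l,\rho,B,\delta,\Delta_f,b$ (so not on $d,\epsilon,f,x_0,\hat\epsilon$), such that $\frac{\epsilon^{3+\theta/2}}{d^{\frac12(1+\theta/2)}}\le C\,\log^k(g(d,\epsilon))\,E$ for all $d\ge1$ and $0<\epsilon\le\epsilon_0$, and such that the following holds for every $d\ge1$, every $f:\mathbb{R}^d\to\mathbb{R}$ that is $l$-smooth, $\rho$-Hessian Lipschitz, bounded below with infimum $f^*$, and satisfies $\|\nabla f\|\le B$ everywhere, every $x_0$ with $f(x_0)-f^*\le\Delta_f$, every $\epsilon>0$ with $\sqrt{\rho\epsilon}\le l$, and every $0<\hat\epsilon\le E$. With probability at least $1-\delta$, EGD started at $x_0$ terminates and all of the following hold: 1. its output is an $\epsilon$-second-order stationary point of $f$;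 2. the number of iterations is at most $M\Big(\frac{l(f(x_0)-f^*)}{\epsilon^2}+\frac{l}{\sqrt{\rho\epsilon}}\Big)\max\Big\{1,\log\frac{dl\Delta_f}{\epsilon^2\delta}\Big\}^4$; and it is at most $M\,\frac{l(f(x_0)-f^*)}{\epsilon^2}\log^4\Big(\frac{dl\Delta_f}{\epsilon^2\delta}\Big)$ as soon as $\epsilon$ is so small that $\sqrt{\epsilon^3/\rho}\le f(x_0)-f^*$ and $\log\frac{dl\Delta_f}{\epsilon^2\delta}\ge1$; 3. if $\epsilon\le\epsilon_0$ and $\hat\epsilon\ge bE$ (that is, $\hat\epsilon$ is of the order of its upper bound), the total number of queries of $f$ is at most $C\,g(d,\epsilon)\log^k g(d,\epsilon)$, i.e. $\widetilde O\big(d^{2+\theta/2}/\epsilon^{8+\theta}\big)$. -/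

import Mathlib

open MeasureTheory ProbabilityTheory

noncomputable section

namespace EGD

/-- The space `ℝ^d` with its Euclidean norm. -/
abbrev Vec (d : ℕ) : Type := EuclideanSpace ℝ (Fin d)

/-! ### Smoothness classes and stationary points -/

/-- The Hessian `∇²f(x)`, as the derivative of the gradient. -/
def hessian {d : ℕ} (f : Vec d → ℝ) (x : Vec d) : Vec d →L[ℝ] Vec d :=
  fderiv ℝ (gradient f) x

/-- `f` is differentiable with `l`-Lipschitz gradient. -/
def IsSmooth {d : ℕ} (l : ℝ) (f : Vec d → ℝ) : Prop :=
  Differentiable ℝ f ∧ ∀ x y, ‖gradient f x - gradient f y‖ ≤ l * ‖x - y‖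

/-- `f` is twice differentiable with `ρ`-Lipschitz Hessian (in the spectral norm). -/
def IsHessianLipschitz {d : ℕ} (ρ : ℝ) (f : Vec d → ℝ) : Prop :=
  Differentiable ℝ f ∧ Differentiable ℝ (gradient f) ∧
    ∀ x y, ‖hessian f x - hessian f y‖ ≤ ρ * ‖x - y‖

/-- The smallest eigenvalue of a (symmetric) operator. -/
def lambdaMin {d : ℕ} (A : Vec d →L[ℝ] Vec d) : ℝ :=
  sInf {μ : ℝ | Module.End.HasEigenvalue (A : Vec d →ₗ[ℝ] Vec d) μ}

/-- `ε`-second-order stationary point of a `ρ`-Hessian Lipschitz function. -/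
def IsSOSP {d : ℕ} (ρ ε : ℝ) (f : Vec d → ℝ) (x : Vec d) : Prop :=
  ‖gradient f x‖ ≤ ε ∧ -√(ρ * ε) ≤ lambdaMin (hessian f x)

/-! ### Parameters of the algorithm -/

/-- The scalar `χ = max {(1 + θ/4) log (2 d l Δ_f / (c ε² δ)), χ₁}`. -/
def chi (d : ℕ) (l c θ χ₁ δ Δf ε : ℝ) : ℝ :=
  max ((1 + θ / 4) * Real.log (2 * d * l * Δf / (c * ε ^ 2 * δ))) χ₁

/-- The scalar inputs of the algorithm in dimension `d`. -/
structure Params (d : ℕ) where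
  l : ℝ
  B : ℝ
  χ₁ : ℝ
  θ : ℝ
  ρ : ℝ
  ε : ℝ
  epsHat : ℝ
  c : ℝ
  c' : ℝ
  δ : ℝ
  Δf : ℝ

namespace Params

variable {d : ℕ} (p : Params d)

def chi : ℝ := EGD.chi d p.l p.c p.θ p.χ₁ p.δ p.Δf p.ε

/-- Step size. -/
def eta : ℝ := p.c / p.l

def gThres : ℝ := √p.c / p.chi ^ 2 * p.ε

def fThres : ℝ := p.c / p.chi ^ 3 * √(p.ε ^ 3 / p.ρ)

/-- `(χ / c²) · l / √(ρ ε)`, rounded up to an integer number of steps. -/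
def tThres : ℕ := ⌈p.chi / p.c ^ 2 * (p.l / √(p.ρ * p.ε))⌉₊

/-- Radius of the perturbation ball. -/
def r : ℝ := p.gThres / p.l

/-- Gaussian smoothing parameter. -/
def v : ℝ := p.epsHat / (p.c' * p.l * ((d : ℝ) + 3) ^ (3 / 2 : ℝ))

def sigmaSq : ℝ := 2 * p.c' ^ 2 * ((d : ℝ) + 4) * p.B ^ 2

/-- Number of Gaussian samples for one gradient estimate, rounded up to an integer. -/
def m : ℕ := ⌈32 * p.sigmaSq / p.epsHat ^ 2 * (Real.log (1 / p.epsHat) + 1 / 4)⌉₊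

end Params

/-! ### The algorithm -/

/-- Gradient estimate at `x` from the samples `u 0, …, u (m - 1)`.  Each of the `m` summands
queries `f` twice. -/
def gradEst {d : ℕ} (p : Params d) (f : Vec d → ℝ) (u : ℕ → Vec d) (x : Vec d) : Vec d :=
  (1 / (p.m : ℝ)) • ∑ i ∈ Finset.range p.m, ((f (x + p.v • u i) - f x) / p.v) • u i

/-- State of the main loop. -/
structure State (d : ℕ) where
  /-- index of the next iteration, i.e. the number of iterations executed so far -/
  t : ℕ
  /-- current iterate `x_t` -/
  x : Vec d
  /-- time of the last perturbation -/
  tTemp : ℤ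
  /-- value of the iterate `x_{tTemp}` (after its perturbation) -/
  xTemp : Vec d
  /-- number of queries of `f` made so far -/
  queries : ℕ
  /-- the returned point, once the algorithm has returned -/
  output : Option (Vec d)

def initState {d : ℕ} (p : Params d) (x₀ : Vec d) : State d where
  t := 0
  x := x₀
  tTemp := -(p.tThres : ℤ) - 1
  xTemp := x₀
  queries := 0
  output := none

open Classical in
/-- One iteration of the loop; `u i` are the Gaussian samples and `ξ` the perturbation of
this iteration.  The termination test can only succeed when `t - tTemp = t_thres`, and then
`x_{t - t_thres} = x_{tTemp}`, the perturbed iterate kept in `xTemp` (the initial value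
`-t_thres - 1` of `tTemp` never satisfies this equation).  After returning, the state does
not change any more. -/
def step {d : ℕ} (p : Params d) (f : Vec d → ℝ) (u : ℕ → Vec d) (ξ : Vec d) (s : State d) :
    State d :=
  match s.output with
  | some _ => s
  | none =>
    let g : Vec d := gradEst p f u s.x
    let perturb : Prop := ‖g‖ ≤ p.gThres ∧ (s.t : ℤ) - s.tTemp > (p.tThres : ℤ)
    let x : Vec d := if perturb then s.x + ξ else s.x
    let tTemp : ℤ := if perturb then (s.t : ℤ) else s.tTemp
    let xTemp : Vec d := if perturb then x else s.xTemp
    let test : Prop := (s.t : ℤ) - tTemp = (p.tThres : ℤ)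
    let halt : Prop := test ∧ f x - f xTemp > -p.fThres
    { t := s.t + 1
      x := if halt then x else x - p.eta • g
      tTemp := tTemp
      xTemp := xTemp
      queries := s.queries + 2 * p.m + (if test then 2 else 0)
      output := if halt then some xTemp else none }

/-- State after `n` rounds of the loop, when iteration `t` uses the Gaussian samples
`u t 0, u t 1, …` and the perturbation `ξ t`. -/
def run {d : ℕ} (p : Params d) (f : Vec d → ℝ) (x₀ : Vec d) (u : ℕ → ℕ → Vec d)
    (ξ : ℕ → Vec d) : ℕ → State d
  | 0 => initState p x₀
  | n + 1 => step p f (u n) (ξ n) (run p f x₀ u ξ n)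

/-- The algorithm started at `x₀` returns `y` after exactly `T` iterations and `Q` queries of
`f`. -/
def Returns {d : ℕ} (p : Params d) (f : Vec d → ℝ) (x₀ : Vec d) (u : ℕ → ℕ → Vec d)
    (ξ : ℕ → Vec d) (y : Vec d) (T Q : ℕ) : Prop :=
  ∃ n, (run p f x₀ u ξ n).output = some y ∧ (run p f x₀ u ξ n).t = T ∧
    (run p f x₀ u ξ n).queries = Q

/-- The randomness of the algorithm: the samples `u t i` are standard Gaussian vectors, the
perturbations `ξ t` are uniform on the ball of radius `r` about `0`, and all of them are
independent. -/
structure IsRandomness {d : ℕ} (p : Params d) {Ω : Type*} [MeasurableSpace Ω] (P : Measure Ω)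
    (u : ℕ → ℕ → Ω → Vec d) (ξ : ℕ → Ω → Vec d) : Prop where
  gaussian : ∀ t i, HasLaw (u t i) (stdGaussian (Vec d)) P
  uniform : ∀ t, HasLaw (ξ t) (cond volume (Metric.closedBall (0 : Vec d) p.r)) P
  indep : iIndepFun (Sum.elim (fun q : ℕ × ℕ => u q.1 q.2) ξ) P

/-! ### Accuracy of the gradient estimates and the query rate -/

/-- Upper bound for the accuracy `epsHat` of the gradient estimates.  The second entry is `O(ε)`.
Since `exp (-χ) = min ((c ε² δ / (2 d l Δ_f)) ^ (1 + θ/4)) (exp (-χ₁))`, the third entry is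
of order `ε ^ (3 + θ/2) / d ^ ((1 + θ/2) / 2)` up to logarithms; as `ε → 0` it is the smallest
one up to constants. -/
def epsHatBound (a : ℝ) (d : ℕ) (l ρ c θ χ₁ δ Δf ε : ℝ) : ℝ :=
  let χ := chi d l c θ χ₁ δ Δf ε
  a * min 1 (min (ε / χ ^ 2) (min (√(d : ℝ) * ε / χ ^ 3 * Real.exp (-χ))
    (min (ε ^ 2 * δ / (χ ^ 4 * l * Δf)) (δ * √(ρ * ε) / (χ * l)))))

/-- `d ^ (2 + θ/2) / ε ^ (8 + θ)`. -/
def queryRate (d : ℕ) (θ ε : ℝ) : ℝ :=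
  (d : ℝ) ^ (2 + θ / 2) / ε ^ (8 + θ)

end EGD

end

/-! Write `γ = √(ρε)`, and `F` for the initial gap `f x₀ - inf f`. The proof separates a
deterministic analysis of a run whose random inputs behave well (`exists_returns`) from a bound on
the probability that they misbehave (`le_measureReal_goodRun`).

Accuracy. A gradient estimate splits into the average of `⟪∇f(x), u⟫ u`, a quadratic Gaussian form
with mean `∇f(x)`, and a remainder of size `l v ‖u‖³`. Exponential moments of both parts give an
error above `epsHat` with probability at most `epsHat` (`measure_gradEst_error_le`). The run is
shorter than a number `N` with `N * epsHat ≤ δ / 2`, so a union bound over iterations suffices here.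

Potential. With accurate estimates, an iteration outside a perturbation window lowers `f` by at
least `rate`, because it would have perturbed if its estimate were small. A window that does not end
in termination lowers `f` by `fThres`, which pays for the perturbation, the gradient noise and the
length of the window. Hence `f` plus a multiple of the iteration count, and `f` plus a multiple of
the perturbation count, stay controlled (`progress`); both counts are bounded by `F`.

Escape. The output is a perturbed point. Its gradient is small because the estimate was small and
the perturbation is short, so only negative curvature has to be excluded. Fix all Gaussian samples
and compare two perturbations of the same `x` that differ by `μ` along the bottom eigenvector of
`∇²f(x)`. Little decrease confines both trajectories near `x`, whereas their difference grows like
`(1 + ηγ₁)^n`; so `|μ|` is exponentially small in `χ` (`Regime.abs_lt_of_not_decrease`). The failing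
perturbations thus form a set thin in one fixed direction, a fraction at most `(d/8)(l/γ) exp(-χ)`
of the ball (`volume_failsEscape_le`). This bounds the failure probability conditionally on all
inputs except the current perturbation. Multiplied by the expected number of attempts, which is
bounded by the potential argument, it is at most `δ / 2` by the choice of `χ`
(`escapeFailure_mul_le`). If `F` is too small to absorb the additive constants, no failing attempt
exists at all: a point of curvature below `-γ` lies at least `√(ε³/ρ)/16` above the infimum.

Queries. There are about `χ⁴ / ε²` iterations with about `d / epsHat²` samples each; for `epsHat` of
the order of its upper bound this is `queryRate` up to logarithms (`exists_accuracyOrder_le`,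
`queryRate_eq`). -/

noncomputable section

namespace EGD

open scoped RealInnerProductSpace ENNReal

/-! ### Smooth functions, Hessians and quadratic forms -/

section Calculus

variable {d : ℕ} {f : Vec d → ℝ} {l ρ : ℝ}

lemma hasDerivAt_line (hf : Differentiable ℝ f) (x h : Vec d) (t : ℝ) :
    HasDerivAt (fun s : ℝ => f (x + s • h)) ⟪gradient f (x + t • h), h⟫ t := by
  have h1 := (hf (x + t • h)).hasGradientAt.hasFDerivAt
  have h2 : HasDerivAt (fun s : ℝ => x + s • h) h t := by
    simpa using ((hasDerivAt_id t).smul_const h).const_add x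
  exact (h1.comp_hasDerivAt t h2).congr_deriv (by simp)

/-- Quadratic error bound for the linearization of a function with Lipschitz gradient. -/
lemma IsSmooth.abs_sub_sub_inner_le (hf : IsSmooth l f) (x h : Vec d) :
    |f (x + h) - f x - ⟪gradient f x, h⟫| ≤ l / 2 * ‖h‖ ^ 2 := by
  have key := image_norm_le_of_norm_deriv_right_le_deriv_boundary (a := 0) (b := 1)
    (f := fun t : ℝ => f (x + t • h) - f x - t * ⟪gradient f x, h⟫)
    (f' := fun t => ⟪gradient f (x + t • h), h⟫ - ⟪gradient f x, h⟫)
    (B := fun t => l * ‖h‖ ^ 2 * (t ^ 2 / 2)) (B' := fun t => l * ‖h‖ ^ 2 * t)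
    (fun t _ => by
      have := (hasDerivAt_line hf.1 x h t).continuousAt
      exact ((this.sub continuousAt_const).sub
        (continuousAt_id.mul continuousAt_const)).continuousWithinAt)
    (fun t _ => by
      have := ((hasDerivAt_line hf.1 x h t).sub_const (f x)).sub
        ((hasDerivAt_id t).mul_const ⟪gradient f x, h⟫)
      exact (this.congr_deriv (by simp)).hasDerivWithinAt)
    (by simp)
    (fun t => by
      have := ((hasDerivAt_id t).pow 2).div_const 2
      have := this.const_mul (l * ‖h‖ ^ 2)
      exact this.congr_deriv (by simp))
    (fun t ht => by
      rw [← inner_sub_left]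
      refine (norm_inner_le_norm _ _).trans ?_
      have := hf.2 (x + t • h) x
      rw [add_sub_cancel_left, norm_smul, Real.norm_of_nonneg ht.1] at this
      calc _ ≤ (l * (t * ‖h‖)) * ‖h‖ := by gcongr
        _ = _ := by ring)
    (Set.right_mem_Icc.2 zero_le_one)
  simp only [one_smul, one_mul, Real.norm_eq_abs] at key
  refine key.trans (le_of_eq ?_)
  ring

/-- Progress of an inexact gradient step. -/
lemma IsSmooth.step_le (hf : IsSmooth l f) (x g : Vec d) (η : ℝ) :
    f (x - η • g) ≤ f x - η / 2 * ‖gradient f x‖ ^ 2 + η / 2 * ‖g - gradient f x‖ ^ 2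
      - η / 2 * (1 - l * η) * ‖g‖ ^ 2 := by
  have h := (abs_le.1 (hf.abs_sub_sub_inner_le x (-(η • g)))).2
  rw [← sub_eq_add_neg, norm_neg, norm_smul, inner_neg_right, inner_smul_right, mul_pow,
    Real.norm_eq_abs, sq_abs] at h
  rw [norm_sub_sq_real, real_inner_comm]
  linarith

lemma abs_sub_le_of_gradient_le (hf : Differentiable ℝ f) {B : ℝ}
    (hB : ∀ x, ‖gradient f x‖ ≤ B) (x h : Vec d) : |f (x + h) - f x| ≤ B * ‖h‖ := by
  have := convex_univ.norm_image_sub_le_of_norm_fderiv_le (𝕜 := ℝ) (f := f) (C := B)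
    (fun y _ => hf y) (fun y _ => by
      rw [(hf y).hasGradientAt.hasFDerivAt.fderiv]
      exact (LinearIsometryEquiv.norm_map _ _).trans_le (hB y))
      (Set.mem_univ x) (Set.mem_univ (x + h))
  simpa using this

lemma IsSmooth.continuous_gradient (hf : IsSmooth l f) : Continuous (gradient f) := by
  refine (LipschitzWith.of_dist_le_mul (K := l.toNNReal) fun x y => ?_).continuous
  rw [dist_eq_norm, dist_eq_norm]
  exact (hf.2 x y).trans (by gcongr; exact Real.le_coe_toNNReal l)

lemma IsHessianLipschitz.hasFDerivAt (hf : IsHessianLipschitz ρ f) (x : Vec d) :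
    HasFDerivAt (gradient f) (hessian f x) x :=
  (hf.2.1 x).hasFDerivAt

lemma IsHessianLipschitz.continuous_hessian (hf : IsHessianLipschitz ρ f) :
    Continuous (hessian f) := by
  refine (LipschitzWith.of_dist_le_mul (K := ρ.toNNReal) fun x y => ?_).continuous
  rw [dist_eq_norm, dist_eq_norm]
  exact (hf.2.2 x y).trans (by gcongr; exact Real.le_coe_toNNReal ρ)

/-- Symmetry of the second derivative of `f`, whose first derivative is the gradient composed with
the Riesz map. -/
lemma IsHessianLipschitz.inner_hessian_comm (hf : IsHessianLipschitz ρ f) (x v w : Vec d) :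
    ⟪hessian f x v, w⟫ = ⟪v, hessian f x w⟫ := by
  let L : Vec d →L[ℝ] (Vec d →L[ℝ] ℝ) :=
    LinearMap.toContinuousLinearMap
      { toFun := fun v => InnerProductSpace.toDual ℝ (Vec d) v
        map_add' := fun v w => map_add _ v w
        map_smul' := fun c v => by simp }
  have h := second_derivative_symmetric (𝕜 := ℝ) (f := f) (x := x)
    (f' := fun y => L (gradient f y)) (f'' := L.comp (hessian f x))
    (fun y => (hf.1 y).hasGradientAt.hasFDerivAt)
    (L.hasFDerivAt.comp x (hf.hasFDerivAt x)) v w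
  have h' : ⟪hessian f x v, w⟫ = ⟪hessian f x w, v⟫ := h
  rw [h', real_inner_comm]

lemma norm_hessian_le (hl : 0 ≤ l) (hs : IsSmooth l f) (hf : IsHessianLipschitz ρ f)
    (x : Vec d) : ‖hessian f x‖ ≤ l :=
  (hf.hasFDerivAt x).le_of_lip' hl (Filter.Eventually.of_forall fun y => hs.2 y x)

/-- Mean value inequality for `∇f - ∇²f(x)`, whose derivative has norm at most `ρ R` on the ball. It
lets the difference of two trajectories be compared with the linear dynamics frozen at `x`. -/
lemma IsHessianLipschitz.norm_gradient_sub_le (hρ : 0 ≤ ρ) (hf : IsHessianLipschitz ρ f)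
    (x y y' : Vec d) {R : ℝ} (hy : ‖y - x‖ ≤ R) (hy' : ‖y' - x‖ ≤ R) :
    ‖gradient f y - gradient f y' - hessian f x (y - y')‖ ≤ ρ * R * ‖y - y'‖ := by
  refine (convex_closedBall x R).norm_image_sub_le_of_norm_hasFDerivWithin_le'
    (fun z _ => (hf.hasFDerivAt z).hasFDerivWithinAt) (fun z hz => ?_) ?_ ?_
  · refine (hf.2.2 z x).trans ?_
    rw [Metric.mem_closedBall, dist_eq_norm] at hz
    gcongr
  · rwa [Metric.mem_closedBall, dist_eq_norm]
  · rwa [Metric.mem_closedBall, dist_eq_norm]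

/-- A direction of negative curvature `-γ` gives a point with a definitely smaller value. -/
lemma IsHessianLipschitz.exists_le_of_negative_curvature (hρ : 0 < ρ)
    (hf : IsHessianLipschitz ρ f) {x w : Vec d} {γ : ℝ} (hγ : 0 < γ) (hw : ‖w‖ = 1)
    (hc : ⟪hessian f x w, w⟫ < -γ) : ∃ y, f y ≤ f x - γ ^ 3 / (16 * ρ ^ 2) := by
  wlog hg : ⟪gradient f x, w⟫ ≤ 0 generalizing w
  · exact this (w := -w) (by simpa using hw) (by simpa using hc)
      (by simpa using (not_le.1 hg).le)
  have hder : ∀ t : ℝ, HasDerivAt (fun s : ℝ => ⟪gradient f (x + s • w), w⟫)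
      ⟪hessian f (x + t • w) w, w⟫ t := fun t => by
    have h2 : HasDerivAt (fun s : ℝ => x + s • w) w t := by
      simpa using ((hasDerivAt_id t).smul_const w).const_add x
    have h3 := (hf.hasFDerivAt (x + t • w)).comp_hasDerivAt t h2
    simpa using h3.inner ℝ (hasDerivAt_const t w)
  -- Up to distance `γ / (2ρ)` the Hessian changes by at most `γ / 2`, so half of the negative
  -- curvature survives. Integrating twice over this length yields the gain `γ / 4 * (γ / (2ρ))² =
  -- γ³ / (16ρ²)`.
  have hcurv : ∀ t ∈ Set.Icc 0 (γ / (2 * ρ)), ⟪hessian f (x + t • w) w, w⟫ ≤ -(γ / 2) := by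
    intro t ht
    have h1 : ⟪(hessian f (x + t • w) - hessian f x) w, w⟫ ≤ ρ * t := by
      refine (real_inner_le_norm _ _).trans ?_
      rw [hw, mul_one]
      refine (ContinuousLinearMap.le_opNorm _ _).trans ?_
      have := hf.2.2 (x + t • w) x
      rwa [add_sub_cancel_left, norm_smul, hw, mul_one, Real.norm_of_nonneg ht.1,
        ← mul_one ‖_ - _‖] at *
    have h2 : ρ * t ≤ γ / 2 := by
      have := mul_le_mul_of_nonneg_left ht.2 hρ.le
      refine this.trans (le_of_eq ?_)
      field_simp
    rw [sub_apply, inner_sub_left] at h1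
    linarith
  set τ := γ / (2 * ρ) with hτ
  have hτ0 : 0 < τ := by positivity
  have hslope : ∀ t ∈ Set.Icc 0 τ, ⟪gradient f (x + t • w), w⟫ ≤ -(γ / 2 * t) := by
    intro t ht
    have hanti : AntitoneOn (fun s : ℝ => ⟪gradient f (x + s • w), w⟫ + γ / 2 * s)
        (Set.Icc 0 τ) := by
      refine antitoneOn_of_hasDerivWithinAt_nonpos
        (f' := fun s => ⟪hessian f (x + s • w) w, w⟫ + γ / 2) (convex_Icc _ _)
        (fun s _ => ?_) (fun s _ => ?_) (fun s hs => ?_)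
      · exact ((hder s).continuousAt.add (continuousAt_const.mul
          continuousAt_id)).continuousWithinAt
      · have := (hder s).add ((hasDerivAt_id s).const_mul (γ / 2))
        exact (this.congr_deriv (by simp)).hasDerivWithinAt
      · have := hcurv s (interior_subset hs)
        linarith
    have := hanti (Set.left_mem_Icc.2 hτ0.le) ht ht.1
    simp only [zero_smul, add_zero, mul_zero] at this
    linarith
  have hanti : AntitoneOn (fun s : ℝ => f (x + s • w) + γ / 4 * s ^ 2) (Set.Icc 0 τ) := by
    refine antitoneOn_of_hasDerivWithinAt_nonpos
      (f' := fun s => ⟪gradient f (x + s • w), w⟫ + γ / 4 * (2 * s)) (convex_Icc _ _)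
      (fun s _ => ?_) (fun s _ => ?_) (fun s hs => ?_)
    · exact ((hasDerivAt_line hf.1 x w s).continuousAt.add (continuousAt_const.mul
        (continuousAt_id.pow 2))).continuousWithinAt
    · have := (hasDerivAt_line hf.1 x w s).add (((hasDerivAt_id s).pow 2).const_mul (γ / 4))
      exact (this.congr_deriv (by simp)).hasDerivWithinAt
    · have := hslope s (interior_subset hs)
      linarith
  have h := hanti (Set.left_mem_Icc.2 hτ0.le) (Set.right_mem_Icc.2 hτ0.le) hτ0.le
  refine ⟨x + τ • w, ?_⟩
  simp only [zero_smul, add_zero] at h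
  have h2 : γ / 4 * τ ^ 2 = γ ^ 3 / (16 * ρ ^ 2) := by
    rw [hτ]; field_simp; norm_num
  rw [h2] at h
  linarith

lemma le_lambdaMin {A : Vec d →L[ℝ] Vec d} {γ : ℝ} (hγ : 0 ≤ γ)
    (h : ∀ w : Vec d, ‖w‖ = 1 → -γ ≤ ⟪A w, w⟫) : -γ ≤ lambdaMin A := by
  rw [lambdaMin]
  rcases Set.eq_empty_or_nonempty
    {μ : ℝ | Module.End.HasEigenvalue (A : Vec d →ₗ[ℝ] Vec d) μ} with he | hne
  -- For an empty spectrum `sInf ∅ = 0`, which is where `0 ≤ γ` enters.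
  · rw [he, Real.sInf_empty]; linarith
  · refine le_csInf hne fun μ hμ => ?_
    obtain ⟨v, hv⟩ := hμ.exists_hasEigenvector
    have hv0 : ‖v‖ ≠ 0 := norm_ne_zero_iff.2 hv.2
    have hAv : A v = μ • v := hv.apply_eq_smul
    have := h (‖v‖⁻¹ • v) (by rw [norm_smul, norm_inv, norm_norm, inv_mul_cancel₀ hv0])
    rw [map_smul, hAv, inner_smul_left, inner_smul_left, inner_smul_right,
      real_inner_self_eq_norm_sq] at this
    simp only [conj_trivial] at this
    field_simp at this
    linarith

/-- A symmetric operator with a negative direction has an eigenvector for its least Rayleigh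
quotient. -/
lemma exists_min_eigenvector {A : Vec d →L[ℝ] Vec d} (hA : ∀ v w, ⟪A v, w⟫ = ⟪v, A w⟫)
    {w : Vec d} (hw : ‖w‖ = 1) {γ : ℝ} (hc : ⟪A w, w⟫ ≤ -γ) :
    ∃ (e : Vec d) (γ₁ : ℝ), ‖e‖ = 1 ∧ γ ≤ γ₁ ∧ A e = -γ₁ • e ∧
      ∀ v, -γ₁ * ‖v‖ ^ 2 ≤ ⟪A v, v⟫ := by
  obtain ⟨e, he, hmin⟩ := (isCompact_sphere (0 : Vec d) 1).exists_isMinOn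
    ⟨w, by simpa using hw⟩ (f := fun v => ⟪A v, v⟫)
    (by fun_prop)
  have he1 : ‖e‖ = 1 := by simpa using he
  have hself : IsSelfAdjoint A := by
    rw [ContinuousLinearMap.isSelfAdjoint_iff_isSymmetric]; exact hA
  have hext : IsMinOn A.reApplyInnerSelf (Metric.sphere 0 ‖e‖) e := by
    rw [he1]
    intro v hv
    simpa [ContinuousLinearMap.reApplyInnerSelf] using hmin hv
  have heig := hself.eq_smul_self_of_isLocalExtrOn (x₀ := e) (Or.inl hext.localize)
  have hray : A.rayleighQuotient e = ⟪A e, e⟫ := by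
    simp [ContinuousLinearMap.rayleighQuotient, ContinuousLinearMap.reApplyInnerSelf, he1]
  refine ⟨e, -⟪A e, e⟫, he1, ?_, ?_, fun v => ?_⟩
  · have : ⟪A e, e⟫ ≤ ⟪A w, w⟫ := hmin (by simpa using hw)
    linarith
  · rw [neg_neg, ← hray]; exact heig
  · rw [neg_neg]
    rcases eq_or_ne v 0 with rfl | hv
    · simp
    have hv0 : ‖v‖ ≠ 0 := norm_ne_zero_iff.2 hv
    have : ⟪A e, e⟫ ≤ ⟪A (‖v‖⁻¹ • v), ‖v‖⁻¹ • v⟫ := hmin (by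
      simp [norm_smul, hv0])
    rw [map_smul, inner_smul_left, inner_smul_right] at this
    simp only [conj_trivial] at this
    have h2 := mul_le_mul_of_nonneg_right this (sq_nonneg ‖v‖)
    refine h2.trans (le_of_eq ?_)
    field_simp

/-- A gradient-descent step of the quadratic form expands by at most its top eigenvalue. -/
lemma norm_sub_smul_le {A : Vec d →L[ℝ] Vec d} (hA : ∀ v w, ⟪A v, w⟫ = ⟪v, A w⟫)
    {η γ₁ : ℝ} (hη : 0 ≤ η) (hAl : ‖A‖ ≤ l) (hηl : η * l ≤ 1) (hγ : 0 ≤ γ₁)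
    (hmin : ∀ v, -γ₁ * ‖v‖ ^ 2 ≤ ⟪A v, v⟫) (v : Vec d) :
    ‖v - η • A v‖ ≤ (1 + η * γ₁) * ‖v‖ := by
  set T : Vec d → Vec d := fun v => v - η • A v with hT
  have hpos : ∀ v, 0 ≤ ⟪T v, v⟫ := fun v => by
    simp only [hT]
    rw [inner_sub_left, inner_smul_left, real_inner_self_eq_norm_sq]
    simp only [conj_trivial]
    have h1 : ⟪A v, v⟫ ≤ l * ‖v‖ ^ 2 := by
      refine (real_inner_le_norm _ _).trans ?_
      calc _ ≤ (‖A‖ * ‖v‖) * ‖v‖ := by gcongr; exact A.le_opNorm v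
        _ ≤ (l * ‖v‖) * ‖v‖ := by gcongr
        _ = _ := by ring
    have h2 := mul_le_mul_of_nonneg_left h1 hη
    have h3 := mul_le_mul_of_nonneg_right hηl (sq_nonneg ‖v‖)
    linarith
  have hle : ∀ v, ⟪T v, v⟫ ≤ (1 + η * γ₁) * ‖v‖ ^ 2 := fun v => by
    simp only [hT]
    rw [inner_sub_left, inner_smul_left, real_inner_self_eq_norm_sq]
    simp only [conj_trivial]
    have := mul_le_mul_of_nonneg_left (hmin v) hη
    linarith
  have hsym : ∀ v w, ⟪T v, w⟫ = ⟪v, T w⟫ := fun v w => by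
    simp only [hT]
    rw [inner_sub_left, inner_sub_right, inner_smul_left, inner_smul_right, hA]
    simp
  have hadd : ∀ (s : ℝ) v w, T (v + s • w) = T v + s • T w := fun s v w => by
    simp only [hT, map_add, map_smul, smul_sub, smul_add]
    rw [smul_comm η s]; abel
  set K := 1 + η * γ₁ with hK
  have hK1 : 1 ≤ K := by rw [hK]; nlinarith [mul_nonneg hη hγ]
  -- Positivity of `T` at `T v - K v`, with `⟪T (T v), T v⟫ ≤ K ‖T v‖²`, gives `K ‖T v‖² ≤ K² ⟪T v,
  -- v⟫ ≤ K³ ‖v‖²`. This replaces a spectral decomposition.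
  have hquad := hpos (T v + (-K) • v)
  rw [hadd, inner_add_left, inner_add_right, inner_add_right] at hquad
  simp only [inner_smul_left, inner_smul_right, conj_trivial] at hquad
  have h1 := hle (T v)
  have h2 : ⟪T (T v), v⟫ = ‖T v‖ ^ 2 := by rw [hsym, real_inner_self_eq_norm_sq]
  have h3 : ⟪T v, T v⟫ = ‖T v‖ ^ 2 := real_inner_self_eq_norm_sq _
  have h4 := hle v
  rw [h2, h3] at hquad
  have h5 : K * ‖T v‖ ^ 2 ≤ K * (K * ‖v‖) ^ 2 := by
    nlinarith [mul_le_mul_of_nonneg_left h4 (sq_nonneg K)]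
  have h6 : ‖T v‖ ^ 2 ≤ (K * ‖v‖) ^ 2 := le_of_mul_le_mul_left h5 (by linarith)
  exact (sq_le_sq₀ (norm_nonneg _) (by positivity)).1 h6

end Calculus

/-! ### Inexact descent near a point of negative curvature -/

section Escape

variable {d : ℕ} {f : Vec d → ℝ} {l ρ : ℝ}

/-- `y` follows `n` steps of gradient descent with step size `η` and search directions `G`, whose
error is at most `e`. -/
structure IsInexactDescent (f : Vec d → ℝ) (η e : ℝ) (n : ℕ) (G y : ℕ → Vec d) : Prop where
  step : ∀ s < n, y (s + 1) = y s - η • G s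
  err : ∀ s < n, ‖G s - gradient f (y s)‖ ≤ e

namespace IsInexactDescent

variable {η e : ℝ} {n N : ℕ} {G y G' y' : ℕ → Vec d}

lemma mono (h : IsInexactDescent f η e N G y) (hn : n ≤ N) : IsInexactDescent f η e n G y :=
  ⟨fun s hs => h.step s (hs.trans_le hn), fun s hs => h.err s (hs.trans_le hn)⟩

/-- `IsSmooth.step_le` telescopes. The true gradients are discarded and the estimates `G` kept,
since the displacement is a sum of estimates. -/
lemma value_add_sum_le (hf : IsSmooth l f) (hη : 0 ≤ η) (h : IsInexactDescent f η e n G y) :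
    f (y n) + η / 2 * (1 - l * η) * ∑ s ∈ Finset.range n, ‖G s‖ ^ 2 ≤
      f (y 0) + n * (η / 2 * e ^ 2) := by
  induction n with
  | zero => simp
  | succ n ih =>
    have ih := ih (h.mono n.le_succ)
    have h1 := hf.step_le (y n) (G n) η
    rw [← h.step n n.lt_succ_self] at h1
    have h2 : ‖G n - gradient f (y n)‖ ^ 2 ≤ e ^ 2 := by gcongr; exact h.err n n.lt_succ_self
    have h3 := mul_le_mul_of_nonneg_left h2 (by positivity : 0 ≤ η / 2)
    have h4 : 0 ≤ η / 2 * ‖gradient f (y n)‖ ^ 2 := by positivity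
    rw [Finset.sum_range_succ, mul_add]
    push_cast
    linarith

lemma sub_eq_sum (h : IsInexactDescent f η e n G y) :
    y n - y 0 = -(η • ∑ s ∈ Finset.range n, G s) := by
  induction n with
  | zero => simp
  | succ n ih =>
    have ih := ih (h.mono n.le_succ)
    rw [h.step n n.lt_succ_self, Finset.sum_range_succ, smul_add, neg_add, ← ih]
    abel

/-- If the function value decreases little, the trajectory stays close to its start. -/
lemma norm_sub_sq_le (hf : IsSmooth l f) (hη : 0 < η) (hlη : l * η ≤ 1 / 3)
    (h : IsInexactDescent f η e N G y) (hn : n ≤ N) {D : ℝ}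
    (hD : f (y 0) - f (y N) + N * (η / 2 * e ^ 2) ≤ D) : ‖y n - y 0‖ ^ 2 ≤ 3 * η * n * D := by
  have h1 := h.value_add_sum_le hf hη.le
  have h2 : ∑ s ∈ Finset.range n, ‖G s‖ ^ 2 ≤ ∑ s ∈ Finset.range N, ‖G s‖ ^ 2 :=
    Finset.sum_le_sum_of_subset_of_nonneg (by simpa using hn) fun _ _ _ => by positivity
  have h3 : 0 ≤ ∑ s ∈ Finset.range N, ‖G s‖ ^ 2 := Finset.sum_nonneg fun _ _ => by positivity
  have h4 : η / 3 * ∑ s ∈ Finset.range N, ‖G s‖ ^ 2 ≤ D := by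
    -- This is where `l * η ≤ 1 / 3` is used; Cauchy–Schwarz then turns the bound on the sum of
    -- squares into one on the displacement.
    have : η / 3 ≤ η / 2 * (1 - l * η) := by nlinarith
    have := mul_le_mul_of_nonneg_right this h3
    linarith
  rw [(h.mono hn).sub_eq_sum, norm_neg, norm_smul, mul_pow, Real.norm_eq_abs, sq_abs]
  have h5 : ‖∑ s ∈ Finset.range n, G s‖ ^ 2 ≤ n * ∑ s ∈ Finset.range n, ‖G s‖ ^ 2 := by
    calc _ ≤ (∑ s ∈ Finset.range n, ‖G s‖) ^ 2 := by gcongr; exact norm_sum_le _ _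
      _ ≤ _ := by simpa using sq_sum_le_card_mul_sum_sq (s := Finset.range n) (f := fun s => ‖G s‖)
  calc η ^ 2 * ‖∑ s ∈ Finset.range n, G s‖ ^ 2
      ≤ η ^ 2 * (n * ∑ s ∈ Finset.range N, ‖G s‖ ^ 2) := by
        gcongr; exact h5.trans (by gcongr)
    _ = 3 * η * n * (η / 3 * ∑ s ∈ Finset.range N, ‖G s‖ ^ 2) := by ring
    _ ≤ 3 * η * n * D := by gcongr

/-- Two trajectories that start apart along the most negative curvature direction separate
exponentially as long as they stay where the Hessian is nearly constant. -/
lemma le_norm_sub (hs : IsSmooth l f) (hf : IsHessianLipschitz ρ f) (hl : 0 ≤ l) (hρ : 0 ≤ ρ)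
    (hη : 0 < η) (hηl : η * l ≤ 1) (he : 0 ≤ e)
    (h : IsInexactDescent f η e n G y) (h' : IsInexactDescent f η e n G' y')
    {x v : Vec d} {γ₁ μ R : ℝ} (hv : ‖v‖ = 1) (hγ : 0 < γ₁) (hμ : 0 ≤ μ)
    (heig : hessian f x v = -γ₁ • v) (hmin : ∀ w, -γ₁ * ‖w‖ ^ 2 ≤ ⟪hessian f x w, w⟫)
    (hR : ∀ s ≤ n, ‖y s - x‖ ≤ R) (hR' : ∀ s ≤ n, ‖y' s - x‖ ≤ R)
    (h0 : y 0 - y' 0 = μ • v) (hcurv : 3 / 2 * (η * (ρ * R)) * n ≤ 1 / 4)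
    (herr : 2 * e / γ₁ ≤ μ / 4) :
    (1 + η * γ₁) ^ n * (μ / 2) ≤ ‖y n - y' n‖ := by
  set K := 1 + η * γ₁ with hK
  have hK1 : 1 ≤ K := by rw [hK]; have := mul_pos hη hγ; linarith
  have hR0 : 0 ≤ R := (norm_nonneg _).trans (hR 0 (Nat.zero_le _))
  set A := 3 / 2 * (η * (ρ * R)) with hA
  have hA0 : 0 ≤ A := by positivity
  have hb0 : 0 ≤ 2 * e / γ₁ := by positivity
  -- The drift of the Hessian and the gradient noise each take a quarter of the main term `K ^ s *
  -- μ`, so half of it remains. Consequently the difference stays below `3/2 * K ^ s * μ`, the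
  -- source of the factor `3 / 2` in `A`.
  have hhalf : ∀ s ≤ n, K ^ s * (A * s * μ) + 2 * e / γ₁ * (K ^ s - 1) ≤ K ^ s * μ / 2 := by
    intro s hsn
    have hKs : 0 < K ^ s := by positivity
    have h1 : A * s * μ ≤ 1 / 4 * μ := by
      have : (s : ℝ) ≤ n := by exact_mod_cast hsn
      gcongr
      exact (mul_le_mul_of_nonneg_left this hA0).trans hcurv
    have h2 := mul_le_mul_of_nonneg_left h1 hKs.le
    have h3 := mul_le_mul_of_nonneg_right herr hKs.le
    nlinarith
  -- With exact gradients and a constant Hessian the difference would be `K ^ s μ v`, since `v` is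
  -- an eigenvector. The deviation has a Hessian part growing like `s K ^ s` and a noise part, the
  -- geometric sum `2 e η ∑ K ^ j = (2 e / γ₁) (K ^ s - 1)`.
  have hq : ∀ s ≤ n, ‖(K ^ s * μ) • v - (y s - y' s)‖ ≤
      K ^ s * (A * s * μ) + 2 * e / γ₁ * (K ^ s - 1) := by
    intro s
    induction s with
    | zero => intro _; simp [h0]
    | succ s ih =>
      intro hsn
      have ih := ih (by omega)
      have hsn' : s < n := by omega
      set w := y s - y' s with hw
      set q := (K ^ s * μ) • v - w with hqdef
      have hdec : (K ^ (s + 1) * μ) • v - (y (s + 1) - y' (s + 1)) =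
          (q - η • hessian f x q) +
            η • ((gradient f (y s) - gradient f (y' s) - hessian f x (y s - y' s)) +
              ((G s - gradient f (y s)) - (G' s - gradient f (y' s)))) := by
        rw [h.step s hsn', h'.step s hsn', hqdef, map_sub, map_smul, heig, hw, pow_succ, hK]
        module
      have h1 := norm_sub_smul_le (hf.inner_hessian_comm x) hη.le (norm_hessian_le hl hs hf x)
        hηl hγ.le hmin q
      have h2 := hf.norm_gradient_sub_le hρ x (y s) (y' s) (hR s hsn'.le) (hR' s hsn'.le)
      have h3 : ‖(G s - gradient f (y s)) - (G' s - gradient f (y' s))‖ ≤ 2 * e := by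
        refine (norm_sub_le _ _).trans ?_
        linarith [h.err s hsn', h'.err s hsn']
      have hwle : ‖w‖ ≤ 3 / 2 * (K ^ s * μ) := by
        have hw' : w = (K ^ s * μ) • v - q := by rw [hqdef]; abel
        have h4 : ‖w‖ ≤ ‖(K ^ s * μ) • v‖ + ‖q‖ := by
          conv_lhs => rw [hw']
          exact norm_sub_le _ _
        rw [norm_smul, hv, mul_one, Real.norm_of_nonneg (by positivity)] at h4
        have := hhalf s hsn'.le
        linarith
      rw [hdec]
      have h5 : ‖q - η • hessian f x q‖ ≤ K * ‖q‖ := h1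
      have h6 : ‖η • ((gradient f (y s) - gradient f (y' s) - hessian f x (y s - y' s)) +
              ((G s - gradient f (y s)) - (G' s - gradient f (y' s))))‖ ≤
            η * (ρ * R * (3 / 2 * (K ^ s * μ)) + 2 * e) := by
        rw [norm_smul, Real.norm_of_nonneg hη.le]
        gcongr
        refine (norm_add_le _ _).trans (add_le_add (h2.trans ?_) h3)
        gcongr
      refine (norm_add_le _ _).trans ((add_le_add h5 h6).trans ?_)
      have h7 : K * ‖q‖ ≤ K * (K ^ s * (A * s * μ) + 2 * e / γ₁ * (K ^ s - 1)) := by gcongr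
      have h8 : η * (ρ * R * (3 / 2 * (K ^ s * μ)) + 2 * e) = A * (K ^ s * μ) + 2 * e * η := by
        rw [hA]; ring
      have h9 : A * (K ^ s * μ) ≤ A * (K ^ (s + 1) * μ) := by
        gcongr
        exact s.le_succ
      have h10 : 2 * e / γ₁ * (K ^ (s + 1) - 1) =
          K * (2 * e / γ₁ * (K ^ s - 1)) + 2 * e * η := by
        have : 2 * e * η = 2 * e / γ₁ * (η * γ₁) := by field_simp
        rw [this, pow_succ, hK]; ring
      rw [h8, h10]
      push_cast
      have h11 : K ^ (s + 1) * (A * (s + 1) * μ) =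
          K * (K ^ s * (A * s * μ)) + A * (K ^ (s + 1) * μ) := by rw [pow_succ]; ring
      rw [h11]
      linarith
  have h1 := (hq n le_rfl).trans (hhalf n le_rfl)
  have h2 : ‖(K ^ n * μ) • v‖ ≤ ‖(K ^ n * μ) • v - (y n - y' n)‖ + ‖y n - y' n‖ := by
    simpa using norm_add_le ((K ^ n * μ) • v - (y n - y' n)) (y n - y' n)
  rw [norm_smul, hv, mul_one, Real.norm_of_nonneg (by positivity)] at h2
  linarith

end IsInexactDescent

lemma exp_half_le_one_add {z : ℝ} (h0 : 0 ≤ z) (h1 : z ≤ 1) : Real.exp (z / 2) ≤ 1 + z := by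
  have h : 1 - z / 2 ≤ Real.exp (-(z / 2)) := by
    have := Real.add_one_le_exp (-(z / 2)); linarith
  rw [Real.exp_neg] at h
  have h2 : 0 < Real.exp (z / 2) := Real.exp_pos _
  have h3 : (1 - z / 2) * Real.exp (z / 2) ≤ 1 := by
    have := mul_le_mul_of_nonneg_right h h2.le
    rwa [inv_mul_cancel₀ h2.ne'] at this
  nlinarith

/-- Final contradiction of the escape argument: the separation of two trajectories would be at least
`exp (5χ/2)` and at most `384 χ` in the same units. -/
lemma mul_lt_exp {χ : ℝ} (hχ : 4 ≤ χ) : 384 * χ < Real.exp (5 / 2 * χ) := by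
  have h8 : (2.7 : ℝ) ^ 8 ≤ Real.exp 8 := by
    have : Real.exp 8 = Real.exp 1 ^ 8 := by rw [← Real.exp_nat_mul]; norm_num
    rw [this]
    gcongr
    linarith [Real.exp_one_gt_d9]
  have h1 : Real.exp 8 ≤ Real.exp (2 * χ) := Real.exp_le_exp.2 (by linarith)
  have h2 := Real.add_one_le_exp (χ / 2)
  have h3 : Real.exp (5 / 2 * χ) = Real.exp (2 * χ) * Real.exp (χ / 2) := by
    rw [← Real.exp_add]; ring_nf
  rw [h3]
  have h4 : (2000 : ℝ) ≤ Real.exp (2 * χ) := by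
    refine le_trans ?_ (h8.trans h1); norm_num
  calc 384 * χ < 2000 * (χ / 2 + 1) := by linarith
    _ ≤ _ := by gcongr

/-- The relations between the scalar parameters used in the analysis of one escape attempt; `γ`
stands for `√(ρ ε)` and `ê` for the accuracy of the gradient estimates. -/
structure Regime (d : ℕ) (l ρ ε c χ γ ê : ℝ) : Prop where
  l_pos : 0 < l
  ρ_pos : 0 < ρ
  ε_pos : 0 < ε
  c_pos : 0 < c
  c_le : c ≤ 1 / 10 ^ 7
  χ_ge : 4 ≤ χ
  γ_pos : 0 < γ
  γ_le : γ ≤ l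
  γ_sq : γ ^ 2 = ρ * ε
  ê_nonneg : 0 ≤ ê
  ê_le : ê ≤ c / 1000 * (ε / χ ^ 2)
  ê_le_exp : ê ≤ c / 1000 * (√(d : ℝ) * ε / χ ^ 3 * Real.exp (-χ))
  d_pos : 1 ≤ d

namespace Regime

variable {ε c χ γ ê : ℝ}

lemma ê_le_thres (hp : Regime d l ρ ε c χ γ ê) : ê ≤ √c / χ ^ 2 * ε / 1000 := by
  have hc : c ≤ √c := by
    rw [Real.le_sqrt' hp.c_pos]
    nlinarith [hp.c_pos, hp.c_le]
  have := hp.ε_pos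
  have := hp.c_pos
  have := hp.χ_ge
  refine hp.ê_le.trans ?_
  calc c / 1000 * (ε / χ ^ 2) ≤ √c / 1000 * (ε / χ ^ 2) := by gcongr
    _ = _ := by ring

/-- Without a sufficient decrease, a perturbed trajectory is confined for a while. -/
lemma norm_sub_le_of_not_decrease (hp : Regime d l ρ ε c χ γ ê) (hs : IsSmooth l f) {N n : ℕ}
    (hN : (N : ℝ) ≤ χ / c ^ 2 * (l / γ)) (hnN : n ≤ N) (hn : (n : ℝ) ≤ 16 * χ * l / (c * γ))
    {x x' g : Vec d} (hx' : ‖x' - x‖ ≤ √c / χ ^ 2 * ε / l) (hg : ‖g‖ ≤ √c / χ ^ 2 * ε)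
    (hge : ‖g - gradient f x‖ ≤ ê) {G y : ℕ → Vec d} (h0 : y 0 = x' - (c / l) • g)
    (h : IsInexactDescent f (c / l) ê N G y)
    (hend : -(c / χ ^ 3 * (ε ^ 2 / γ)) < f (y N) - f x') :
    ‖y n - x‖ ≤ 12 * (√c * ε / (γ * χ)) := by
  obtain ⟨hl, hρ, hε, hc, hc7, hχ, hγ, hγl, hγ2, hê, hê1, hê2, hd⟩ := hp
  have hχ0 : 0 < χ := by linarith
  have hsc : √c ^ 2 = c := Real.sq_sqrt hc.le
  have hsc0 : 0 < √c := Real.sqrt_pos.2 hc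
  set sc := √c with hscdef
  set ft := c / χ ^ 3 * (ε ^ 2 / γ) with hft
  have hft0 : 0 < ft := by positivity
  set g0 := sc / χ ^ 2 * ε with hg0
  have hg00 : 0 < g0 := by positivity
  have hêg : ê ≤ g0 := by
    have := Regime.ê_le_thres ⟨hl, hρ, hε, hc, hc7, hχ, hγ, hγl, hγ2, hê, hê1, hê2, hd⟩
    linarith
  have hratio : γ / l ≤ 1 := (div_le_one hl).2 hγl
  -- the first step
  have hstart : f (y 0) ≤ f x' + ft / 8 := by
    have h1 := hs.step_le x' g (c / l)
    rw [← h0] at h1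
    have h2 : ‖g - gradient f x'‖ ≤ 2 * g0 := by
      have h3 : ‖gradient f x - gradient f x'‖ ≤ g0 := by
        rw [norm_sub_rev] at hx'
        refine (hs.2 x x').trans ?_
        calc l * ‖x - x'‖ ≤ l * (g0 / l) := by gcongr
          _ = g0 := by field_simp
      calc ‖g - gradient f x'‖ = ‖(g - gradient f x) + (gradient f x - gradient f x')‖ := by
            congr 1; abel
        _ ≤ _ := (norm_add_le _ _).trans (by linarith)
    have h4 : c / l / 2 * ‖g - gradient f x'‖ ^ 2 ≤ c / l / 2 * (2 * g0) ^ 2 := by gcongr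
    have h5 : c / l / 2 * (2 * g0) ^ 2 = ft * (2 * c * (γ / l) / χ) := by
      rw [hg0, hft, mul_pow, mul_pow, div_pow, hsc]; field_simp
    have h6 : 2 * c * (γ / l) / χ ≤ 1 / 8 := by
      rw [div_le_iff₀ hχ0]
      have : c * (γ / l) ≤ c * 1 := by gcongr
      linarith
    have h7 : 0 ≤ c / l / 2 * ‖gradient f x'‖ ^ 2 := by positivity
    have h8 : 0 ≤ c / l / 2 * (1 - l * (c / l)) * ‖g‖ ^ 2 := by
      have : l * (c / l) = c := by field_simp
      rw [this]
      have : 0 ≤ 1 - c := by linarith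
      positivity
    have h9 := mul_le_mul_of_nonneg_left h6 hft0.le
    linarith
  have hnoise : (N : ℝ) * (c / l / 2 * ê ^ 2) ≤ ft / 8 := by
    calc (N : ℝ) * (c / l / 2 * ê ^ 2)
        ≤ (χ / c ^ 2 * (l / γ)) * (c / l / 2 * (c / 1000 * (ε / χ ^ 2)) ^ 2) := by gcongr
      _ = ft * (1 / 2000000) := by rw [hft]; field_simp; norm_num
      _ ≤ _ := by linarith
  -- The missing decrease accounts for `ft`, the first step and the accumulated noise for `ft / 8`
  -- each.
  have hD : f (y 0) - f (y N) + N * (c / l / 2 * ê ^ 2) ≤ 5 / 4 * ft := by linarith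
  have hlη : l * (c / l) ≤ 1 / 3 := by
    have : l * (c / l) = c := by field_simp
    rw [this]; linarith
  have h1 := h.norm_sub_sq_le hs (by positivity) hlη hnN hD
  -- The horizon `16 χ l / (c γ)` turns the bound into `60 ≤ 8²` units `c ε² / (γχ)²`. The
  -- perturbation and the first step contribute at most four more units of length, hence the
  -- constant `12`.
  have h2 : ‖y n - y 0‖ ^ 2 ≤ (8 * (sc * ε / (γ * χ))) ^ 2 := by
    refine h1.trans ?_
    calc 3 * (c / l) * n * (5 / 4 * ft)
        ≤ 3 * (c / l) * (16 * χ * l / (c * γ)) * (5 / 4 * ft) := by gcongr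
      _ = 60 * (sc ^ 2 * ε ^ 2 / (γ ^ 2 * χ ^ 2)) := by rw [hft, hsc]; field_simp; norm_num
      _ ≤ 64 * (sc ^ 2 * ε ^ 2 / (γ ^ 2 * χ ^ 2)) := by gcongr; norm_num
      _ = _ := by field_simp; norm_num
  have h3 : ‖y n - y 0‖ ≤ 8 * (sc * ε / (γ * χ)) :=
    (sq_le_sq₀ (norm_nonneg _) (by positivity)).1 h2
  have h4 : ‖y 0 - x‖ ≤ 2 * (g0 / l) := by
    have : y 0 - x = (x' - x) - (c / l) • g := by rw [h0]; abel
    rw [this]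
    refine (norm_sub_le _ _).trans ?_
    rw [norm_smul, Real.norm_of_nonneg (by positivity)]
    have : c / l * ‖g‖ ≤ 1 / l * g0 := by gcongr; linarith
    have h5 : 1 / l * g0 = g0 / l := by ring
    linarith
  have h5 : 2 * (g0 / l) ≤ 4 * (sc * ε / (γ * χ)) := by
    have : 2 * (g0 / l) = (sc * ε / (γ * χ)) * (2 * (γ / l) / χ) := by
      rw [hg0]; field_simp
    rw [this, mul_comm (4 : ℝ)]
    gcongr
    rw [div_le_iff₀ hχ0]
    linarith
  calc ‖y n - x‖ = ‖(y n - y 0) + (y 0 - x)‖ := by congr 1; abel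
    _ ≤ _ := (norm_add_le _ _).trans (by linarith)

set_option maxHeartbeats 1000000 in
/-- Of two perturbations of a point with negative curvature whose difference along the most
negative curvature direction is not tiny, at least one leads to a sufficient decrease. -/
lemma abs_lt_of_not_decrease (hp : Regime d l ρ ε c χ γ ê) (hs : IsSmooth l f)
    (hf : IsHessianLipschitz ρ f) {N : ℕ}
    (hN : (N : ℝ) ≤ χ / c ^ 2 * (l / γ)) (hN' : χ / c ^ 2 * (l / γ) ≤ N + 1)
    {x x₁ x₂ g v : Vec d} {γ₁ μ : ℝ} (hv : ‖v‖ = 1) (hγ₁ : γ / 2 ≤ γ₁)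
    (heig : hessian f x v = -γ₁ • v) (hmin : ∀ w, -γ₁ * ‖w‖ ^ 2 ≤ ⟪hessian f x w, w⟫)
    (hx₁ : ‖x₁ - x‖ ≤ √c / χ ^ 2 * ε / l) (hx₂ : ‖x₂ - x‖ ≤ √c / χ ^ 2 * ε / l)
    (hμ : x₁ - x₂ = μ • v) (hg : ‖g‖ ≤ √c / χ ^ 2 * ε) (hge : ‖g - gradient f x‖ ≤ ê)
    {G₁ y₁ G₂ y₂ : ℕ → Vec d} (h₁0 : y₁ 0 = x₁ - (c / l) • g) (h₂0 : y₂ 0 = x₂ - (c / l) • g)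
    (h₁ : IsInexactDescent f (c / l) ê N G₁ y₁) (h₂ : IsInexactDescent f (c / l) ê N G₂ y₂)
    (h₁N : -(c / χ ^ 3 * (ε ^ 2 / γ)) < f (y₁ N) - f x₁)
    (h₂N : -(c / χ ^ 3 * (ε ^ 2 / γ)) < f (y₂ N) - f x₂) :
    |μ| < 1 / 8 * √(d : ℝ) * (l / γ) * Real.exp (-χ) * (√c / χ ^ 2 * ε / l) := by
  wlog hμ0 : 0 ≤ μ generalizing μ x₁ x₂ G₁ G₂ y₁ y₂
  · rw [← abs_neg]
    exact this hx₂ hx₁ (by rw [neg_smul, ← hμ]; abel) h₂0 h₁0 h₂ h₁ h₂N h₁N (by linarith)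
  rw [abs_of_nonneg hμ0]
  by_contra hcon
  rw [not_lt] at hcon
  have hloc₁ := fun n hn hn' => hp.norm_sub_le_of_not_decrease hs hN (n := n) hn hn'
    hx₁ hg hge h₁0 h₁ h₁N
  have hloc₂ := fun n hn hn' => hp.norm_sub_le_of_not_decrease hs hN (n := n) hn hn'
    hx₂ hg hge h₂0 h₂ h₂N
  obtain ⟨hl, hρ, hε, hc, hc7, hχ, hγ, hγl, hγ2, hê, hê1, hê2, hd⟩ := hp
  have hχ0 : 0 < χ := by linarith
  have hsc : √c ^ 2 = c := Real.sq_sqrt hc.le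
  have hsc0 : 0 < √c := Real.sqrt_pos.2 hc
  -- The bound `288 √c ≤ 1/4` needed for the Hessian drift; the assumption `c ≤ 1 / 10 ^ 7` provides
  -- it.
  have hsc1 : √c ≤ 1 / 1152 := by
    rw [Real.sqrt_le_iff]; exact ⟨by norm_num, hc7.trans (by norm_num)⟩
  set sc := √c with hscdef
  set R := 12 * (sc * ε / (γ * χ)) with hR
  -- Long enough for growth by `exp (7χ/2)`, and much shorter than the window because `c` is small,
  -- so that the confinement radius stays small.
  set n := ⌊16 * χ * l / (c * γ)⌋₊ with hn
  have hn1 : (n : ℝ) ≤ 16 * χ * l / (c * γ) := Nat.floor_le (by positivity)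
  have hn2 : 16 * χ * l / (c * γ) < n + 1 := Nat.lt_floor_add_one _
  have hlγ : 1 ≤ l / γ := (one_le_div hγ).2 hγl
  have hnN : n ≤ N := by
    have h1 : 16 * χ * l / (c * γ) + 1 ≤ χ / c ^ 2 * (l / γ) := by
      have h2 : 16 * χ * l / (c * γ) = (χ / c * (l / γ)) * 16 := by field_simp
      have h3 : χ / c ^ 2 * (l / γ) = (χ / c * (l / γ)) * (1 / c) := by field_simp
      have h4 : 17 ≤ 1 / c := by rw [le_div_iff₀ hc]; linarith
      have h5 : 1 ≤ χ / c * (l / γ) := by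
        have : 1 ≤ χ / c := by rw [le_div_iff₀ hc]; linarith
        nlinarith
      rw [h2, h3]
      nlinarith
    have : (n : ℝ) ≤ N := by linarith
    exact_mod_cast this
  have hd1 : 1 ≤ √(d : ℝ) := by rw [Real.one_le_sqrt]; exact_mod_cast hd
  have hcurv : 3 / 2 * (c / l * (ρ * R)) * n ≤ 1 / 4 := by
    calc 3 / 2 * (c / l * (ρ * R)) * n
        ≤ 3 / 2 * (c / l * (ρ * R)) * (16 * χ * l / (c * γ)) := by gcongr
      _ = 288 * sc * ((ρ * ε) / γ ^ 2) := by rw [hR]; field_simp; norm_num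
      _ = 288 * sc := by rw [← hγ2, div_self (by positivity), mul_one]
      _ ≤ 1 / 4 := by linarith
  -- The exponentially small entry of the accuracy bound is chosen for this: the noise must not mask
  -- the separation `μ`, itself of order `√d exp (-χ)` times the radius.
  have herr : 2 * ê / γ₁ ≤ μ / 4 := by
    set X := Real.exp (-χ) with hX
    have hX0 : 0 < X := Real.exp_pos _
    set S := √(d : ℝ) with hS
    calc 2 * ê / γ₁ ≤ 2 * (c / 1000 * (S * ε / χ ^ 3 * X)) / (γ / 2) := by
          gcongr
      _ = (1 / 8 * S * (l / γ) * X * (sc / χ ^ 2 * ε / l)) *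
            (sc * (32 / 1000) / χ) := by
          rw [← hsc]; field_simp; norm_num
      _ ≤ (1 / 8 * S * (l / γ) * X * (sc / χ ^ 2 * ε / l)) * (1 / 4) := by
          gcongr ?_ * ?_
          rw [div_le_iff₀ hχ0]
          linarith
      _ ≤ μ * (1 / 4) := by gcongr
      _ = μ / 4 := by ring
  have hgrow := (h₁.mono hnN).le_norm_sub hs hf hl.le hρ.le (by positivity)
    (by rw [div_mul_cancel₀ _ hl.ne']; linarith) hê (h₂.mono hnN) (R := R) hv (by linarith) hμ0
    heig hmin
    (fun s hs => hloc₁ s (hs.trans hnN) (le_trans (by exact_mod_cast hs) hn1))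
    (fun s hs => hloc₂ s (hs.trans hnN) (le_trans (by exact_mod_cast hs) hn1))
    (by rw [h₁0, h₂0, sub_sub_sub_cancel_right, hμ])
    hcurv herr
  have hup : ‖y₁ n - y₂ n‖ ≤ 2 * R := by
    have h1 := hloc₁ n hnN hn1
    have h2 := hloc₂ n hnN hn1
    calc ‖y₁ n - y₂ n‖ = ‖(y₁ n - x) - (y₂ n - x)‖ := by congr 1; abel
      _ ≤ _ := (norm_sub_le _ _).trans (by linarith)
  -- With `z = η γ / 2` one has `(1 + z) ^ n ≥ exp (n z / 2)`. Without rounding the exponent would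
  -- be `4 χ`; the floor costs at most `1/2`.
  have hexp : Real.exp (7 / 2 * χ) ≤ (1 + c / l * γ₁) ^ n := by
    set z := c / l * (γ / 2) with hz
    have hz0 : 0 < z := by positivity
    have hz1 : z ≤ 1 := by
      have : z = c * (γ / l) / 2 := by rw [hz]; field_simp
      rw [this]
      have : c * (γ / l) ≤ 1 * 1 := by
        gcongr
        · linarith
        · exact (div_le_one hl).2 hγl
      linarith
    have h1 : Real.exp (n * (z / 2)) ≤ (1 + z) ^ n := by
      rw [Real.exp_nat_mul]
      gcongr
      exact exp_half_le_one_add hz0.le hz1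
    have h2 : (1 + z) ^ n ≤ (1 + c / l * γ₁) ^ n := by rw [hz]; gcongr
    refine le_trans (Real.exp_le_exp.2 ?_) (h1.trans h2)
    have h3 : (16 * χ * l / (c * γ) - 1) * (z / 2) ≤ n * (z / 2) := by gcongr; linarith
    have h4 : (16 * χ * l / (c * γ)) * (z / 2) = 4 * χ := by rw [hz]; field_simp; norm_num
    linarith
  have hfin : Real.exp (7 / 2 * χ) *
      ((1 / 8 * (l / γ) * Real.exp (-χ) * (sc / χ ^ 2 * ε / l)) / 2) ≤ 2 * R := by
    refine le_trans ?_ (hgrow.trans hup)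
    have hγ₁0 : 0 < γ₁ := by linarith
    refine mul_le_mul hexp ?_ (by positivity) (by positivity)
    gcongr
    refine le_trans ?_ hcon
    have : 1 / 8 * 1 * (l / γ) * Real.exp (-χ) * (sc / χ ^ 2 * ε / l) ≤
      1 / 8 * √(d : ℝ) * (l / γ) * Real.exp (-χ) * (sc / χ ^ 2 * ε / l) := by gcongr
    simpa using this
  have h1 : Real.exp (7 / 2 * χ) *
      ((1 / 8 * (l / γ) * Real.exp (-χ) * (sc / χ ^ 2 * ε / l)) / 2) =
      Real.exp (5 / 2 * χ) * (sc * ε / (16 * γ * χ ^ 2)) := by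
    have : Real.exp (7 / 2 * χ) = Real.exp (5 / 2 * χ) * Real.exp χ := by
      rw [← Real.exp_add]; ring_nf
    rw [this, Real.exp_neg]
    field_simp; norm_num
  have h2 : 2 * R = 384 * χ * (sc * ε / (16 * γ * χ ^ 2)) := by
    rw [hR]; field_simp; norm_num
  rw [h1, h2] at hfin
  have h3 : 0 < sc * ε / (16 * γ * χ ^ 2) := by positivity
  have := le_of_mul_le_mul_right hfin h3
  linarith [mul_lt_exp hχ]

end Regime

end Escape

/-! ### Exponential moments of Gaussian functionals -/

section Gaussian

/-- The factor `exp (x² / 4)` halves the exponent of the density, that is, it doubles the variance.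
-/
lemma integrable_exp_sq_gaussianReal :
    Integrable (fun x : ℝ => Real.exp (x ^ 2 / 4)) (gaussianReal 0 1) ∧
      ∫ x, Real.exp (x ^ 2 / 4) ∂(gaussianReal 0 1) = √2 := by
  have h1 : ∀ x : ℝ, gaussianPDFReal 0 1 x * Real.exp (x ^ 2 / 4) =
      (√(2 * Real.pi))⁻¹ * Real.exp (-(1 / 4) * x ^ 2) := fun x => by
    rw [gaussianPDFReal, mul_assoc, ← Real.exp_add]
    simp only [NNReal.coe_one, mul_one, sub_zero]
    congr 2
    ring
  constructor
  · rw [gaussianReal_of_var_ne_zero _ one_ne_zero, integrable_withDensity_iff_integrable_smul']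
    · simp only [toReal_gaussianPDF, smul_eq_mul, h1]
      exact (integrable_exp_neg_mul_sq (by norm_num)).const_mul _
    · exact measurable_gaussianPDF 0 1
    · exact Filter.Eventually.of_forall fun x => by simp [gaussianPDF]
  · rw [integral_gaussianReal_eq_integral_smul one_ne_zero]
    simp only [smul_eq_mul, h1]
    rw [integral_const_mul, integral_gaussian, ← Real.sqrt_inv, ← Real.sqrt_mul (by positivity)]
    congr 1
    field_simp
    norm_num

variable {d : ℕ}

lemma map_inner_stdGaussian {w : Vec d} (hw : ‖w‖ = 1) :
    (stdGaussian (Vec d)).map (fun u => ⟪w, u⟫) = gaussianReal 0 1 := by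
  have h := IsGaussian.map_eq_gaussianReal (μ := stdGaussian (Vec d)) (innerSL ℝ w)
  rw [integral_strongDual_stdGaussian, variance_dual_stdGaussian, innerSL_apply_norm, hw] at h
  simpa using h

lemma integrable_exp_inner_sq {w : Vec d} (hw : ‖w‖ ≤ 1) :
    Integrable (fun u : Vec d => Real.exp (⟪w, u⟫ ^ 2 / 4)) (stdGaussian (Vec d)) ∧
      ∫ u, Real.exp (⟪w, u⟫ ^ 2 / 4) ∂(stdGaussian (Vec d)) ≤ √2 := by
  have hunit : ∀ v : Vec d, ‖v‖ = 1 →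
      Integrable (fun u : Vec d => Real.exp (⟪v, u⟫ ^ 2 / 4)) (stdGaussian (Vec d)) ∧
      ∫ u, Real.exp (⟪v, u⟫ ^ 2 / 4) ∂(stdGaussian (Vec d)) = √2 := by
    intro v hv
    have h := integrable_exp_sq_gaussianReal
    rw [← map_inner_stdGaussian hv] at h
    have hm : AEMeasurable (fun u : Vec d => ⟪v, u⟫) (stdGaussian (Vec d)) :=
      Measurable.aemeasurable (by fun_prop)
    rw [integral_map hm (Continuous.aestronglyMeasurable (by fun_prop))] at h
    exact ⟨h.1.comp_aemeasurable hm, h.2⟩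
  rcases eq_or_ne w 0 with rfl | hw0
  · simp
  have hn : ‖w‖ ≠ 0 := norm_ne_zero_iff.2 hw0
  obtain ⟨hi, he⟩ := hunit (‖w‖⁻¹ • w) (by rw [norm_smul, norm_inv, norm_norm, inv_mul_cancel₀ hn])
  have hle : ∀ u : Vec d, Real.exp (⟪w, u⟫ ^ 2 / 4) ≤
      Real.exp (⟪‖w‖⁻¹ • w, u⟫ ^ 2 / 4) := fun u => by
    rw [Real.exp_le_exp, inner_smul_left, mul_pow]
    simp only [conj_trivial]
    have : 1 ≤ ‖w‖⁻¹ ^ 2 := one_le_pow₀ ((one_le_inv₀ (by positivity)).2 hw)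
    gcongr
    nlinarith [sq_nonneg ⟪w, u⟫]
  have hi' : Integrable (fun u : Vec d => Real.exp (⟪w, u⟫ ^ 2 / 4)) (stdGaussian (Vec d)) := by
    refine hi.mono (Continuous.aestronglyMeasurable (by fun_prop))
      (Filter.Eventually.of_forall fun u => ?_)
    rw [Real.norm_of_nonneg (Real.exp_pos _).le, Real.norm_of_nonneg (Real.exp_pos _).le]
    exact hle u
  exact ⟨hi', he ▸ integral_mono hi' hi hle⟩

/-- By convexity of `exp`, the integrand is at most the average over coordinates of `exp (uᵢ² / 4)`.
Independence of the coordinates is not needed. -/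
lemma integrable_exp_norm_sq (hd : 1 ≤ d) :
    Integrable (fun u : Vec d => Real.exp (‖u‖ ^ 2 / (4 * d))) (stdGaussian (Vec d)) ∧
      ∫ u, Real.exp (‖u‖ ^ 2 / (4 * d)) ∂(stdGaussian (Vec d)) ≤ √2 := by
  have hd0 : (0 : ℝ) < d := by exact_mod_cast hd
  set b := EuclideanSpace.basisFun (Fin d) ℝ
  have hb : ∀ i, ‖b i‖ ≤ 1 := fun i => (b.norm_eq_one i).le
  have hle : ∀ u : Vec d, Real.exp (‖u‖ ^ 2 / (4 * d)) ≤
      ∑ i, (1 / d : ℝ) * Real.exp (⟪b i, u⟫ ^ 2 / 4) := fun u => by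
    have := convexOn_exp.map_sum_le (t := Finset.univ) (w := fun _ : Fin d => (1 / d : ℝ))
      (p := fun i => ⟪b i, u⟫ ^ 2 / 4) (fun _ _ => by positivity)
      (by simp; field_simp) (fun _ _ => Set.mem_univ _)
    simp only [smul_eq_mul] at this
    refine le_trans (le_of_eq ?_) this
    rw [← b.sum_sq_inner_right u]
    simp only [← Finset.mul_sum, ← Finset.sum_div]
    congr 1
    field_simp
  have hi := integrable_finsetSum Finset.univ
    (fun i _ => (integrable_exp_inner_sq (hb i)).1.const_mul (1 / d : ℝ))
  have hi' : Integrable (fun u : Vec d => Real.exp (‖u‖ ^ 2 / (4 * d))) (stdGaussian (Vec d)) := by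
    refine hi.mono (Continuous.aestronglyMeasurable (by fun_prop))
      (Filter.Eventually.of_forall fun u => ?_)
    rw [Real.norm_of_nonneg (Real.exp_pos _).le]
    exact (hle u).trans (Real.le_norm_self _)
  refine ⟨hi', (integral_mono hi' hi hle).trans ?_⟩
  rw [integral_finsetSum _ fun i _ => (integrable_exp_inner_sq (hb i)).1.const_mul _]
  simp only [integral_const_mul]
  calc _ ≤ ∑ i : Fin d, (1 / d : ℝ) * √2 := by
        gcongr with i; exact (integrable_exp_inner_sq (hb i)).2
    _ = √2 := by simp; field_simp

lemma memLp_inner_stdGaussian (a : Vec d) :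
    MemLp (fun u : Vec d => ⟪a, u⟫) 2 (stdGaussian (Vec d)) :=
  (innerSL ℝ a).comp_memLp' (IsGaussian.memLp_two_id (μ := stdGaussian (Vec d)))

lemma integral_inner_mul_inner (a w : Vec d) :
    Integrable (fun u : Vec d => ⟪a, u⟫ * ⟪w, u⟫) (stdGaussian (Vec d)) ∧
      ∫ u, ⟪a, u⟫ * ⟪w, u⟫ ∂(stdGaussian (Vec d)) = ⟪a, w⟫ := by
  refine ⟨(memLp_inner_stdGaussian a).integrable_mul (memLp_inner_stdGaussian w), ?_⟩
  have h := covarianceBilin_apply (IsGaussian.memLp_two_id (μ := stdGaussian (Vec d))) a w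
  rw [covarianceBilin_stdGaussian] at h
  simp only [id] at h
  rw [integral_id_stdGaussian] at h
  simp only [sub_zero] at h
  exact h.symm

lemma exp_le_one_add_add_sq_mul (z : ℝ) :
    Real.exp z ≤ 1 + z + z ^ 2 * Real.exp |z| := by
  have h := Complex.norm_exp_sub_sum_le_norm_mul_exp (z : ℂ) 2
  simp only [Finset.sum_range_succ, Finset.sum_range_zero, pow_zero, Nat.factorial_zero,
    Nat.factorial_one, Nat.cast_one, div_one, pow_one, zero_add] at h
  have h1 : Complex.exp z - (1 + z) = ((Real.exp z - (1 + z) : ℝ) : ℂ) := by push_cast; rfl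
  rw [h1, Complex.norm_real, Complex.norm_real, Real.norm_eq_abs, Real.norm_eq_abs, sq_abs] at h
  linarith [le_abs_self (Real.exp z - (1 + z))]

lemma exp_quarter_mul_sqrt_two_le : Real.exp (1 / 4) * √2 ≤ 2 := by
  have h1 : Real.exp (1 / 4) ≤ 1 / (1 - 1 / 4) := by
    have := Real.exp_bound_div_one_sub_of_interval' (x := 1 / 4) (by norm_num) (by norm_num)
    exact this.le
  have h2 : √2 ≤ 3 / 2 := by rw [Real.sqrt_le_iff]; norm_num
  calc Real.exp (1 / 4) * √2 ≤ (1 / (1 - 1 / 4)) * (3 / 2) := by gcongr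
    _ = 2 := by norm_num

/-- Moment generating function of a centered product of two Gaussian functionals. -/
lemma lintegral_exp_inner_mul_inner_le {a w : Vec d} {B lam : ℝ} (hB : 0 < B) (ha : ‖a‖ ≤ B)
    (hw : ‖w‖ ≤ 1) (hlam : 0 ≤ lam) (hlamB : lam * B ≤ 1 / 16) :
    ∫⁻ u, ENNReal.ofReal (Real.exp (lam * (⟪a, u⟫ * ⟪w, u⟫ - ⟪a, w⟫))) ∂(stdGaussian (Vec d)) ≤
      ENNReal.ofReal (Real.exp (128 * (lam * B) ^ 2)) := by
  set s : Vec d → ℝ := fun u => ⟪B⁻¹ • a, u⟫ with hs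
  set t : Vec d → ℝ := fun u => ⟪w, u⟫ with ht
  have hBa : ‖B⁻¹ • a‖ ≤ 1 := by
    rw [norm_smul, norm_inv, Real.norm_of_nonneg hB.le, inv_mul_le_iff₀ hB]; simpa using ha
  -- Integrable majorant of `exp (Q / 4)` for `Q = (s² + t²)/2 + 1`, obtained from `2xy ≤ x² + y²`;
  -- its integral is at most `2`.
  set W : Vec d → ℝ := fun u =>
    Real.exp (1 / 4) * ((Real.exp (s u ^ 2 / 4) + Real.exp (t u ^ 2 / 4)) / 2) with hW
  have hWi : Integrable W (stdGaussian (Vec d)) :=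
    (((integrable_exp_inner_sq hBa).1.add (integrable_exp_inner_sq hw).1).div_const 2).const_mul _
  have hWle : ∫ u, W u ∂(stdGaussian (Vec d)) ≤ 2 := by
    rw [hW, integral_const_mul, integral_div, integral_add (integrable_exp_inner_sq hBa).1
      (integrable_exp_inner_sq hw).1]
    refine le_trans ?_ exp_quarter_mul_sqrt_two_le
    gcongr
    linarith [(integrable_exp_inner_sq hBa).2, (integrable_exp_inner_sq hw).2]
  obtain ⟨hZi, hZ⟩ := integral_inner_mul_inner a w
  have hpt : ∀ u : Vec d, Real.exp (lam * (⟪a, u⟫ * ⟪w, u⟫ - ⟪a, w⟫)) ≤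
      1 + lam * (⟪a, u⟫ * ⟪w, u⟫ - ⟪a, w⟫) + 57 * (lam * B) ^ 2 * W u := by
    intro u
    set Q := (s u ^ 2 + t u ^ 2) / 2 + 1 with hQ
    have hQ1 : 0 ≤ Q := by positivity
    have hZQ : |⟪a, u⟫ * ⟪w, u⟫ - ⟪a, w⟫| ≤ B * Q := by
      have h1 : ⟪a, u⟫ = B * s u := by
        simp only [hs, inner_smul_left, conj_trivial]; field_simp
      have h2 : |⟪a, u⟫ * ⟪w, u⟫| ≤ B * ((s u ^ 2 + t u ^ 2) / 2) := by
        rw [h1, mul_assoc, abs_mul, abs_of_pos hB]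
        gcongr
        change |s u * t u| ≤ _
        rw [abs_le]
        constructor <;> nlinarith [sq_nonneg (s u + t u), sq_nonneg (s u - t u)]
      have h3 : |⟪a, w⟫| ≤ B := by
        refine (abs_real_inner_le_norm _ _).trans ?_
        calc ‖a‖ * ‖w‖ ≤ B * 1 := by gcongr
          _ = B := mul_one B
      refine (abs_sub _ _).trans ?_
      rw [hQ, mul_add, mul_one]
      exact add_le_add h2 h3
    set z := lam * (⟪a, u⟫ * ⟪w, u⟫ - ⟪a, w⟫) with hz
    have hzabs : |z| ≤ lam * B * Q := by
      rw [hz, abs_mul, abs_of_nonneg hlam, mul_assoc]; gcongr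
    have hz16 : |z| ≤ Q / 16 := hzabs.trans (by nlinarith)
    refine (exp_le_one_add_add_sq_mul z).trans (add_le_add le_rfl ?_)
    have h1 : z ^ 2 ≤ (lam * B * Q) ^ 2 := by rw [← sq_abs]; gcongr
    -- From `x² / 2 ≤ exp x` at `x = 3Q/16`, as `2 (16/3)² < 57`. Together with `|z| ≤ Q / 16` the
    -- exponents add up to `Q / 4`. After integration the centered linear term vanishes and `57 * 2
    -- ≤ 128`.
    have h2 : Q ^ 2 ≤ 57 * Real.exp (3 * Q / 16) := by
      have := Real.quadratic_le_exp_of_nonneg (x := 3 * Q / 16) (by positivity)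
      nlinarith
    have h3 : Real.exp (Q / 4) ≤ W u := by
      have h4 : Real.exp (Q / 4) = Real.exp (1 / 4) *
          (Real.exp (s u ^ 2 / 8) * Real.exp (t u ^ 2 / 8)) := by
        rw [← Real.exp_add, ← Real.exp_add, hQ]; ring_nf
      rw [h4]
      simp only [hW]
      gcongr
      have h5 : Real.exp (s u ^ 2 / 4) = Real.exp (s u ^ 2 / 8) ^ 2 := by
        rw [← Real.exp_nat_mul]; congr 1; push_cast; ring
      have h6 : Real.exp (t u ^ 2 / 4) = Real.exp (t u ^ 2 / 8) ^ 2 := by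
        rw [← Real.exp_nat_mul]; congr 1; push_cast; ring
      rw [h5, h6]
      nlinarith [sq_nonneg (Real.exp (s u ^ 2 / 8) - Real.exp (t u ^ 2 / 8))]
    calc z ^ 2 * Real.exp |z| ≤ (lam * B * Q) ^ 2 * Real.exp (Q / 16) := by gcongr
      _ = (lam * B) ^ 2 * (Q ^ 2 * Real.exp (Q / 16)) := by ring
      _ ≤ (lam * B) ^ 2 * ((57 * Real.exp (3 * Q / 16)) * Real.exp (Q / 16)) := by gcongr
      _ = 57 * (lam * B) ^ 2 * Real.exp (Q / 4) := by
        rw [mul_assoc 57, ← Real.exp_add]; ring_nf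
      _ ≤ 57 * (lam * B) ^ 2 * W u := by gcongr
  have hint1 : Integrable (fun u : Vec d => 1 + lam * (⟪a, u⟫ * ⟪w, u⟫ - ⟪a, w⟫))
      (stdGaussian (Vec d)) :=
    (integrable_const _).add ((hZi.sub (integrable_const _)).const_mul _)
  have hint : Integrable (fun u : Vec d => 1 + lam * (⟪a, u⟫ * ⟪w, u⟫ - ⟪a, w⟫) +
      57 * (lam * B) ^ 2 * W u) (stdGaussian (Vec d)) := hint1.add (hWi.const_mul _)
  calc _ ≤ ∫⁻ u, ENNReal.ofReal (1 + lam * (⟪a, u⟫ * ⟪w, u⟫ - ⟪a, w⟫) +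
        57 * (lam * B) ^ 2 * W u) ∂(stdGaussian (Vec d)) :=
        lintegral_mono fun u => ENNReal.ofReal_le_ofReal (hpt u)
    _ = ENNReal.ofReal (∫ u, (1 + lam * (⟪a, u⟫ * ⟪w, u⟫ - ⟪a, w⟫) +
        57 * (lam * B) ^ 2 * W u) ∂(stdGaussian (Vec d))) := by
        rw [ofReal_integral_eq_lintegral_ofReal hint]
        exact Filter.Eventually.of_forall fun u => (Real.exp_pos _).le.trans (hpt u)
    _ ≤ _ := by
        refine ENNReal.ofReal_le_ofReal ?_
        have hZ0 : ∫ u, (1 + lam * (⟪a, u⟫ * ⟪w, u⟫ - ⟪a, w⟫)) ∂(stdGaussian (Vec d)) = 1 := by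
          have h := integral_sub hZi (integrable_const ⟪a, w⟫)
          rw [hZ] at h
          have h' := integral_add (integrable_const (1 : ℝ))
            ((hZi.sub (integrable_const ⟪a, w⟫)).const_mul lam)
          simp only [Pi.sub_apply] at h'
          rw [h', integral_const_mul, h]
          simp
        rw [integral_add hint1 (hWi.const_mul _), integral_const_mul, hZ0]
        have h1 := Real.add_one_le_exp (128 * (lam * B) ^ 2)
        have h2 : 57 * (lam * B) ^ 2 * ∫ u, W u ∂(stdGaussian (Vec d)) ≤
          57 * (lam * B) ^ 2 * 2 := by gcongr
        nlinarith [sq_nonneg (lam * B)]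

/-- Moment generating function of a remainder of cubic order with quadratic growth. -/
lemma lintegral_exp_remainder_le (hd : 1 ≤ d) {B K lam : ℝ} (hK : 0 ≤ K)
    (hlam : 0 ≤ lam) (hlamB : lam * B * d ≤ 1 / 32) {Y : Vec d → ℝ} (hY0 : ∀ u, 0 ≤ Y u)
    (hY2 : ∀ u, Y u ≤ 2 * B * ‖u‖ ^ 2) (hY3 : ∀ u, Y u ≤ K * ‖u‖ ^ 3) :
    ∫⁻ u, ENNReal.ofReal (Real.exp (lam * Y u)) ∂(stdGaussian (Vec d)) ≤
      ENNReal.ofReal (Real.exp (48 * lam * K * √(d : ℝ) ^ 3)) := by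
  have hd0 : (0 : ℝ) < d := by exact_mod_cast hd
  obtain ⟨hi, hle⟩ := integrable_exp_norm_sq hd
  -- In `exp z ≤ 1 + z exp z`, the cubic bound is used for the prefactor, to make it small, and the
  -- quadratic bound for the exponent, to keep it integrable. Lengths are normalized by `√d`, and
  -- `32 * 3/2 = 48`.
  have hpt : ∀ u : Vec d, Real.exp (lam * Y u) ≤
      1 + 32 * lam * K * √(d : ℝ) ^ 3 * Real.exp (‖u‖ ^ 2 / (4 * d)) := by
    intro u
    have hs0 : 0 < √(d : ℝ) := Real.sqrt_pos.2 hd0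
    set n := ‖u‖ / √(d : ℝ) with hn
    have hn0 : 0 ≤ n := by positivity
    have hnu : ‖u‖ = n * √(d : ℝ) := by rw [hn]; field_simp
    have hn2 : ‖u‖ ^ 2 = n ^ 2 * d := by rw [hnu, mul_pow, Real.sq_sqrt hd0.le]
    have hz : lam * Y u ≤ n ^ 2 / 16 := by
      have := mul_le_mul_of_nonneg_left (hY2 u) hlam
      rw [hn2] at this
      nlinarith [mul_le_mul_of_nonneg_right hlamB (sq_nonneg n)]
    have hz0 : 0 ≤ lam * Y u := mul_nonneg hlam (hY0 u)
    have h1 : Real.exp (lam * Y u) ≤ 1 + lam * Y u * Real.exp (lam * Y u) := by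
      have := Real.add_one_le_exp (-(lam * Y u))
      have h2 := mul_le_mul_of_nonneg_right this (Real.exp_pos (lam * Y u)).le
      rw [← Real.exp_add, neg_add_cancel, Real.exp_zero] at h2
      linarith
    have h3 : n ^ 3 ≤ 32 * Real.exp (3 * n ^ 2 / 16) := by
      have := Real.quadratic_le_exp_of_nonneg (x := 3 * n ^ 2 / 16) (by positivity)
      have h4 : n ^ 3 ≤ (n ^ 2 + n ^ 4) / 2 := by nlinarith [sq_nonneg (n - n ^ 2)]
      nlinarith
    refine h1.trans ?_
    gcongr 1 + ?_
    calc lam * Y u * Real.exp (lam * Y u)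
        ≤ lam * (K * ‖u‖ ^ 3) * Real.exp (n ^ 2 / 16) := by gcongr; exact hY3 u
      _ = lam * K * √(d : ℝ) ^ 3 * (n ^ 3 * Real.exp (n ^ 2 / 16)) := by rw [hnu]; ring
      _ ≤ lam * K * √(d : ℝ) ^ 3 * ((32 * Real.exp (3 * n ^ 2 / 16)) * Real.exp (n ^ 2 / 16)) := by
        gcongr
      _ = 32 * lam * K * √(d : ℝ) ^ 3 * Real.exp (n ^ 2 / 4) := by
        rw [mul_assoc 32, ← Real.exp_add]; ring_nf
      _ = _ := by rw [hn2]; congr 2; field_simp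
  have hint : Integrable (fun u : Vec d => 1 + 32 * lam * K * √(d : ℝ) ^ 3 *
      Real.exp (‖u‖ ^ 2 / (4 * d))) (stdGaussian (Vec d)) :=
    (integrable_const _).add (hi.const_mul _)
  calc _ ≤ ∫⁻ u, ENNReal.ofReal (1 + 32 * lam * K * √(d : ℝ) ^ 3 *
      Real.exp (‖u‖ ^ 2 / (4 * d))) ∂(stdGaussian (Vec d)) :=
        lintegral_mono fun u => ENNReal.ofReal_le_ofReal (hpt u)
    _ = ENNReal.ofReal (∫ u, (1 + 32 * lam * K * √(d : ℝ) ^ 3 *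
      Real.exp (‖u‖ ^ 2 / (4 * d))) ∂(stdGaussian (Vec d))) := by
        rw [ofReal_integral_eq_lintegral_ofReal hint]
        exact Filter.Eventually.of_forall fun u => (Real.exp_pos _).le.trans (hpt u)
    _ ≤ _ := by
        refine ENNReal.ofReal_le_ofReal ?_
        rw [integral_add (integrable_const _) (hi.const_mul _), integral_const_mul]
        simp only [integral_const, probReal_univ, one_smul]
        have h1 := Real.add_one_le_exp (48 * lam * K * √(d : ℝ) ^ 3)
        have h2 : √2 ≤ 3 / 2 := by rw [Real.sqrt_le_iff]; norm_num
        have h3 : 32 * lam * K * √(d : ℝ) ^ 3 *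
            ∫ u, Real.exp (‖u‖ ^ 2 / (4 * d)) ∂(stdGaussian (Vec d)) ≤
          32 * lam * K * √(d : ℝ) ^ 3 * (3 / 2) := by
            gcongr; exact hle.trans h2
        linarith

end Gaussian

/-! ### Tail bounds for sums of independent Gaussian functionals -/

section Concentration

variable {d : ℕ}

/-- Exponential moments multiply under independence. The law gives only a.e. measurability, so the
samples are replaced by measurable versions. -/
lemma lintegral_prod_le_exp {Ω : Type*} [MeasurableSpace Ω] {P : Measure Ω}
    {u : ℕ → Ω → Vec d} (hlaw : ∀ i, HasLaw (u i) (stdGaussian (Vec d)) P)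
    (hind : iIndepFun u P) {F : Vec d → ℝ≥0∞} (hF : Measurable F) (m : ℕ) {κ : ℝ}
    (hκ : ∫⁻ x, F x ∂(stdGaussian (Vec d)) ≤ ENNReal.ofReal (Real.exp κ)) :
    ∫⁻ ω, ∏ i ∈ Finset.range m, F (u i ω) ∂P ≤ ENNReal.ofReal (Real.exp (m * κ)) := by
  have hmeas : ∀ i, AEMeasurable (u i) P := fun i => (hlaw i).aemeasurable
  set u' : ℕ → Ω → Vec d := fun i => (hmeas i).mk (u i) with hu'
  have hu'm : ∀ i, Measurable (u' i) := fun i => (hmeas i).measurable_mk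
  have hae : ∀ i, u i =ᵐ[P] u' i := fun i => (hmeas i).ae_eq_mk
  have hind' : iIndepFun u' P := hind.congr hae
  have h1 : ∫⁻ ω, ∏ i ∈ Finset.range m, F (u i ω) ∂P =
      ∫⁻ ω, ∏ i ∈ Finset.range m, F (u' i ω) ∂P := by
    refine lintegral_congr_ae ?_
    filter_upwards [ae_all_iff.2 hae] with ω hω
    exact Finset.prod_congr rfl fun i _ => by rw [hω i]
  have h3 := lintegral_prod_eq_prod_lintegral_of_indepFun (Finset.range m) _
    (hind'.comp (fun _ => F) fun _ => hF) (fun i => hF.comp (hu'm i))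
  refine (h1.trans h3).trans_le ?_
  have h2 : ∀ i, ∫⁻ ω, (F ∘ u' i) ω ∂P = ∫⁻ x, F x ∂(stdGaussian (Vec d)) := fun i => by
    rw [← ((hlaw i).congr (hae i).symm).lintegral_comp hF.aemeasurable]; rfl
  simp only [h2, Finset.prod_const, Finset.card_range]
  calc _ ≤ ENNReal.ofReal (Real.exp κ) ^ m := by gcongr
    _ = _ := by rw [← ENNReal.ofReal_pow (Real.exp_pos _).le, Real.exp_nat_mul]

/-- The average of `exp (λ ⟪w, s⟫)` over the unit ball is exponentially large in `‖s‖`. -/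
lemma le_lintegral_ball_exp (s : Vec d) {lam : ℝ} (hlam : 0 ≤ lam) :
    ENNReal.ofReal ((1 / 4) ^ d * Real.exp (lam * ‖s‖ / 4)) *
      volume (Metric.closedBall (0 : Vec d) 1) ≤
    ∫⁻ w in Metric.closedBall (0 : Vec d) 1, ENNReal.ofReal (Real.exp (lam * ⟪w, s⟫)) := by
  obtain ⟨z, hz1, hz⟩ : ∃ z : Vec d, ‖z‖ ≤ 1 ∧ ⟪z, s⟫ = ‖s‖ := by
    rcases eq_or_ne s 0 with rfl | hs
    · exact ⟨0, by simp, by simp⟩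
    · have hn : ‖s‖ ≠ 0 := norm_ne_zero_iff.2 hs
      refine ⟨‖s‖⁻¹ • s, by rw [norm_smul, norm_inv, norm_norm, inv_mul_cancel₀ hn], ?_⟩
      rw [inner_smul_left, real_inner_self_eq_norm_sq]
      simp only [conj_trivial]
      field_simp
  -- On the ball of radius `1/4` about `z / 2`, where `z` points along `s`, the inner product is at
  -- least `‖s‖/2 - ‖s‖/4`. This ball fills the fraction `4⁻ᵈ` of the unit ball.
  have hsub : Metric.closedBall ((1 / 2 : ℝ) • z) (1 / 4) ⊆ Metric.closedBall (0 : Vec d) 1 := by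
    refine Metric.closedBall_subset_closedBall' ?_
    rw [dist_zero_right, norm_smul, Real.norm_of_nonneg (by norm_num)]
    linarith
  have hlow : ∀ w ∈ Metric.closedBall ((1 / 2 : ℝ) • z) (1 / 4), ‖s‖ / 4 ≤ ⟪w, s⟫ := by
    intro w hw
    rw [Metric.mem_closedBall, dist_eq_norm] at hw
    have h1 : ⟪w, s⟫ = ⟪w - (1 / 2 : ℝ) • z, s⟫ + ‖s‖ / 2 := by
      rw [inner_sub_left, inner_smul_left, hz]; simp; ring
    have h2 := (abs_le.1 (abs_real_inner_le_norm (w - (1 / 2 : ℝ) • z) s)).1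
    have h3 : ‖w - (1 / 2 : ℝ) • z‖ * ‖s‖ ≤ 1 / 4 * ‖s‖ := by gcongr
    linarith
  calc ENNReal.ofReal ((1 / 4) ^ d * Real.exp (lam * ‖s‖ / 4)) *
        volume (Metric.closedBall (0 : Vec d) 1)
      = ENNReal.ofReal (Real.exp (lam * ‖s‖ / 4)) *
          volume (Metric.closedBall ((1 / 2 : ℝ) • z) (1 / 4)) := by
        rw [Measure.addHaar_closedBall volume ((1 / 2 : ℝ) • z) (by norm_num : (0 : ℝ) ≤ 1 / 4),
          Measure.addHaar_closedBall volume (0 : Vec d) zero_le_one, finrank_euclideanSpace_fin,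
          mul_comm (_ ^ d), ENNReal.ofReal_mul (Real.exp_pos _).le]
        simp [mul_assoc]
    _ = ∫⁻ _ in Metric.closedBall ((1 / 2 : ℝ) • z) (1 / 4),
          ENNReal.ofReal (Real.exp (lam * ‖s‖ / 4)) := by
        rw [setLIntegral_const]
    _ ≤ ∫⁻ w in Metric.closedBall ((1 / 2 : ℝ) • z) (1 / 4),
          ENNReal.ofReal (Real.exp (lam * ⟪w, s⟫)) := by
        refine setLIntegral_mono' measurableSet_closedBall fun w hw => ?_
        gcongr
        rw [mul_div_assoc]
        gcongr
        exact hlow w hw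
    _ ≤ _ := lintegral_mono_set hsub

variable {Ω : Type*} [MeasurableSpace Ω] {P : Measure Ω}
  {u : ℕ → Ω → Vec d}

lemma measure_ge_le_of_lintegral_exp {X : Ω → ℝ} (hX : AEMeasurable X P) {lam κ τ : ℝ}
    (hlam : 0 ≤ lam)
    (h : ∫⁻ ω, ENNReal.ofReal (Real.exp (lam * X ω)) ∂P ≤ ENNReal.ofReal (Real.exp κ)) :
    P {ω | τ ≤ X ω} ≤ ENNReal.ofReal (Real.exp (κ - lam * τ)) := by
  have hm : AEMeasurable (fun ω => ENNReal.ofReal (Real.exp (lam * X ω))) P := by fun_prop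
  have h1 := mul_meas_ge_le_lintegral₀ hm (ENNReal.ofReal (Real.exp (lam * τ)))
  have h2 : P {ω | τ ≤ X ω} ≤
      P {ω | ENNReal.ofReal (Real.exp (lam * τ)) ≤ ENNReal.ofReal (Real.exp (lam * X ω))} := by
    refine measure_mono fun ω (hω : τ ≤ X ω) => ?_
    simp only [Set.mem_ofPred_eq]
    gcongr
  have h3 : ENNReal.ofReal (Real.exp (lam * τ)) ≠ 0 := by
    simpa using Real.exp_pos (lam * τ)
  refine h2.trans ?_
  rw [Real.exp_sub, ENNReal.ofReal_div_of_pos (Real.exp_pos _)]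
  rw [ENNReal.le_div_iff_mul_le (Or.inl h3) (Or.inl ENNReal.ofReal_ne_top), mul_comm]
  exact h1.trans h

/-- The norm is a supremum over directions `w`. Instead of a net, the exponential moment of `⟪w, S⟫`
is averaged over the unit ball: by `le_lintegral_ball_exp` this average controls `exp (λ ‖S‖ / 4)`
at the price of `4 ^ d`, and Tonelli moves it outside the expectation. -/
lemma measure_norm_sum_ge_le [IsProbabilityMeasure P]
    (hlaw : ∀ i, HasLaw (u i) (stdGaussian (Vec d)) P) (hind : iIndepFun u P)
    {a : Vec d} {B lam : ℝ} (hB : 0 < B) (ha : ‖a‖ ≤ B) (hlam : 0 ≤ lam)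
    (hlamB : lam * B ≤ 1 / 16) (m : ℕ) (τ : ℝ) :
    P {ω | τ ≤ ‖∑ i ∈ Finset.range m, (⟪a, u i ω⟫ • u i ω - a)‖} ≤
      ENNReal.ofReal (4 ^ d * Real.exp (m * (128 * (lam * B) ^ 2) - lam / 4 * τ)) := by
  set S : Ω → Vec d := fun ω => ∑ i ∈ Finset.range m, (⟪a, u i ω⟫ • u i ω - a) with hS
  have hmeas : ∀ i, AEMeasurable (u i) P := fun i => (hlaw i).aemeasurable
  have hSm : AEMeasurable S P := by
    refine Finset.aemeasurable_fun_sum _ fun i _ => ?_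
    exact (((innerSL ℝ a).measurable.comp_aemeasurable (hmeas i)).smul (hmeas i)).sub
      aemeasurable_const
  set U := Metric.closedBall (0 : Vec d) 1 with hU
  have hU0 : volume U ≠ 0 := (Metric.measure_closedBall_pos _ _ one_pos).ne'
  have hUt : volume U ≠ ⊤ := measure_closedBall_lt_top.ne
  have hmgf : ∀ w ∈ U, ∫⁻ ω, ENNReal.ofReal (Real.exp (lam * ⟪w, S ω⟫)) ∂P ≤
      ENNReal.ofReal (Real.exp (m * (128 * (lam * B) ^ 2))) := by
    intro w hw
    have hw1 : ‖w‖ ≤ 1 := by simpa [hU] using hw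
    have h := lintegral_prod_le_exp hlaw hind
      (F := fun x => ENNReal.ofReal (Real.exp (lam * (⟪a, x⟫ * ⟪w, x⟫ - ⟪a, w⟫))))
      (by fun_prop) m (lintegral_exp_inner_mul_inner_le hB ha hw1 hlam hlamB)
    refine le_trans (le_of_eq ?_) h
    refine lintegral_congr fun ω => ?_
    rw [← ENNReal.ofReal_prod_of_nonneg fun _ _ => (Real.exp_pos _).le, ← Real.exp_sum,
      ← Finset.mul_sum, hS, inner_sum]
    congr 3
    refine Finset.sum_congr rfl fun i _ => ?_
    rw [inner_sub_right, inner_smul_right, real_inner_comm a w]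
  have hdouble : ∫⁻ ω, ENNReal.ofReal ((1 / 4) ^ d * Real.exp (lam * ‖S ω‖ / 4)) ∂P ≤
      ENNReal.ofReal (Real.exp (m * (128 * (lam * B) ^ 2))) := by
    have h1 : (∫⁻ ω, ENNReal.ofReal ((1 / 4) ^ d * Real.exp (lam * ‖S ω‖ / 4)) ∂P) * volume U ≤
        ENNReal.ofReal (Real.exp (m * (128 * (lam * B) ^ 2))) * volume U := by
      rw [← lintegral_mul_const' _ _ hUt]
      calc _ ≤ ∫⁻ ω, ∫⁻ w in U, ENNReal.ofReal (Real.exp (lam * ⟪w, S ω⟫)) ∂volume ∂P :=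
            lintegral_mono fun ω => le_lintegral_ball_exp (S ω) hlam
        _ = ∫⁻ w in U, ∫⁻ ω, ENNReal.ofReal (Real.exp (lam * ⟪w, S ω⟫)) ∂P ∂volume := by
            refine lintegral_lintegral_swap ?_
            have h2 : AEMeasurable (fun q : Ω × Vec d => S q.1) (P.prod (volume.restrict U)) :=
              hSm.comp_fst
            have h3 : AEMeasurable (fun q : Ω × Vec d => q.2) (P.prod (volume.restrict U)) :=
              measurable_snd.aemeasurable
            exact ((h3.inner h2).const_mul lam).exp.ennreal_ofReal
        _ ≤ ∫⁻ w in U, ENNReal.ofReal (Real.exp (m * (128 * (lam * B) ^ 2))) ∂volume :=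
            setLIntegral_mono' measurableSet_closedBall hmgf
        _ = _ := by rw [setLIntegral_const]
    exact (ENNReal.mul_le_mul_iff_left hU0 hUt).1 h1
  have hfin : ∫⁻ ω, ENNReal.ofReal (Real.exp (lam / 4 * ‖S ω‖)) ∂P ≤
      ENNReal.ofReal (Real.exp (m * (128 * (lam * B) ^ 2) + Real.log (4 ^ d))) := by
    have h1 : ∫⁻ ω, ENNReal.ofReal (Real.exp (lam / 4 * ‖S ω‖)) ∂P =
        ENNReal.ofReal (4 ^ d) *
          ∫⁻ ω, ENNReal.ofReal ((1 / 4) ^ d * Real.exp (lam * ‖S ω‖ / 4)) ∂P := by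
      rw [← lintegral_const_mul' _ _ ENNReal.ofReal_ne_top]
      refine lintegral_congr fun ω => ?_
      rw [← ENNReal.ofReal_mul (by positivity), ← mul_assoc, ← mul_pow]
      norm_num
      congr 2; ring
    rw [h1, Real.exp_add, Real.exp_log (by positivity), mul_comm (Real.exp _),
      ENNReal.ofReal_mul (by positivity)]
    gcongr
  have h := measure_ge_le_of_lintegral_exp (X := fun ω => ‖S ω‖) hSm.norm (τ := τ)
    (by positivity : 0 ≤ lam / 4) hfin
  refine h.trans (le_of_eq ?_)
  rw [add_sub_right_comm, Real.exp_add, Real.exp_log (by positivity), mul_comm]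

lemma measure_sum_remainder_ge_le [IsProbabilityMeasure P]
    (hlaw : ∀ i, HasLaw (u i) (stdGaussian (Vec d)) P) (hind : iIndepFun u P) (hd : 1 ≤ d)
    {B K lam : ℝ} (hK : 0 ≤ K)
    (hlam : 0 ≤ lam) (hlamB : lam * B * d ≤ 1 / 32) {Y : Vec d → ℝ} (hYm : Measurable Y)
    (hY0 : ∀ u, 0 ≤ Y u) (hY2 : ∀ u, Y u ≤ 2 * B * ‖u‖ ^ 2) (hY3 : ∀ u, Y u ≤ K * ‖u‖ ^ 3)
    (m : ℕ) (τ : ℝ) :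
    P {ω | τ ≤ ∑ i ∈ Finset.range m, Y (u i ω)} ≤
      ENNReal.ofReal (Real.exp (m * (48 * lam * K * √(d : ℝ) ^ 3) - lam * τ)) := by
  have hmeas : ∀ i, AEMeasurable (u i) P := fun i => (hlaw i).aemeasurable
  refine measure_ge_le_of_lintegral_exp
    (Finset.aemeasurable_fun_sum _ fun i _ => hYm.comp_aemeasurable (hmeas i)) hlam ?_
  have h := lintegral_prod_le_exp hlaw hind
      (F := fun x => ENNReal.ofReal (Real.exp (lam * Y x)))
      (by fun_prop) m (lintegral_exp_remainder_le hd hK hlam hlamB hY0 hY2 hY3)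
  refine le_trans (le_of_eq ?_) h
  refine lintegral_congr fun ω => ?_
  rw [← ENNReal.ofReal_prod_of_nonneg fun _ _ => (Real.exp_pos _).le, ← Real.exp_sum,
    ← Finset.mul_sum]
  rfl

end Concentration

/-! ### Accuracy of a single gradient estimate -/

section GradientEstimate

variable {d : ℕ} {p : Params d} {f : Vec d → ℝ}

lemma sqrt_pow_three_le_rpow : √(d : ℝ) ^ 3 ≤ ((d : ℝ) + 3) ^ (3 / 2 : ℝ) := by
  have h : √(d : ℝ) ^ 3 = (d : ℝ) ^ (3 / 2 : ℝ) := by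
    rw [Real.sqrt_eq_rpow, ← Real.rpow_natCast, ← Real.rpow_mul (by positivity)]
    norm_num
  rw [h]
  gcongr
  linarith

/-- The gradient estimate decomposes into a quadratic form of the samples and a remainder. -/
lemma norm_gradEst_sub_le (hm : 0 < p.m) (u : ℕ → Vec d) (x : Vec d) :
    ‖gradEst p f u x - gradient f x‖ ≤ 1 / p.m *
      (‖∑ i ∈ Finset.range p.m, (⟪gradient f x, u i⟫ • u i - gradient f x)‖ +
        ∑ i ∈ Finset.range p.m,
          |(f (x + p.v • u i) - f x) / p.v - ⟪gradient f x, u i⟫| * ‖u i‖) := by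
  have hm0 : (0 : ℝ) < p.m := by exact_mod_cast hm
  have h1 : gradEst p f u x - gradient f x = (1 / (p.m : ℝ)) •
      (∑ i ∈ Finset.range p.m, (⟪gradient f x, u i⟫ • u i - gradient f x) +
        ∑ i ∈ Finset.range p.m,
          ((f (x + p.v • u i) - f x) / p.v - ⟪gradient f x, u i⟫) • u i) := by
    rw [← Finset.sum_add_distrib, gradEst]
    have h2 : gradient f x = (1 / (p.m : ℝ)) • ∑ i ∈ Finset.range p.m, gradient f x := by
      rw [Finset.sum_const, Finset.card_range, ← Nat.cast_smul_eq_nsmul ℝ, smul_smul,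
        one_div_mul_cancel hm0.ne', one_smul]
    conv_lhs => rw [h2]
    rw [← smul_sub, ← Finset.sum_sub_distrib]
    congr 1
    refine Finset.sum_congr rfl fun i _ => ?_
    rw [sub_smul]; abel
  rw [h1, norm_smul, Real.norm_of_nonneg (by positivity)]
  gcongr
  refine (norm_add_le _ _).trans (add_le_add le_rfl ((norm_sum_le _ _).trans (le_of_eq ?_)))
  simp only [norm_smul, Real.norm_eq_abs]

/-- The gradient estimate is accurate with high probability. -/
lemma measure_gradEst_error_le {Ω : Type*} [MeasurableSpace Ω] {P : Measure Ω}
    [IsProbabilityMeasure P] {u : ℕ → Ω → Vec d}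
    (hlaw : ∀ i, HasLaw (u i) (stdGaussian (Vec d)) P) (hind : iIndepFun u P)
    (hs : IsSmooth p.l f) (hgrad : ∀ x, ‖gradient f x‖ ≤ p.B) (hd : 1 ≤ d) (hl : 0 < p.l)
    (hB : 1 ≤ p.B) (hc' : 100 ≤ p.c') (hê0 : 0 < p.epsHat) (hê : p.epsHat ≤ 1 / 2) (x : Vec d) :
    P {ω | p.epsHat < ‖gradEst p f (fun i => u i ω) x - gradient f x‖} ≤
      ENNReal.ofReal p.epsHat := by
  have hd1 : (1 : ℝ) ≤ d := by exact_mod_cast hd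
  have hd0 : (0 : ℝ) < d := by linarith
  have hB0 : 0 < p.B := by linarith
  have hc0 : 0 < p.c' := by linarith
  set e := p.epsHat with he
  set a := gradient f x with ha
  set L := Real.log (1 / e) + 1 / 4 with hL
  have hlog : 1 / 2 ≤ Real.log (1 / e) := by
    have h1 : Real.log 2 ≤ Real.log (1 / e) := by
      apply Real.log_le_log (by norm_num)
      rw [le_div_iff₀ hê0]; linarith
    linarith [Real.log_two_gt_d9]
  -- Each of the two tail events only has to reach exponent `-2L`: then its probability is at most
  -- `e² ≤ e / 2`.
  have hexpL : Real.exp (-2 * L) ≤ e / 2 := by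
    have h1 : Real.exp (-2 * L) ≤ Real.exp (-2 * Real.log (1 / e)) := by
      rw [Real.exp_le_exp]; linarith
    have h2 : Real.exp (-2 * Real.log (1 / e)) = e ^ 2 := by
      rw [one_div, Real.log_inv]
      have : -2 * -Real.log e = Real.log e + Real.log e := by ring
      rw [this, Real.exp_add, Real.exp_log hê0]; ring
    nlinarith
  have hmL : 64 * p.c' ^ 2 * (d + 4) * p.B ^ 2 * L ≤ p.m * e ^ 2 := by
    have h1 := Nat.le_ceil (32 * p.sigmaSq / e ^ 2 * (Real.log (1 / e) + 1 / 4))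
    have h2 : (32 * p.sigmaSq / e ^ 2 * (Real.log (1 / e) + 1 / 4)) ≤ p.m := h1
    have h3 := mul_le_mul_of_nonneg_right h2 (sq_nonneg e)
    refine le_trans (le_of_eq ?_) h3
    rw [hL, Params.sigmaSq]
    field_simp
    ring
  have hL0 : 3 / 4 ≤ L := by linarith
  have hm0 : (0 : ℝ) < p.m := by
    by_contra hcon
    have h0 : (p.m : ℝ) = 0 := le_antisymm (not_lt.1 hcon) (by positivity)
    rw [h0, zero_mul] at hmL
    have : 0 < 64 * p.c' ^ 2 * (d + 4) * p.B ^ 2 * L := by positivity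
    linarith
  have hv0 : 0 < p.v := by unfold Params.v; positivity
  -- the quadratic part
  have hpart1 : P {ω | p.m * e / 2 ≤ ‖∑ i ∈ Finset.range p.m, (⟪a, u i ω⟫ • u i ω - a)‖} ≤
      ENNReal.ofReal (e / 2) := by
    -- The rate `λ = e / (2048 B²)` minimizes the exponent `128 m (λB)² - λ m e / 8`.
    refine (measure_norm_sum_ge_le hlaw hind hB0 (hgrad x) (lam := e / (2048 * p.B ^ 2))
      (by positivity) ?_ p.m (p.m * e / 2)).trans (ENNReal.ofReal_le_ofReal ?_)
    · rw [div_mul_eq_mul_div, div_le_iff₀ (by positivity)]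
      nlinarith
    · have h4 : (4 : ℝ) ^ d ≤ Real.exp (2 * d) := by
        rw [mul_comm, Real.exp_nat_mul]
        gcongr
        have : Real.exp 2 = Real.exp 1 * Real.exp 1 := by rw [← Real.exp_add]; norm_num
        nlinarith [Real.exp_one_gt_d9]
      refine le_trans ?_ hexpL
      refine le_trans (mul_le_mul_of_nonneg_right h4 (Real.exp_pos _).le) ?_
      rw [← Real.exp_add, Real.exp_le_exp]
      have h5 : p.m * (128 * (e / (2048 * p.B ^ 2) * p.B) ^ 2) -
          e / (2048 * p.B ^ 2) / 4 * (p.m * e / 2) = -(p.m * e ^ 2 / (32768 * p.B ^ 2)) := by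
        field_simp; norm_num
      rw [h5]
      -- Here the size of `c'` matters: `64 * 100² ≥ 16 * 32768`. The factor `d + 4` in the sample
      -- size pays for `4 ^ d ≤ exp (2d)`.
      have h6 : 16 * (d + 4) * L ≤ p.m * e ^ 2 / (32768 * p.B ^ 2) := by
        rw [le_div_iff₀ (by positivity)]
        refine le_trans ?_ hmL
        have : (10000 : ℝ) ≤ p.c' ^ 2 := by nlinarith
        calc 16 * (d + 4) * L * (32768 * p.B ^ 2) = 524288 * ((d + 4) * p.B ^ 2 * L) := by ring
          _ ≤ (64 * p.c' ^ 2) * ((d + 4) * p.B ^ 2 * L) := by gcongr; linarith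
          _ = _ := by ring
      nlinarith
  -- the remainder
  set Y : Vec d → ℝ := fun w => |(f (x + p.v • w) - f x) / p.v - ⟪a, w⟫| * ‖w‖ with hY
  have hYm : Measurable Y := by
    have := hs.1.continuous
    have : Continuous Y := by
      rw [hY]
      have h1 : Continuous fun w : Vec d => f (x + p.v • w) := by fun_prop
      exact (((h1.sub continuous_const).div_const _).sub (by fun_prop)).abs.mul continuous_norm
    exact this.measurable
  have hY2 : ∀ w, Y w ≤ 2 * p.B * ‖w‖ ^ 2 := fun w => by
    have h1 := abs_sub_le_of_gradient_le hs.1 hgrad x (p.v • w)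
    rw [norm_smul, Real.norm_of_nonneg hv0.le] at h1
    have h2 : |(f (x + p.v • w) - f x) / p.v| ≤ p.B * ‖w‖ := by
      rw [abs_div, abs_of_pos hv0, div_le_iff₀ hv0]
      linarith
    have h3 : |⟪a, w⟫| ≤ p.B * ‖w‖ :=
      (abs_real_inner_le_norm _ _).trans (by gcongr; exact hgrad x)
    have h4 := (abs_sub ((f (x + p.v • w) - f x) / p.v) ⟪a, w⟫).trans (add_le_add h2 h3)
    calc Y w ≤ (p.B * ‖w‖ + p.B * ‖w‖) * ‖w‖ := mul_le_mul_of_nonneg_right h4 (norm_nonneg _)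
      _ = _ := by ring
  have hY3 : ∀ w, Y w ≤ p.l * p.v / 2 * ‖w‖ ^ 3 := fun w => by
    have h1 := hs.abs_sub_sub_inner_le x (p.v • w)
    rw [norm_smul, Real.norm_of_nonneg hv0.le, inner_smul_right] at h1
    have h2 : |(f (x + p.v • w) - f x) / p.v - ⟪a, w⟫| ≤ p.l * p.v / 2 * ‖w‖ ^ 2 := by
      have h3 : (f (x + p.v • w) - f x) / p.v - ⟪a, w⟫ =
          (f (x + p.v • w) - f x - p.v * ⟪a, w⟫) / p.v := by field_simp
      rw [h3, abs_div, abs_of_pos hv0, div_le_iff₀ hv0]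
      refine h1.trans (le_of_eq ?_)
      ring
    calc Y w ≤ (p.l * p.v / 2 * ‖w‖ ^ 2) * ‖w‖ := mul_le_mul_of_nonneg_right h2 (norm_nonneg _)
      _ = _ := by ring
  have hpart2 : P {ω | p.m * e / 2 ≤ ∑ i ∈ Finset.range p.m, Y (u i ω)} ≤
      ENNReal.ofReal (e / 2) := by
    -- The largest admissible rate. No optimization is needed, because the bound on the mean of the
    -- remainder lies below the threshold by a fixed proportion.
    refine (measure_sum_remainder_ge_le hlaw hind hd (lam := 1 / (32 * p.B * d)) (by positivity)
      (by positivity) (le_of_eq (by field_simp)) hYm (fun _ => by positivity) hY2 hY3 p.m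
      (p.m * e / 2)).trans (ENNReal.ofReal_le_ofReal ?_)
    refine le_trans ?_ hexpL
    rw [Real.exp_le_exp]
    -- The smoothing parameter `v` is scaled to cancel `l` and the third moment `d ^ (3/2)` of the
    -- norm. With `c' ≥ 100` the mean term is at most `24 e / 100 ≤ e / 4`, half of the threshold `e
    -- / 2`.
    have h1 : p.l * p.v * √(d : ℝ) ^ 3 ≤ e / p.c' := by
      rw [Params.v]
      have : p.l * (e / (p.c' * p.l * ((d : ℝ) + 3) ^ (3 / 2 : ℝ))) * √(d : ℝ) ^ 3 =
          e / p.c' * (√(d : ℝ) ^ 3 / ((d : ℝ) + 3) ^ (3 / 2 : ℝ)) := by field_simp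
      rw [this]
      refine mul_le_of_le_one_right (by positivity) ?_
      rw [div_le_one (by positivity)]
      exact sqrt_pow_three_le_rpow
    have h2 : e / p.c' ≤ e / 100 := by gcongr
    have h3 : p.m * (48 * (1 / (32 * p.B * d)) * (p.l * p.v / 2) * √(d : ℝ) ^ 3) -
        1 / (32 * p.B * d) * (p.m * e / 2) =
        p.m / (32 * p.B * d) * (24 * (p.l * p.v * √(d : ℝ) ^ 3) - e / 2) := by
      field_simp; norm_num; ring
    rw [h3]
    have h4 : p.m / (32 * p.B * d) * (24 * (p.l * p.v * √(d : ℝ) ^ 3) - e / 2) ≤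
        p.m / (32 * p.B * d) * (-(e / 4)) := by gcongr; linarith
    have h5 : 2 * L ≤ p.m / (32 * p.B * d) * (e / 4) := by
      have h6 : p.m / (32 * p.B * d) * (e / 4) = p.m * e ^ 2 / (128 * p.B * d * e) := by
        field_simp; norm_num
      rw [h6, le_div_iff₀ (by positivity)]
      refine le_trans ?_ hmL
      have : (10000 : ℝ) ≤ p.c' ^ 2 := by nlinarith
      calc 2 * L * (128 * p.B * d * e) = 256 * L * d * (p.B * e) := by ring
        _ ≤ 256 * L * d * (p.B ^ 2 * 1) := by gcongr ?_ * ?_ ; nlinarith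
        _ = 256 * (d * p.B ^ 2 * L) := by ring
        _ ≤ (64 * p.c' ^ 2) * ((d + 4) * p.B ^ 2 * L) := by gcongr <;> linarith
        _ = _ := by ring
    linarith
  calc P {ω | e < ‖gradEst p f (fun i => u i ω) x - a‖}
      ≤ P ({ω | p.m * e / 2 ≤ ‖∑ i ∈ Finset.range p.m, (⟪a, u i ω⟫ • u i ω - a)‖} ∪
          {ω | p.m * e / 2 ≤ ∑ i ∈ Finset.range p.m, Y (u i ω)}) := by
        refine measure_mono fun ω (hω : e < _) => ?_
        have h1 := norm_gradEst_sub_le (p := p) (f := f) (by exact_mod_cast hm0)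
          (fun i => u i ω) x
        have h2 := hω.trans_le h1
        rw [one_div_mul_eq_div, lt_div_iff₀ hm0] at h2
        by_contra hcon
        simp only [Set.mem_union, Set.mem_ofPred_eq, not_or, not_le] at hcon
        have h3 := hcon.1
        have h4 : ∑ i ∈ Finset.range p.m,
          |(f (x + p.v • u i ω) - f x) / p.v - ⟪gradient f x, u i ω⟫| * ‖u i ω‖ <
            p.m * e / 2 := hcon.2
        linarith
    _ ≤ ENNReal.ofReal (e / 2) + ENNReal.ofReal (e / 2) :=
        (measure_union_le _ _).trans (add_le_add hpart1 hpart2)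
    _ = ENNReal.ofReal e := by
        rw [← ENNReal.ofReal_add (by positivity) (by positivity), add_halves]

end GradientEstimate

/-! ### Volume of sets that are thin in one direction -/

section Slices

/-- Log-convexity of the Gamma function at the midpoint of `x` and `x + 1`. -/
lemma Gamma_add_half_le {x : ℝ} (hx : 0 < x) :
    Real.Gamma (x + 1 / 2) ≤ √x * Real.Gamma x := by
  have h := Real.Gamma_mul_add_mul_le_rpow_Gamma_mul_rpow_Gamma hx (by linarith : 0 < x + 1)
    (a := 1 / 2) (b := 1 / 2) (by norm_num) (by norm_num) (by norm_num)
  have h1 : 1 / 2 * x + 1 / 2 * (x + 1) = x + 1 / 2 := by ring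
  rw [h1, Real.Gamma_add_one hx.ne', ← Real.sqrt_eq_rpow, ← Real.sqrt_eq_rpow,
    Real.sqrt_mul hx.le] at h
  refine h.trans (le_of_eq ?_)
  rw [mul_left_comm, Real.mul_self_sqrt (Real.Gamma_pos_of_pos hx).le]

lemma volume_closedBall_vec (n : ℕ) {r : ℝ} (hr : 0 ≤ r) :
    volume (Metric.closedBall (0 : Vec n) r) =
      ENNReal.ofReal (r ^ n * (√Real.pi ^ n / Real.Gamma (n / 2 + 1))) := by
  rcases Nat.eq_zero_or_pos n with rfl | hn
  · have h1 : Metric.closedBall (0 : Vec 0) r = {0} := by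
      ext x
      simp [Subsingleton.elim x 0, hr]
    have h2 := (PiLp.volume_preserving_toLp (Fin 0)).measure_preimage
      (s := {0}) (measurableSet_singleton _).nullMeasurableSet
    have h3 : (WithLp.toLp 2 ⁻¹' {0} : Set (Fin 0 → ℝ)) = Set.univ :=
      Set.eq_univ_of_forall fun x => Subsingleton.elim _ _
    rw [h1, ← h2, h3, volume_pi, Measure.pi_of_empty]
    simp
  · have : Nonempty (Fin n) := ⟨⟨0, hn⟩⟩
    rw [EuclideanSpace.volume_closedBall, Fintype.card_fin, ← ENNReal.ofReal_pow hr,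
      ← ENNReal.ofReal_mul (by positivity)]

/-- Comparison of the volumes of balls in consecutive dimensions. -/
lemma volume_closedBall_le_succ (n : ℕ) {r : ℝ} (hr : 0 < r) :
    volume (Metric.closedBall (0 : Vec n) r) ≤
      ENNReal.ofReal (√((n + 1 : ℕ) : ℝ) / r) *
        volume (Metric.closedBall (0 : Vec (n + 1)) r) := by
  rw [volume_closedBall_vec n hr.le, volume_closedBall_vec (n + 1) hr.le,
    ← ENNReal.ofReal_mul (by positivity)]
  refine ENNReal.ofReal_le_ofReal ?_
  have hx : (0 : ℝ) < n / 2 + 1 := by positivity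
  have hG := Gamma_add_half_le hx
  have hG0 := Real.Gamma_pos_of_pos hx
  have hG1 : 0 < Real.Gamma (n / 2 + 1 + 1 / 2) := Real.Gamma_pos_of_pos (by positivity)
  have h1 : (((n + 1 : ℕ) : ℝ) / 2 + 1) = n / 2 + 1 + 1 / 2 := by push_cast; ring
  rw [h1]
  have h2 : √((n : ℝ) / 2 + 1) ≤ √((n + 1 : ℕ) : ℝ) := by
    apply Real.sqrt_le_sqrt; push_cast; linarith [(Nat.cast_nonneg n : (0 : ℝ) ≤ n)]
  have h3 : 1 ≤ √Real.pi := by rw [Real.one_le_sqrt]; linarith [Real.pi_gt_three]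
  have h4 : Real.Gamma (n / 2 + 1 + 1 / 2) ≤
      √((n + 1 : ℕ) : ℝ) * √Real.pi * Real.Gamma (n / 2 + 1) := by
    refine hG.trans ?_
    gcongr
    calc √((n : ℝ) / 2 + 1) ≤ √((n + 1 : ℕ) : ℝ) * 1 := by rwa [mul_one]
      _ ≤ _ := by gcongr
  have h5 : 1 / Real.Gamma (n / 2 + 1) ≤
      √((n + 1 : ℕ) : ℝ) * √Real.pi / Real.Gamma (n / 2 + 1 + 1 / 2) := by
    rw [div_le_div_iff₀ hG0 hG1]; linarith
  calc r ^ n * (√Real.pi ^ n / Real.Gamma (n / 2 + 1))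
      = r ^ n * √Real.pi ^ n * (1 / Real.Gamma (n / 2 + 1)) := by ring
    _ ≤ r ^ n * √Real.pi ^ n *
        (√((n + 1 : ℕ) : ℝ) * √Real.pi / Real.Gamma (n / 2 + 1 + 1 / 2)) := by gcongr
    _ = _ := by rw [pow_succ, pow_succ]; field_simp

/-- A measurable subset of a ball that is thin in one direction has small volume. -/
lemma volume_le_of_thin {d : ℕ} {K : Set (Vec d)} (hK : MeasurableSet K) {r h : ℝ} (hr : 0 < r)
    (hKr : K ⊆ Metric.closedBall 0 r) {e : Vec d} (he : ‖e‖ = 1)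
    (hthin : ∀ x ∈ K, ∀ y ∈ K, ∀ μ : ℝ, x - y = μ • e → |μ| ≤ h) :
    volume K ≤ ENNReal.ofReal (√(d : ℝ) * h / r) * volume (Metric.closedBall (0 : Vec d) r) := by
  obtain ⟨n, rfl⟩ : ∃ n, d = n + 1 := by
    rcases Nat.eq_zero_or_pos d with rfl | hd
    · simp [Subsingleton.elim e 0] at he
    · exact ⟨d - 1, by omega⟩
  obtain ⟨b, hb⟩ := Orthonormal.exists_orthonormalBasis_extension_of_card_eq
    (𝕜 := ℝ) (E := Vec (n + 1)) (ι := Fin (n + 1)) (by simp) (v := fun _ => e) (s := {0})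
    (by
      rw [orthonormal_iff_ite]
      rintro ⟨i, hi⟩ ⟨j, hj⟩
      rw [Set.mem_singleton_iff] at hi hj
      subst hi hj
      simp [he])
  have hb0 : b 0 = e := hb 0 rfl
  -- Orthonormal coordinates adapted to `e`: the first component is the coordinate along `e`, and
  -- the map preserves volume.
  let φ : Vec (n + 1) ≃ᵐ ℝ × (Fin n → ℝ) :=
    (b.measurableEquiv.trans (MeasurableEquiv.toLp 2 (Fin (n + 1) → ℝ)).symm).trans
      (MeasurableEquiv.piFinSuccAbove (fun _ => ℝ) 0)
  have hφ : MeasurePreserving φ volume volume :=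
    ((volume_preserving_piFinSuccAbove (fun _ => ℝ) 0).comp
      (PiLp.volume_preserving_ofLp (Fin (n + 1)))).comp b.measurePreserving_measurableEquiv
  have hφ1 : ∀ x, (φ x).1 = b.repr x 0 := fun x => rfl
  have hφ2 : ∀ x i, (φ x).2 i = b.repr x i.succ := fun x i => rfl
  have hnorm : ∀ x, ‖x‖ ^ 2 = (φ x).1 ^ 2 + ∑ i, (φ x).2 i ^ 2 := fun x => by
    rw [← b.repr.norm_map x, EuclideanSpace.norm_sq_eq, Fin.sum_univ_succ]
    simp [hφ1, hφ2]
  have hvol : volume K = volume (φ.symm ⁻¹' K) :=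
    (hφ.symm φ).measure_preimage hK.nullMeasurableSet |>.symm
  have hK' : MeasurableSet (φ.symm ⁻¹' K) := φ.symm.measurable hK
  rw [hvol, Measure.volume_eq_prod, Measure.prod_apply_symm hK']
  set C : Set (Fin n → ℝ) := (WithLp.toLp 2) ⁻¹' Metric.closedBall (0 : Vec n) r with hC
  have hCm : MeasurableSet C := (PiLp.continuous_toLp 2 _).measurable measurableSet_closedBall
  -- A line parallel to `e` meets `K` in a set of diameter at most `h`, and misses `K` unless its
  -- base point lies in the `n`-dimensional ball of radius `r`.
  have hslice : ∀ y, volume ((fun s => (s, y)) ⁻¹' (φ.symm ⁻¹' K)) ≤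
      C.indicator (fun _ => ENNReal.ofReal h) y := by
    intro y
    by_cases hy : y ∈ C
    · rw [Set.indicator_of_mem hy]
      refine (Real.volume_le_diam _).trans ?_
      refine Metric.ediam_le fun s hs t ht => ?_
      rw [edist_dist, Real.dist_eq]
      refine ENNReal.ofReal_le_ofReal (hthin _ hs _ ht (s - t) ?_)
      apply b.repr.injective
      rw [map_sub, map_smul, ← hb0, b.repr_self]
      ext i
      refine Fin.cases ?_ (fun j => ?_) i
      · have h1 := hφ1 (φ.symm (s, y))
        have h2 := hφ1 (φ.symm (t, y))
        rw [φ.apply_symm_apply] at h1 h2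
        simp [← h1, ← h2]
      · have h1 := hφ2 (φ.symm (s, y)) j
        have h2 := hφ2 (φ.symm (t, y)) j
        rw [φ.apply_symm_apply] at h1 h2
        simp [← h1, ← h2]
    · rw [Set.indicator_of_notMem hy, nonpos_iff_eq_zero]
      convert measure_empty (μ := (volume : Measure ℝ))
      rw [Set.eq_empty_iff_forall_notMem]
      intro s hs
      apply hy
      have h1 := hKr hs
      rw [mem_closedBall_zero_iff] at h1
      have h2 := hnorm (φ.symm (s, y))
      rw [φ.apply_symm_apply] at h2
      rw [hC, Set.mem_preimage, mem_closedBall_zero_iff, ← sq_le_sq₀ (norm_nonneg _) hr.le,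
        EuclideanSpace.norm_sq_eq]
      have h3 : ‖φ.symm (s, y)‖ ^ 2 ≤ r ^ 2 := by gcongr
      simp only [Real.norm_eq_abs, sq_abs]
      nlinarith [sq_nonneg s]
  calc ∫⁻ y, volume ((fun s => (s, y)) ⁻¹' (φ.symm ⁻¹' K))
      ≤ ∫⁻ y, C.indicator (fun _ => ENNReal.ofReal h) y := lintegral_mono hslice
    _ = ENNReal.ofReal h * volume (Metric.closedBall (0 : Vec n) r) := by
        rw [lintegral_indicator_const hCm, hC,
          (PiLp.volume_preserving_toLp (Fin n)).measure_preimage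
            measurableSet_closedBall.nullMeasurableSet]
    _ ≤ ENNReal.ofReal h * (ENNReal.ofReal (√((n + 1 : ℕ) : ℝ) / r) *
        volume (Metric.closedBall (0 : Vec (n + 1)) r)) := by
        gcongr; exact volume_closedBall_le_succ n hr
    _ = _ := by
        rw [← mul_assoc, mul_comm (ENNReal.ofReal h), ← ENNReal.ofReal_mul (by positivity)]
        congr 2
        ring

end Slices

/-! ### Structure of a run: perturbations, windows and tests -/

section Run

variable {d : ℕ} {p : Params d} {f : Vec d → ℝ} {x₀ : Vec d} {u : ℕ → ℕ → Vec d} {ξ : ℕ → Vec d}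

/-- The gradient estimate of iteration `n`. -/
def runGrad (p : Params d) (f : Vec d → ℝ) (x₀ : Vec d) (u : ℕ → ℕ → Vec d) (ξ : ℕ → Vec d)
    (n : ℕ) : Vec d :=
  gradEst p f (u n) (run p f x₀ u ξ n).x

/-- Iteration `n` perturbs the iterate. -/
def Perturbs (p : Params d) (f : Vec d → ℝ) (x₀ : Vec d) (u : ℕ → ℕ → Vec d) (ξ : ℕ → Vec d)
    (n : ℕ) : Prop :=
  (run p f x₀ u ξ n).output = none ∧ ‖runGrad p f x₀ u ξ n‖ ≤ p.gThres ∧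
    (n : ℤ) - (run p f x₀ u ξ n).tTemp > (p.tThres : ℤ)

/-- The gradient estimate of iteration `n` is accurate. -/
def Accurate (p : Params d) (f : Vec d → ℝ) (x₀ : Vec d) (u : ℕ → ℕ → Vec d) (ξ : ℕ → Vec d)
    (n : ℕ) : Prop :=
  ‖runGrad p f x₀ u ξ n - gradient f (run p f x₀ u ξ n).x‖ ≤ p.epsHat

lemma step_of_some {u : ℕ → Vec d} {ξ : Vec d} {s : State d} {y : Vec d}
    (h : s.output = some y) : step p f u ξ s = s := by
  simp only [step, h]

lemma output_none_of_succ {n : ℕ} (h : (run p f x₀ u ξ (n + 1)).output = none) :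
    (run p f x₀ u ξ n).output = none := by
  by_contra hcon
  obtain ⟨y, hy⟩ := Option.ne_none_iff_exists'.1 hcon
  have : run p f x₀ u ξ (n + 1) = run p f x₀ u ξ n := step_of_some hy
  rw [this] at h
  exact hcon h

lemma run_t {n : ℕ} (h : (run p f x₀ u ξ n).output = none) : (run p f x₀ u ξ n).t = n := by
  induction n with
  | zero => rfl
  | succ n ih =>
    have h0 := output_none_of_succ h
    have : (run p f x₀ u ξ (n + 1)).t = (run p f x₀ u ξ n).t + 1 := by
      simp only [run, step, h0]
    rw [this, ih h0]

section Step

variable {n : ℕ} (h : (run p f x₀ u ξ n).output = none)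

include h

/-- A perturbation resets the clock to `0`, which differs from `tThres`; so no test is made in the
same iteration. -/
lemma run_succ_of_perturbs (hT : 0 < p.tThres) (hp : Perturbs p f x₀ u ξ n) :
    (run p f x₀ u ξ (n + 1)).x =
        (run p f x₀ u ξ n).x + ξ n - p.eta • runGrad p f x₀ u ξ n ∧
      (run p f x₀ u ξ (n + 1)).tTemp = n ∧
      (run p f x₀ u ξ (n + 1)).xTemp = (run p f x₀ u ξ n).x + ξ n ∧
      (run p f x₀ u ξ (n + 1)).output = none := by
  obtain ⟨-, h1, h2⟩ := hp
  have ht := run_t h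
  rw [gt_iff_lt] at h2
  have h3 : ¬ ((0 : ℤ) = p.tThres) := by omega
  unfold runGrad at h1
  simp [run, step, h, h1, h2, h3, runGrad, ht]

lemma run_succ_of_not_perturbs_of_ne (hp : ¬ Perturbs p f x₀ u ξ n)
    (hne : (n : ℤ) - (run p f x₀ u ξ n).tTemp ≠ p.tThres) :
    (run p f x₀ u ξ (n + 1)).x = (run p f x₀ u ξ n).x - p.eta • runGrad p f x₀ u ξ n ∧
      (run p f x₀ u ξ (n + 1)).tTemp = (run p f x₀ u ξ n).tTemp ∧
      (run p f x₀ u ξ (n + 1)).xTemp = (run p f x₀ u ξ n).xTemp ∧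
      (run p f x₀ u ξ (n + 1)).output = none := by
  have ht := run_t h
  have hp' : ¬ (‖gradEst p f (u n) (run p f x₀ u ξ n).x‖ ≤ p.gThres ∧
      (n : ℤ) - (run p f x₀ u ξ n).tTemp > (p.tThres : ℤ)) := fun hc => hp ⟨h, hc⟩
  simp [run, step, h, hp', hne, runGrad, ht]

/-- At the time of the test no perturbation can intervene, since perturbing requires strictly more
than `tThres` elapsed iterations. -/
lemma run_succ_of_eq (heq : (n : ℤ) - (run p f x₀ u ξ n).tTemp = p.tThres) :
    (f (run p f x₀ u ξ n).x - f (run p f x₀ u ξ n).xTemp > -p.fThres ∧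
      (run p f x₀ u ξ (n + 1)).output = some (run p f x₀ u ξ n).xTemp ∧
      (run p f x₀ u ξ (n + 1)).t = n + 1) ∨
    (f (run p f x₀ u ξ n).x - f (run p f x₀ u ξ n).xTemp ≤ -p.fThres ∧
      (run p f x₀ u ξ (n + 1)).x = (run p f x₀ u ξ n).x - p.eta • runGrad p f x₀ u ξ n ∧
      (run p f x₀ u ξ (n + 1)).tTemp = (run p f x₀ u ξ n).tTemp ∧
      (run p f x₀ u ξ (n + 1)).output = none) := by
  have ht := run_t h
  rcases lt_or_ge (-p.fThres) (f (run p f x₀ u ξ n).x - f (run p f x₀ u ξ n).xTemp) with hh | hh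
  · left
    refine ⟨hh, ?_⟩
    simp only [run, step, h, ht, heq]
    simp [hh, heq]
  · right
    refine ⟨hh, ?_⟩
    have hh' : ¬ (-p.fThres < f (run p f x₀ u ξ n).x - f (run p f x₀ u ξ n).xTemp) := not_lt.2 hh
    simp only [run, step, h, ht, heq, runGrad]
    simp [hh']

end Step

/-- Each iteration makes at most `2 m + 2` queries. -/
lemma run_queries_le (n : ℕ) :
    (run p f x₀ u ξ n).queries ≤ (run p f x₀ u ξ n).t * (2 * p.m + 2) := by
  induction n with
  | zero => simp [run, initState]
  | succ n ih =>
    rcases hout : (run p f x₀ u ξ n).output with _ | y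
    · have h1 : (run p f x₀ u ξ (n + 1)).t = (run p f x₀ u ξ n).t + 1 := by
        simp only [run, step, hout]
      have h2 : (run p f x₀ u ξ (n + 1)).queries ≤ (run p f x₀ u ξ n).queries + 2 * p.m + 2 := by
        simp only [run, step, hout]
        split_ifs <;> simp
      rw [h1, add_mul, one_mul]
      omega
    · have : run p f x₀ u ξ (n + 1) = run p f x₀ u ξ n := step_of_some hout
      rw [this]
      exact ih

/-- State of the loop between a perturbation in iteration `k` and the corresponding test. -/
structure InWindow (p : Params d) (f : Vec d → ℝ) (x₀ : Vec d) (u : ℕ → ℕ → Vec d)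
    (ξ : ℕ → Vec d) (k n : ℕ) : Prop where
  lt : k < n
  le : n ≤ k + p.tThres
  perturbs : Perturbs p f x₀ u ξ k
  tTemp : (run p f x₀ u ξ n).tTemp = k
  xTemp : (run p f x₀ u ξ n).xTemp = (run p f x₀ u ξ k).x + ξ k
  first : (run p f x₀ u ξ (k + 1)).x =
    (run p f x₀ u ξ k).x + ξ k - p.eta • runGrad p f x₀ u ξ k
  next : ∀ j, k < j → j < n →
    (run p f x₀ u ξ (j + 1)).x = (run p f x₀ u ξ j).x - p.eta • runGrad p f x₀ u ξ j

/-- Dichotomy behind every induction over the run: the clock either exceeds `tThres`, so that a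
small estimate would trigger a perturbation, or it belongs to a window opened by one. The initial
value `-tThres - 1` puts the start in the first case. -/
lemma free_or_inWindow (hT : 0 < p.tThres) {n : ℕ} (h : (run p f x₀ u ξ n).output = none) :
    (n : ℤ) - (run p f x₀ u ξ n).tTemp > (p.tThres : ℤ) ∨ ∃ k, InWindow p f x₀ u ξ k n := by
  induction n with
  | zero => left; simp [run, initState]
  | succ n ih =>
    have h0 := output_none_of_succ h
    by_cases hper : Perturbs p f x₀ u ξ n
    · right
      obtain ⟨h1, h2, h3, -⟩ := run_succ_of_perturbs h0 hT hper
      exact ⟨n, n.lt_succ_self, by omega, hper, h2, h3, h1, fun j hj hj' => by omega⟩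
    · rcases ih h0 with hfree | ⟨k, hk⟩
      · left
        obtain ⟨-, h2, -, -⟩ := run_succ_of_not_perturbs_of_ne h0 hper (by omega)
        rw [h2]
        push_cast
        omega
      · have hkn := hk.lt
        rcases eq_or_ne ((n : ℤ) - (run p f x₀ u ξ n).tTemp) p.tThres with heq | hne
        · rcases run_succ_of_eq h0 heq with ⟨-, h1, -⟩ | ⟨-, -, h2, -⟩
          · rw [h] at h1; simp at h1
          · left
            rw [h2]
            push_cast
            omega
        · right
          obtain ⟨h1, h2, h3, -⟩ := run_succ_of_not_perturbs_of_ne h0 hper hne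
          have hle := hk.le
          rw [hk.tTemp] at hne
          refine ⟨k, by omega, by omega, hk.perturbs, h2.trans hk.tTemp, h3.trans hk.xTemp,
            hk.first, fun j hj hj' => ?_⟩
          rcases Nat.lt_succ_iff_lt_or_eq.1 hj' with hlt | rfl
          · exact hk.next j hj hlt
          · exact h1

lemma InWindow.not_perturbs {k n : ℕ} (hk : InWindow p f x₀ u ξ k n) :
    ¬ Perturbs p f x₀ u ξ n := by
  rintro ⟨-, -, h⟩
  rw [hk.tTemp] at h
  have := hk.le
  omega

/-- Gradient descent with the gradient estimates obtained from the samples `w 0, w 1, …`. -/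
def traj (p : Params d) (f : Vec d → ℝ) (w : ℕ → ℕ → Vec d) (y₀ : Vec d) : ℕ → Vec d
  | 0 => y₀
  | s + 1 => traj p f w y₀ s - p.eta • gradEst p f (w s) (traj p f w y₀ s)

/-- Inside a window the run is an explicit function of the center, the perturbation and the samples.
Different perturbations can thus be compared with all samples fixed. -/
lemma InWindow.run_eq_traj {k n : ℕ} (hk : InWindow p f x₀ u ξ k n) {s : ℕ}
    (hs : k + 1 + s ≤ n) :
    (run p f x₀ u ξ (k + 1 + s)).x = traj p f (fun s => u (k + 1 + s))
      ((run p f x₀ u ξ k).x + ξ k - p.eta • gradEst p f (u k) (run p f x₀ u ξ k).x) s := by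
  induction s with
  | zero => exact hk.first
  | succ s ih =>
    have h := hk.next (k + 1 + s) (by omega) (by omega)
    rw [traj, ← ih (by omega)]
    exact h

/-- The perturbation `ξ` of `x` in iteration `k` reaches a point with negative curvature from
which the following iterations, although their gradient estimates are accurate, do not lead to a
sufficient decrease. -/
structure FailsEscape (p : Params d) (f : Vec d → ℝ) (u : ℕ → ℕ → Vec d) (k : ℕ)
    (x ξ : Vec d) : Prop where
  norm_le : ‖ξ‖ ≤ p.r
  grad_le : ‖gradEst p f (u k) x‖ ≤ p.gThres
  accurate : ‖gradEst p f (u k) x - gradient f x‖ ≤ p.epsHat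
  curvature : ∃ w : Vec d, ‖w‖ = 1 ∧ ⟪hessian f (x + ξ) w, w⟫ < -√(p.ρ * p.ε)
  accurate_traj : ∀ s < p.tThres - 1,
    ‖gradEst p f (u (k + 1 + s)) (traj p f (fun s => u (k + 1 + s))
        (x + ξ - p.eta • gradEst p f (u k) x) s) -
      gradient f (traj p f (fun s => u (k + 1 + s))
        (x + ξ - p.eta • gradEst p f (u k) x) s)‖ ≤ p.epsHat
  no_decrease : -p.fThres < f (traj p f (fun s => u (k + 1 + s))
    (x + ξ - p.eta • gradEst p f (u k) x) (p.tThres - 1)) - f (x + ξ)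

end Run

/-! ### Decrease of the objective along an accurate run -/

section Progress

variable {d : ℕ} {l ρ ε c χ γ ê : ℝ}

namespace Regime

variable (hp : Regime d l ρ ε c χ γ ê)

include hp

lemma χ_pos : 0 < χ := by linarith [hp.χ_ge]

lemma ratio_le : γ / l ≤ 1 := (div_le_one hp.l_pos).2 hp.γ_le

lemma fThres_pos : 0 < c / χ ^ 3 * (ε ^ 2 / γ) := by
  have := hp.χ_pos
  have := hp.c_pos
  have := hp.ε_pos
  have := hp.γ_pos
  positivity

lemma gThres_pos : 0 < √c / χ ^ 2 * ε := by
  have := hp.χ_pos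
  have := Real.sqrt_pos.2 hp.c_pos
  have := hp.ε_pos
  positivity

lemma gThres_sq : (√c / χ ^ 2 * ε) ^ 2 / l = c / χ ^ 3 * (ε ^ 2 / γ) * ((γ / l) / χ) := by
  have := hp.χ_pos
  have := hp.l_pos
  have := hp.γ_pos
  rw [mul_pow, div_pow, Real.sq_sqrt hp.c_pos.le]
  field_simp

lemma gThres_sq_le : (√c / χ ^ 2 * ε) ^ 2 / l ≤ c / χ ^ 3 * (ε ^ 2 / γ) / 4 := by
  rw [hp.gThres_sq, div_eq_mul_one_div _ (4 : ℝ)]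
  have h1 := hp.fThres_pos
  gcongr
  · exact hp.ratio_le
  · exact hp.χ_ge

lemma noise_le : c / l / 2 * ê ^ 2 ≤ c / χ ^ 3 * (ε ^ 2 / γ) / 20 := by
  have h1 := hp.gThres_sq_le
  have h2 := hp.ê_le_thres
  have h3 := hp.gThres_pos
  have h4 := hp.ê_nonneg
  have h5 := hp.c_le
  have h6 := hp.c_pos
  have hl := hp.l_pos
  have h7 := hp.fThres_pos
  calc c / l / 2 * ê ^ 2 ≤ c / l / 2 * (√c / χ ^ 2 * ε) ^ 2 := by gcongr; linarith
    _ = c / 2 * ((√c / χ ^ 2 * ε) ^ 2 / l) := by ring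
    _ ≤ (1 / 5) * (c / χ ^ 3 * (ε ^ 2 / γ) / 4) :=
        mul_le_mul (by linarith) h1 (by positivity) (by norm_num)
    _ = _ := by ring

lemma perturb_le : (√c / χ ^ 2 * ε + ê) * (√c / χ ^ 2 * ε / l) +
    l / 2 * (√c / χ ^ 2 * ε / l) ^ 2 ≤ 2 / 5 * (c / χ ^ 3 * (ε ^ 2 / γ)) := by
  have h1 := hp.gThres_sq_le
  have h2 := hp.ê_le_thres
  have h3 := hp.gThres_pos
  have hl := hp.l_pos
  set g := √c / χ ^ 2 * ε
  calc (g + ê) * (g / l) + l / 2 * (g / l) ^ 2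
      ≤ (g + g / 1000) * (g / l) + l / 2 * (g / l) ^ 2 := by
        gcongr
    _ = (1501 / 1000) * (g ^ 2 / l) := by field_simp; ring
    _ ≤ (1501 / 1000) * (c / χ ^ 3 * (ε ^ 2 / γ) / 4) := by gcongr
    _ ≤ _ := by linarith [hp.fThres_pos]

/-- The error is at most a thousandth of `gThres`, so a step with estimate above `gThres` retains
most of its exact gain. The constants leave room by a factor of order `1 / c`, which makes `rate`
also compatible with the windows. -/
lemma large_step_le : c / l / 2 * ê ^ 2 - c / l / 2 * (1 - l * (c / l)) * (√c / χ ^ 2 * ε) ^ 2 ≤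
    -(c ^ 3 * ε ^ 2 / (8 * χ ^ 4 * l)) := by
  have h2 := hp.ê_le_thres
  have h3 := hp.gThres_pos
  have hl := hp.l_pos
  have hχ := hp.χ_pos
  have hc := hp.c_pos
  have hc7 := hp.c_le
  have h4 := hp.ê_nonneg
  have h1 : l * (c / l) = c := by field_simp
  rw [h1]
  have h5 : ê ^ 2 ≤ (√c / χ ^ 2 * ε / 1000) ^ 2 := by gcongr
  have h6 : c / l / 2 * ê ^ 2 - c / l / 2 * (1 - c) * (√c / χ ^ 2 * ε) ^ 2 ≤
      -(c / l / 4 * (√c / χ ^ 2 * ε) ^ 2) := by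
    have h7 : 0 < (√c / χ ^ 2 * ε) ^ 2 := by positivity
    have h8 : c / l / 2 * ê ^ 2 ≤ c / l / 2 * (√c / χ ^ 2 * ε / 1000) ^ 2 := by gcongr
    have h9 : c / l / 2 * (9 / 10) * (√c / χ ^ 2 * ε) ^ 2 ≤
        c / l / 2 * (1 - c) * (√c / χ ^ 2 * ε) ^ 2 := by gcongr; linarith
    have h10 : 0 < c / l * (√c / χ ^ 2 * ε) ^ 2 := by positivity
    nlinarith
  refine h6.trans (neg_le_neg ?_)
  rw [mul_pow, div_pow, Real.sq_sqrt hc.le]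
  have hε := hp.ε_pos
  calc c ^ 3 * ε ^ 2 / (8 * χ ^ 4 * l) = c ^ 2 * ε ^ 2 / (4 * χ ^ 4 * l) * (c / 2) := by
        field_simp; norm_num
    _ ≤ c ^ 2 * ε ^ 2 / (4 * χ ^ 4 * l) * 1 := by gcongr; linarith
    _ = _ := by field_simp

lemma one_le_window : 1 ≤ χ / c ^ 2 * (l / γ) := by
  have h1 : 1 ≤ l / γ := (one_le_div hp.γ_pos).2 hp.γ_le
  have h2 : 1 ≤ χ / c ^ 2 := by
    rw [one_le_div (by have := hp.c_pos; positivity)]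
    nlinarith [hp.χ_ge, hp.c_pos, hp.c_le]
  nlinarith

/-- A window and its test iteration consume at most half of `fThres`; the other half is left for the
perturbation and the noise. Rounding is absorbed by `T + 1 ≤ 3 (χ / c²)(l / γ)`. -/
lemma rate_mul_window_le {T : ℝ} (hT : T ≤ χ / c ^ 2 * (l / γ) + 1) :
    c ^ 3 * ε ^ 2 / (8 * χ ^ 4 * l) * (T + 1) ≤ c / χ ^ 3 * (ε ^ 2 / γ) / 2 := by
  have hl := hp.l_pos
  have hχ := hp.χ_pos
  have hc := hp.c_pos
  have hε := hp.ε_pos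
  have hγ := hp.γ_pos
  have h1 := hp.one_le_window
  calc c ^ 3 * ε ^ 2 / (8 * χ ^ 4 * l) * (T + 1)
      ≤ c ^ 3 * ε ^ 2 / (8 * χ ^ 4 * l) * (3 * (χ / c ^ 2 * (l / γ))) := by gcongr; linarith
    _ = c / χ ^ 3 * (ε ^ 2 / γ) * (3 / 8) := by field_simp
    _ ≤ c / χ ^ 3 * (ε ^ 2 / γ) * (1 / 2) := by
      have := hp.fThres_pos
      linarith
    _ = _ := by ring

end Regime

variable {p : Params d} {f : Vec d → ℝ} {x₀ : Vec d} {u : ℕ → ℕ → Vec d} {ξ : ℕ → Vec d}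

/-- The parameters of the algorithm lie in the regime of the analysis. -/
abbrev Params.InRegime (p : Params d) : Prop :=
  Regime d p.l p.ρ p.ε p.c p.chi √(p.ρ * p.ε) p.epsHat

/-- Guaranteed average decrease of the objective per iteration. -/
def Params.rate (p : Params d) : ℝ := p.c ^ 3 * p.ε ^ 2 / (8 * p.chi ^ 4 * p.l)

lemma Params.le_tThres (p : Params d) :
    p.chi / p.c ^ 2 * (p.l / √(p.ρ * p.ε)) ≤ p.tThres := Nat.le_ceil _

namespace Params.InRegime

variable (hp : p.InRegime)

include hp

lemma sqrt_cube_div : √(p.ε ^ 3 / p.ρ) = p.ε ^ 2 / √(p.ρ * p.ε) := by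
  have hρ := hp.ρ_pos
  have hε := hp.ε_pos
  have h1 : p.ε ^ 3 / p.ρ = (p.ε ^ 2) ^ 2 / (p.ρ * p.ε) := by field_simp
  rw [h1, Real.sqrt_div (by positivity), Real.sqrt_sq (by positivity)]

lemma fThres_eq : p.fThres = p.c / p.chi ^ 3 * (p.ε ^ 2 / √(p.ρ * p.ε)) := by
  rw [Params.fThres, sqrt_cube_div hp]

lemma fThres_pos : 0 < p.fThres := by
  rw [fThres_eq hp]; exact Regime.fThres_pos hp

lemma gThres_pos : 0 < p.gThres := Regime.gThres_pos hp

lemma r_pos : 0 < p.r := div_pos (gThres_pos hp) hp.l_pos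

lemma rate_pos : 0 < p.rate := by
  have h1 := hp.l_pos
  have h2 := Regime.χ_pos hp
  have h3 := hp.c_pos
  have h4 := hp.ε_pos
  unfold Params.rate
  positivity

lemma tThres_lt : (p.tThres : ℝ) < p.chi / p.c ^ 2 * (p.l / √(p.ρ * p.ε)) + 1 :=
  Nat.ceil_lt_add_one (by linarith [Regime.one_le_window hp])

lemma tThres_pos : 0 < p.tThres := by
  have : (0 : ℝ) < p.tThres := by linarith [Regime.one_le_window hp, p.le_tThres]
  exact_mod_cast this

lemma rate_mul_le : p.rate * (p.tThres + 1) ≤ p.fThres / 2 := by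
  rw [fThres_eq hp]
  exact Regime.rate_mul_window_le hp (tThres_lt hp).le

lemma value_step_le (hs : IsSmooth p.l f) {x g : Vec d} (hg : ‖g - gradient f x‖ ≤ p.epsHat) :
    f (x - p.eta • g) ≤ f x + p.fThres / 20 := by
  have hl := hp.l_pos
  have hc := hp.c_pos
  have h1 := hs.step_le x g p.eta
  have h2 : p.eta / 2 * ‖g - gradient f x‖ ^ 2 ≤ p.eta / 2 * p.epsHat ^ 2 := by
    have : 0 < p.eta := div_pos hc hl
    gcongr
  have h3 := Regime.noise_le hp
  rw [← fThres_eq hp] at h3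
  have h4 : 0 ≤ p.eta / 2 * ‖gradient f x‖ ^ 2 := by
    have : 0 < p.eta := div_pos hc hl
    positivity
  have h5 : 0 ≤ p.eta / 2 * (1 - p.l * p.eta) * ‖g‖ ^ 2 := by
    have : 0 < p.eta := div_pos hc hl
    have h6 : p.l * p.eta = p.c := by unfold Params.eta; field_simp
    have h7 : 0 ≤ 1 - p.l * p.eta := by rw [h6]; linarith [hp.c_le]
    positivity
  unfold Params.eta at *
  linarith

lemma value_large_step_le (hs : IsSmooth p.l f) {x g : Vec d}
    (hg : ‖g - gradient f x‖ ≤ p.epsHat) (hlarge : p.gThres < ‖g‖) :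
    f (x - p.eta • g) ≤ f x - p.rate := by
  have hl := hp.l_pos
  have hc := hp.c_pos
  have hη : 0 < p.eta := div_pos hc hl
  have h1 := hs.step_le x g p.eta
  have h2 : p.eta / 2 * ‖g - gradient f x‖ ^ 2 ≤ p.eta / 2 * p.epsHat ^ 2 := by gcongr
  have h4 : 0 ≤ p.eta / 2 * ‖gradient f x‖ ^ 2 := by positivity
  have h5 : p.eta / 2 * (1 - p.l * p.eta) * p.gThres ^ 2 ≤
      p.eta / 2 * (1 - p.l * p.eta) * ‖g‖ ^ 2 := by
    have h6 : p.l * p.eta = p.c := by unfold Params.eta; field_simp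
    have h7 : 0 ≤ 1 - p.l * p.eta := by rw [h6]; linarith [hp.c_le]
    have := gThres_pos hp
    gcongr
  have h3 := Regime.large_step_le hp
  unfold Params.eta Params.gThres Params.rate at *
  linarith

lemma value_perturb_le (hs : IsSmooth p.l f) {x g w : Vec d}
    (hg : ‖g - gradient f x‖ ≤ p.epsHat) (hsmall : ‖g‖ ≤ p.gThres) (hw : ‖w‖ ≤ p.r) :
    f (x + w) ≤ f x + 2 / 5 * p.fThres := by
  have hl := hp.l_pos
  have h1 := (abs_le.1 (hs.abs_sub_sub_inner_le x w)).2
  have h2 : ‖gradient f x‖ ≤ p.gThres + p.epsHat := by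
    calc ‖gradient f x‖ = ‖g - (g - gradient f x)‖ := by congr 1; abel
      _ ≤ _ := (_root_.norm_sub_le _ _).trans (by linarith)
  have h3 : ⟪gradient f x, w⟫ ≤ (p.gThres + p.epsHat) * p.r := by
    refine (real_inner_le_norm _ _).trans ?_
    have := (norm_nonneg _).trans h2
    gcongr
  have h4 : p.l / 2 * ‖w‖ ^ 2 ≤ p.l / 2 * p.r ^ 2 := by gcongr
  have h5 := Regime.perturb_le hp
  rw [← fThres_eq hp] at h5
  unfold Params.r Params.gThres at *
  linarith

end Params.InRegime

open Classical in
/-- Number of perturbations before iteration `n`. -/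
def perturbCount (p : Params d) (f : Vec d → ℝ) (x₀ : Vec d) (u : ℕ → ℕ → Vec d) (ξ : ℕ → Vec d)
    (n : ℕ) : ℕ :=
  ((Finset.range n).filter (Perturbs p f x₀ u ξ)).card

lemma perturbCount_succ_of_perturbs {n : ℕ} (h : Perturbs p f x₀ u ξ n) :
    perturbCount p f x₀ u ξ (n + 1) = perturbCount p f x₀ u ξ n + 1 := by
  classical
  rw [perturbCount, Finset.range_add_one, Finset.filter_insert, if_pos h,
    Finset.card_insert_of_notMem (by simp), perturbCount]

lemma perturbCount_succ_of_not_perturbs {n : ℕ} (h : ¬ Perturbs p f x₀ u ξ n) :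
    perturbCount p f x₀ u ξ (n + 1) = perturbCount p f x₀ u ξ n := by
  classical
  rw [perturbCount, Finset.range_add_one, Finset.filter_insert, if_neg h, perturbCount]

/-- As long as the gradient estimates are accurate, the objective decreases linearly in the number
of iterations and in the number of perturbations. -/
lemma progress (hp : p.InRegime) (hs : IsSmooth p.l f) (hξ : ∀ k, ‖ξ k‖ ≤ p.r) {n : ℕ}
    (h : (run p f x₀ u ξ n).output = none) (hacc : ∀ j < n, Accurate p f x₀ u ξ j) :
    ((n : ℤ) - (run p f x₀ u ξ n).tTemp > (p.tThres : ℤ) ∧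
      f (run p f x₀ u ξ n).x + p.rate * n ≤ f x₀ ∧
      f (run p f x₀ u ξ n).x + p.fThres / 2 * perturbCount p f x₀ u ξ n ≤ f x₀) ∨
    ∃ k, InWindow p f x₀ u ξ k n ∧
      f ((run p f x₀ u ξ k).x + ξ k) + p.rate * k ≤ f x₀ + 2 / 5 * p.fThres ∧
      f ((run p f x₀ u ξ k).x + ξ k) + p.fThres / 2 * (perturbCount p f x₀ u ξ n - 1) ≤
        f x₀ + 2 / 5 * p.fThres := by
  have hT := Params.InRegime.tThres_pos hp
  have hft := Params.InRegime.fThres_pos hp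
  induction n with
  | zero => left; simp [run, initState, perturbCount]
  | succ n ih =>
    have h0 := output_none_of_succ h
    have ih := ih h0 fun j hj => hacc j (hj.trans n.lt_succ_self)
    have haccn := hacc n n.lt_succ_self
    by_cases hper : Perturbs p f x₀ u ξ n
    · right
      obtain ⟨h1, h2, h3, -⟩ := run_succ_of_perturbs h0 hT hper
      have hwin : InWindow p f x₀ u ξ n (n + 1) :=
        ⟨n.lt_succ_self, by omega, hper, h2, h3, h1, fun j hj hj' => by omega⟩
      have hv := Params.InRegime.value_perturb_le hp hs haccn hper.2.1 (hξ n)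
      rcases ih with ⟨-, hr, hc⟩ | ⟨k, hk, -⟩
      · refine ⟨n, hwin, by linarith, ?_⟩
        rw [perturbCount_succ_of_perturbs hper]
        push_cast
        linarith
      · exact absurd hper hk.not_perturbs
    · rw [perturbCount_succ_of_not_perturbs hper]
      rcases ih with ⟨hfree, hr, hc⟩ | ⟨k, hk, hr, hc⟩
      · left
        obtain ⟨h1, h2, -, -⟩ := run_succ_of_not_perturbs_of_ne h0 hper (by omega)
        -- Outside a window, a large estimate is the only possible reason for not perturbing.
        have hlarge : p.gThres < ‖runGrad p f x₀ u ξ n‖ := by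
          by_contra hcon
          exact hper ⟨h0, not_lt.1 hcon, hfree⟩
        have hv := Params.InRegime.value_large_step_le hp hs haccn hlarge
        have hrate := Params.InRegime.rate_pos hp
        rw [h1, h2]
        refine ⟨by push_cast; omega, ?_, by linarith⟩
        push_cast
        linarith
      · rcases eq_or_ne ((n : ℤ) - (run p f x₀ u ξ n).tTemp) p.tThres with heq | hne
        · rcases run_succ_of_eq h0 heq with ⟨-, h1, -⟩ | ⟨hdec, h1, h2, -⟩
          · rw [h] at h1; simp at h1
          · left
            -- Budget of the decrease `fThres`: `2/5` for the perturbation, `1/20` for the step of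
            -- the test iteration, and `1/2` for either the `tThres + 1` iterations or the one
            -- perturbation being counted.
            have hv := Params.InRegime.value_step_le hp hs haccn
            rw [hk.xTemp] at hdec
            rw [hk.tTemp] at heq
            have hn : (n : ℝ) = k + p.tThres := by
              have : (n : ℤ) = k + p.tThres := by omega
              exact_mod_cast this
            have hwr := Params.InRegime.rate_mul_le hp
            rw [h1, h2]
            refine ⟨by rw [hk.tTemp]; push_cast; omega, ?_, by linarith⟩
            push_cast
            rw [hn]
            linarith
        · right
          rcases free_or_inWindow hT h with hfree' | ⟨k', hk'⟩
          · obtain ⟨-, h2, -, -⟩ := run_succ_of_not_perturbs_of_ne h0 hper hne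
            rw [h2] at hfree'
            have := hk.le
            rw [hk.tTemp] at hfree' hne
            push_cast at hfree'
            omega
          · obtain ⟨-, h2, -, -⟩ := run_succ_of_not_perturbs_of_ne h0 hper hne
            have h3 : (k' : ℤ) = k := by rw [← hk'.tTemp, h2, hk.tTemp]
            have h4 : k' = k := by exact_mod_cast h3
            subst h4
            exact ⟨k', hk', hr, hc⟩

/-- Bound on the number of iterations. -/
lemma rate_mul_le_of_running (hp : p.InRegime) (hs : IsSmooth p.l f) (hbdd : BddBelow (Set.range f))
    (hξ : ∀ k, ‖ξ k‖ ≤ p.r) {n : ℕ} (h : (run p f x₀ u ξ n).output = none)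
    (hacc : ∀ j < n, Accurate p f x₀ u ξ j) : p.rate * n ≤ f x₀ - (⨅ x, f x) + p.fThres := by
  have hft := Params.InRegime.fThres_pos hp
  have hwr := Params.InRegime.rate_mul_le hp
  have hrate := Params.InRegime.rate_pos hp
  rcases progress hp hs hξ h hacc with ⟨-, h1, -⟩ | ⟨k, hk, h1, -⟩
  · have := ciInf_le hbdd (run p f x₀ u ξ n).x
    linarith
  · have := ciInf_le hbdd ((run p f x₀ u ξ k).x + ξ k)
    have h2 : p.rate * n ≤ p.rate * (k + p.tThres) := by
      gcongr
      exact_mod_cast hk.le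
    linarith

/-- Bound on the number of perturbations. -/
lemma perturbCount_le_of_running (hp : p.InRegime) (hs : IsSmooth p.l f)
    (hbdd : BddBelow (Set.range f))
    (hξ : ∀ k, ‖ξ k‖ ≤ p.r) {n : ℕ} (h : (run p f x₀ u ξ n).output = none)
    (hacc : ∀ j < n, Accurate p f x₀ u ξ j) :
    p.fThres / 2 * perturbCount p f x₀ u ξ n ≤ f x₀ - (⨅ x, f x) + p.fThres := by
  have hft := Params.InRegime.fThres_pos hp
  rcases progress hp hs hξ h hacc with ⟨-, -, h1⟩ | ⟨k, hk, -, h1⟩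
  · have := ciInf_le hbdd (run p f x₀ u ξ n).x
    linarith
  · have := ciInf_le hbdd ((run p f x₀ u ξ k).x + ξ k)
    linarith

/-- The value at a point that is perturbed hardly exceeds the initial value. -/
lemma value_perturbed_le (hp : p.InRegime) (hs : IsSmooth p.l f)
    (hξ : ∀ k, ‖ξ k‖ ≤ p.r) {n : ℕ} (h : Perturbs p f x₀ u ξ n)
    (hacc : ∀ j ≤ n, Accurate p f x₀ u ξ j) :
    f ((run p f x₀ u ξ n).x + ξ n) ≤ f x₀ + 2 / 5 * p.fThres := by
  have hft := Params.InRegime.fThres_pos hp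
  have hrate := Params.InRegime.rate_pos hp
  rcases progress hp hs hξ h.1 (fun j hj => hacc j hj.le) with ⟨-, h1, -⟩ | ⟨k, hk, -, -⟩
  · have := Params.InRegime.value_perturb_le hp hs (hacc n le_rfl) h.2.1 (hξ n)
    have : 0 ≤ p.rate * n := by positivity
    linarith
  · exact absurd h hk.not_perturbs

end Progress

/-! ### Correctness of the returned point -/

section Outcome

variable {d : ℕ} {p : Params d} {f : Vec d → ℝ} {x₀ : Vec d} {u : ℕ → ℕ → Vec d} {ξ : ℕ → Vec d}

namespace Params.InRegime

variable (hp : p.InRegime)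

include hp

lemma tThres_pred : ((p.tThres - 1 : ℕ) : ℝ) = p.tThres - 1 := by
  have := tThres_pos hp
  push_cast [Nat.cast_sub this]
  simp

/-- The perturbation changes the Hessian by at most half of the curvature threshold. Curvature below
`-γ` at a perturbed point therefore forces curvature at most `-γ / 2` at the center. -/
lemma hessian_perturb_le : p.ρ * p.r ≤ √(p.ρ * p.ε) / 2 := by
  have hl := hp.l_pos
  have hγ := hp.γ_pos
  have hχ := Regime.χ_pos hp
  have h1 : p.ρ * p.r = √(p.ρ * p.ε) * ((√(p.ρ * p.ε) / p.l) * (√p.c / p.chi ^ 2)) := by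
    have h2 := hp.γ_sq
    rw [Params.r, Params.gThres]
    have h3 : √(p.ρ * p.ε) * ((√(p.ρ * p.ε) / p.l) * (√p.c / p.chi ^ 2)) =
      √(p.ρ * p.ε) ^ 2 * (√p.c / (p.l * p.chi ^ 2)) := by ring
    rw [h3, h2]
    ring
  have h2 : √p.c / p.chi ^ 2 ≤ 1 / 2 := by
    have h3 : √p.c ≤ 1 := by
      rw [Real.sqrt_le_iff]; constructor <;> linarith [hp.c_le]
    rw [div_le_div_iff₀ (by positivity) (by norm_num)]
    nlinarith [hp.χ_ge]
  rw [h1, div_eq_mul_one_div _ (2 : ℝ)]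
  have h4 := Regime.ratio_le hp
  have h5 : (√(p.ρ * p.ε) / p.l) * (√p.c / p.chi ^ 2) ≤ 1 * (1 / 2) := by
    gcongr
  gcongr
  linarith

lemma norm_gradient_perturbed_le (hs : IsSmooth p.l f) {x g w : Vec d}
    (hg : ‖g - gradient f x‖ ≤ p.epsHat) (hsmall : ‖g‖ ≤ p.gThres) (hw : ‖w‖ ≤ p.r) :
    ‖gradient f (x + w)‖ ≤ p.ε := by
  have hl := hp.l_pos
  have hε := hp.ε_pos
  have hχ := hp.χ_ge
  have h1 : ‖gradient f (x + w) - gradient f x‖ ≤ p.gThres := by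
    refine (hs.2 _ _).trans ?_
    rw [add_sub_cancel_left]
    calc p.l * ‖w‖ ≤ p.l * p.r := by gcongr
      _ = p.gThres := by unfold Params.r; field_simp
  have h2 : p.epsHat ≤ p.gThres / 1000 := Regime.ê_le_thres hp
  have h3 : ‖gradient f (x + w)‖ ≤
      ‖gradient f (x + w) - gradient f x‖ + ‖g - gradient f x‖ + ‖g‖ := by
    have : gradient f (x + w) = (gradient f (x + w) - gradient f x) - (g - gradient f x) + g := by
      abel
    conv_lhs => rw [this]
    exact (norm_add_le _ _).trans (add_le_add (_root_.norm_sub_le _ _) le_rfl)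
  have h4 : 3 * p.gThres ≤ p.ε := by
    have h5 : √p.c ≤ 1 := by
      rw [Real.sqrt_le_iff]; constructor <;> linarith [hp.c_le]
    have h6 : √p.c / p.chi ^ 2 ≤ 1 / 3 := by
      rw [div_le_div_iff₀ (by positivity) (by norm_num)]
      nlinarith
    have h7 : √p.c / p.chi ^ 2 * p.ε ≤ 1 / 3 * p.ε := by gcongr
    unfold Params.gThres
    linarith
  have := gThres_pos hp
  linarith

/-- The direction is the bottom eigenvector of the Hessian at the unperturbed `x`, so one direction
serves all failing perturbations. A single failing perturbation already shows that this eigenvalue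
is at most `-γ / 2`. -/
lemma exists_thin_direction (hs : IsSmooth p.l f) (hf : IsHessianLipschitz p.ρ f) {k : ℕ}
    {x w : Vec d} (hw : FailsEscape p f u k x w) :
    ∃ e : Vec d, ‖e‖ = 1 ∧ ∀ w₁ w₂, FailsEscape p f u k x w₁ → FailsEscape p f u k x w₂ →
      ∀ μ : ℝ, w₁ - w₂ = μ • e →
        |μ| ≤ 1 / 8 * √(d : ℝ) * (p.l / √(p.ρ * p.ε)) * Real.exp (-p.chi) * p.r := by
  obtain ⟨z, hz, hzc⟩ := hw.curvature
  have hcurv : ⟪hessian f x z, z⟫ ≤ -(√(p.ρ * p.ε) / 2) := by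
    have h1 : ⟪(hessian f x - hessian f (x + w)) z, z⟫ ≤ p.ρ * p.r := by
      refine (real_inner_le_norm _ _).trans ?_
      rw [hz, mul_one]
      refine (ContinuousLinearMap.le_opNorm _ _).trans ?_
      rw [hz, mul_one]
      refine (hf.2.2 _ _).trans ?_
      have := hp.ρ_pos
      gcongr
      simpa using hw.norm_le
    rw [sub_apply, inner_sub_left] at h1
    have := hessian_perturb_le hp
    linarith
  obtain ⟨e, γ₁, he, hγ₁, heig, hmin⟩ :=
    exists_min_eigenvector (hf.inner_hessian_comm x) hz hcurv
  refine ⟨e, he, fun w₁ w₂ h₁ h₂ μ hμ => ?_⟩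
  have hT := tThres_pred hp
  -- The first of the `tThres` steps of a window uses the estimate taken before the perturbation. It
  -- is common to both trajectories, so their difference is unchanged and `tThres - 1` steps remain.
  have := Regime.abs_lt_of_not_decrease hp hs hf (N := p.tThres - 1)
    (by rw [hT]; linarith [tThres_lt hp]) (by rw [hT]; linarith [p.le_tThres])
    (x := x) (x₁ := x + w₁) (x₂ := x + w₂) (g := gradEst p f (u k) x) he hγ₁ heig hmin
    (by rw [add_sub_cancel_left]; exact h₁.norm_le)
    (by rw [add_sub_cancel_left]; exact h₂.norm_le)
    (by rw [add_sub_add_left_eq_sub]; exact hμ) h₁.grad_le h₁.accurate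
    (G₁ := fun s => gradEst p f (u (k + 1 + s)) (traj p f (fun s => u (k + 1 + s))
      (x + w₁ - p.eta • gradEst p f (u k) x) s))
    (y₁ := traj p f (fun s => u (k + 1 + s)) (x + w₁ - p.eta • gradEst p f (u k) x))
    (G₂ := fun s => gradEst p f (u (k + 1 + s)) (traj p f (fun s => u (k + 1 + s))
      (x + w₂ - p.eta • gradEst p f (u k) x) s))
    (y₂ := traj p f (fun s => u (k + 1 + s)) (x + w₂ - p.eta • gradEst p f (u k) x))
    rfl rfl ⟨fun s _ => rfl, h₁.accurate_traj⟩ ⟨fun s _ => rfl, h₂.accurate_traj⟩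
    (by rw [← fThres_eq hp]; exact h₁.no_decrease) (by rw [← fThres_eq hp]; exact h₂.no_decrease)
  exact this.le

end Params.InRegime

/-- Points with negative curvature lie well above the infimum. -/
lemma iInf_add_le_of_negative_curvature (hp : p.InRegime) (hf : IsHessianLipschitz p.ρ f)
    (hbdd : BddBelow (Set.range f)) {x : Vec d}
    (hx : ∃ w : Vec d, ‖w‖ = 1 ∧ ⟪hessian f x w, w⟫ < -√(p.ρ * p.ε)) :
    (⨅ x, f x) + √(p.ε ^ 3 / p.ρ) / 16 ≤ f x := by
  obtain ⟨w, hw, hc⟩ := hx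
  obtain ⟨y, hy⟩ := hf.exists_le_of_negative_curvature hp.ρ_pos hp.γ_pos hw hc
  have h1 := ciInf_le hbdd y
  have h2 : √(p.ε ^ 3 / p.ρ) = √(p.ρ * p.ε) ^ 3 / p.ρ ^ 2 := by
    have hγ := hp.γ_pos
    have hρ := hp.ρ_pos
    rw [Params.InRegime.sqrt_cube_div hp, div_eq_div_iff hγ.ne' (by positivity)]
    have h3 : √(p.ρ * p.ε) ^ 3 * √(p.ρ * p.ε) = (√(p.ρ * p.ε) ^ 2) ^ 2 := by ring
    rw [h3, hp.γ_sq]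
    ring
  rw [h2]
  have h3 : √(p.ρ * p.ε) ^ 3 / (16 * p.ρ ^ 2) = √(p.ρ * p.ε) ^ 3 / p.ρ ^ 2 / 16 := by ring
  linarith

/-- If all gradient estimates are accurate and no perturbation fails to escape, the algorithm
returns a second-order stationary point. -/
lemma exists_returns (hp : p.InRegime) (hs : IsSmooth p.l f) (hbdd : BddBelow (Set.range f))
    (hξ : ∀ k, ‖ξ k‖ ≤ p.r) {N : ℕ} (hN : f x₀ - (⨅ x, f x) + p.fThres < p.rate * N)
    (hacc : ∀ j < N, Accurate p f x₀ u ξ j)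
    (hesc : ∀ k < N, Perturbs p f x₀ u ξ k →
      ¬ FailsEscape p f u k (run p f x₀ u ξ k).x (ξ k)) :
    ∃ (y : Vec d) (T Q : ℕ), Returns p f x₀ u ξ y T Q ∧ IsSOSP p.ρ p.ε f y ∧ T ≤ N ∧
      Q ≤ T * (2 * p.m + 2) := by
  have hT := Params.InRegime.tThres_pos hp
  have hret : (run p f x₀ u ξ N).output ≠ none := fun h => by
    have := rate_mul_le_of_running hp hs hbdd hξ h hacc
    linarith
  classical
  have hex : ∃ n, (run p f x₀ u ξ n).output ≠ none := ⟨N, hret⟩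
  obtain ⟨n, hn, hnone, hsome⟩ : ∃ n, n < N ∧ (run p f x₀ u ξ n).output = none ∧
      (run p f x₀ u ξ (n + 1)).output ≠ none := by
    have h1 := Nat.find_spec hex
    have h2 := Nat.find_min' hex hret
    rcases hm : Nat.find hex with _ | n
    · rw [hm] at h1; exact absurd rfl h1
    · rw [hm] at h1 h2
      refine ⟨n, by omega, ?_, h1⟩
      exact not_not.1 (Nat.find_min hex (m := n) (by omega))
  have hper : ¬ Perturbs p f x₀ u ξ n := fun hc => hsome (run_succ_of_perturbs hnone hT hc).2.2.2
  have heq : (n : ℤ) - (run p f x₀ u ξ n).tTemp = p.tThres := by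
    by_contra hne
    exact hsome (run_succ_of_not_perturbs_of_ne hnone hper hne).2.2.2
  obtain ⟨hval, hout, ht⟩ : _ ∧ _ ∧ _ := by
    rcases run_succ_of_eq hnone heq with h | ⟨-, -, -, h⟩
    · exact h
    · exact absurd h hsome
  rcases free_or_inWindow hT hnone with hfree | ⟨k, hk⟩
  · omega
  -- The test compares the iterate before the update of iteration `k + tThres`, so the trajectory
  -- starting at iteration `k + 1` has made `tThres - 1` steps.
  have hkn : n = k + 1 + (p.tThres - 1) := by
    rw [hk.tTemp] at heq
    omega
  have hkN : k < N := hk.lt.trans hn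
  rw [hk.xTemp] at hval hout
  refine ⟨_, n + 1, _, ⟨n + 1, hout, ht, rfl⟩, ?_, hn, ?_⟩
  · have hgrad := Params.InRegime.norm_gradient_perturbed_le hp hs (hacc k hkN) hk.perturbs.2.1
      (hξ k)
    refine ⟨hgrad, le_lambdaMin (Real.sqrt_nonneg _) fun w hw => ?_⟩
    by_contra hcon
    refine hesc k hkN hk.perturbs ⟨hξ k, hk.perturbs.2.1, hacc k hkN, ⟨w, hw, not_le.1 hcon⟩,
      fun s hs' => ?_, ?_⟩
    · rw [← hk.run_eq_traj (by omega)]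
      exact hacc (k + 1 + s) (by omega)
    · rw [← hk.run_eq_traj hkn.ge, ← hkn]
      exact hval
  · have := run_queries_le (p := p) (f := f) (x₀ := x₀) (u := u) (ξ := ξ) (n + 1)
    rwa [ht] at this

end Outcome

/-! ### Measurability and locality of a run -/

section Measurability

variable {d : ℕ} {p : Params d} {f : Vec d → ℝ} {x₀ : Vec d}

/-- The state before iteration `n` depends only on earlier inputs. This causality is what makes the
current samples, or the current perturbation, fresh. -/
lemma run_congr {u u' : ℕ → ℕ → Vec d} {ξ ξ' : ℕ → Vec d} {n : ℕ}
    (hu : ∀ j < n, ∀ i, u j i = u' j i) (hξ : ∀ j < n, ξ j = ξ' j) :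
    run p f x₀ u ξ n = run p f x₀ u' ξ' n := by
  induction n with
  | zero => rfl
  | succ n ih =>
    have h1 : u n = u' n := funext (hu n n.lt_succ_self)
    rw [run, run, ih (fun j hj => hu j (hj.trans n.lt_succ_self))
      (fun j hj => hξ j (hj.trans n.lt_succ_self)), h1, hξ n n.lt_succ_self]

section StepFields

open Classical

variable (u : ℕ → Vec d) (ξ : Vec d) (s : State d)

/-- The test for perturbing in state `s`. -/
def PerturbTest (p : Params d) (f : Vec d → ℝ) (u : ℕ → Vec d) (s : State d) : Prop :=
  ‖gradEst p f u s.x‖ ≤ p.gThres ∧ (s.t : ℤ) - s.tTemp > (p.tThres : ℤ)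

/-- Iterate after a possible perturbation. -/
def newX (p : Params d) (f : Vec d → ℝ) (u : ℕ → Vec d) (ξ : Vec d) (s : State d) : Vec d :=
  if PerturbTest p f u s then s.x + ξ else s.x

/-- Time of the last perturbation after a possible perturbation. -/
def newTTemp (p : Params d) (f : Vec d → ℝ) (u : ℕ → Vec d) (s : State d) : ℤ :=
  if PerturbTest p f u s then (s.t : ℤ) else s.tTemp

/-- Last perturbed iterate after a possible perturbation. -/
def newXTemp (p : Params d) (f : Vec d → ℝ) (u : ℕ → Vec d) (ξ : Vec d) (s : State d) : Vec d :=
  if PerturbTest p f u s then newX p f u ξ s else s.xTemp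

/-- The test for returning in state `s`. -/
def HaltTest (p : Params d) (f : Vec d → ℝ) (u : ℕ → Vec d) (ξ : Vec d) (s : State d) : Prop :=
  (s.t : ℤ) - newTTemp p f u s = (p.tThres : ℤ) ∧
    f (newX p f u ξ s) - f (newXTemp p f u ξ s) > -p.fThres

lemma step_t : (step p f u ξ s).t = if s.output = none then s.t + 1 else s.t := by
  rcases h : s.output with _ | y <;> simp [step, h]

lemma step_x : (step p f u ξ s).x =
    if s.output = none then
      (if HaltTest p f u ξ s then newX p f u ξ s
        else newX p f u ξ s - p.eta • gradEst p f u s.x)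
    else s.x := by
  rcases h : s.output with _ | y
  · simp [step, h, HaltTest, newX, newTTemp, newXTemp, PerturbTest]
  · simp [step, h]

lemma step_tTemp : (step p f u ξ s).tTemp =
    if s.output = none then newTTemp p f u s else s.tTemp := by
  rcases h : s.output with _ | y
  · simp [step, h, newTTemp, PerturbTest]
  · simp [step, h]

lemma step_xTemp : (step p f u ξ s).xTemp =
    if s.output = none then newXTemp p f u ξ s else s.xTemp := by
  rcases h : s.output with _ | y
  · simp [step, h, newX, newXTemp, PerturbTest]
  · simp [step, h]

lemma step_output_eq_none_iff : (step p f u ξ s).output = none ↔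
    s.output = none ∧ ¬ HaltTest p f u ξ s := by
  rcases h : s.output with _ | y
  · have : (step p f u ξ s).output =
        if HaltTest p f u ξ s then some (newXTemp p f u ξ s) else none := by
      simp [step, h, HaltTest, newX, newTTemp, newXTemp, PerturbTest]
    rw [this]
    simp
  · simp [step, h]

end StepFields

variable {α : Type*} [MeasurableSpace α]

lemma measurable_gradEst (hf : Continuous f) {w : α → ℕ → Vec d} {x : α → Vec d}
    (hw : ∀ i, Measurable fun a => w a i) (hx : Measurable x) :
    Measurable fun a => gradEst p f (w a) (x a) := by
  unfold gradEst
  have hs : Measurable fun a => ∑ i ∈ Finset.range p.m,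
      ((f (x a + p.v • w a i) - f (x a)) / p.v) • w a i := by
    refine Finset.measurable_fun_sum _ fun i _ => ?_
    have h1 : Measurable fun a => x a + p.v • w a i := hx.add ((hw i).const_smul p.v)
    exact (((hf.measurable.comp h1).sub (hf.measurable.comp hx)).div_const _).smul (hw i)
  exact hs.const_smul (1 / (p.m : ℝ))

lemma measurable_traj (hf : Continuous f) {w : α → ℕ → ℕ → Vec d} {y : α → Vec d}
    (hw : ∀ j i, Measurable fun a => w a j i) (hy : Measurable y) (s : ℕ) :
    Measurable fun a => traj p f (w a) (y a) s := by
  induction s with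
  | zero => exact hy
  | succ s ih => exact ih.sub ((measurable_gradEst hf (hw s) ih).const_smul p.eta)

variable {U : α → ℕ → ℕ → Vec d} {Ξ : α → ℕ → Vec d}

lemma measurable_run (hf : Continuous f) (hU : ∀ j i, Measurable fun a => U a j i)
    (hΞ : ∀ j, Measurable fun a => Ξ a j) (n : ℕ) :
    Measurable (fun a => (run p f x₀ (U a) (Ξ a) n).t) ∧
    Measurable (fun a => (run p f x₀ (U a) (Ξ a) n).x) ∧
    Measurable (fun a => (run p f x₀ (U a) (Ξ a) n).tTemp) ∧
    Measurable (fun a => (run p f x₀ (U a) (Ξ a) n).xTemp) ∧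
    MeasurableSet {a | (run p f x₀ (U a) (Ξ a) n).output = none} := by
  classical
  induction n with
  | zero => simp [run, initState]
  | succ n ih =>
    obtain ⟨ht, hx, hT, hX, ho⟩ := ih
    set s : α → State d := fun a => run p f x₀ (U a) (Ξ a) n
    have hg : Measurable fun a => gradEst p f (U a n) (s a).x := measurable_gradEst hf (hU n) hx
    have ht' : Measurable fun a => ((s a).t : ℤ) := (measurable_from_top (f := Nat.cast)).comp ht
    have hP : MeasurableSet {a | PerturbTest p f (U a n) (s a)} :=
      (measurableSet_le hg.norm measurable_const).inter
        (measurableSet_lt measurable_const (ht'.sub hT))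
    have hnX : Measurable fun a => newX p f (U a n) (Ξ a n) (s a) :=
      Measurable.ite hP (hx.add (hΞ n)) hx
    have hnT : Measurable fun a => newTTemp p f (U a n) (s a) := Measurable.ite hP ht' hT
    have hnXT : Measurable fun a => newXTemp p f (U a n) (Ξ a n) (s a) := Measurable.ite hP hnX hX
    have hH : MeasurableSet {a | HaltTest p f (U a n) (Ξ a n) (s a)} :=
      (measurableSet_eq_fun (ht'.sub hnT) measurable_const).inter
        (measurableSet_lt measurable_const
          ((hf.measurable.comp hnX).sub (hf.measurable.comp hnXT)))
    simp only [run, step_t, step_x, step_tTemp, step_xTemp, step_output_eq_none_iff]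
    exact ⟨Measurable.ite ho (ht.add_const 1) ht,
      Measurable.ite ho (Measurable.ite hH hnX (hnX.sub (hg.const_smul p.eta))) hx,
      Measurable.ite ho hnT hT, Measurable.ite ho hnXT hX, ho.inter hH.compl⟩

lemma measurable_runGrad (hf : Continuous f) (hU : ∀ j i, Measurable fun a => U a j i)
    (hΞ : ∀ j, Measurable fun a => Ξ a j) (n : ℕ) :
    Measurable fun a => runGrad p f x₀ (U a) (Ξ a) n :=
  measurable_gradEst hf (hU n) (measurable_run hf hU hΞ n).2.1

lemma measurableSet_perturbs (hf : Continuous f) (hU : ∀ j i, Measurable fun a => U a j i)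
    (hΞ : ∀ j, Measurable fun a => Ξ a j) (n : ℕ) :
    MeasurableSet {a | Perturbs p f x₀ (U a) (Ξ a) n} := by
  obtain ⟨-, -, hT, -, ho⟩ := measurable_run (p := p) (x₀ := x₀) hf hU hΞ n
  exact ho.inter ((measurableSet_le (measurable_runGrad hf hU hΞ n).norm measurable_const).inter
    (measurableSet_lt measurable_const (measurable_const.sub hT)))

lemma measurableSet_accurate (hf : Continuous f) (hf' : Continuous (gradient f))
    (hU : ∀ j i, Measurable fun a => U a j i) (hΞ : ∀ j, Measurable fun a => Ξ a j) (n : ℕ) :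
    MeasurableSet {a | Accurate p f x₀ (U a) (Ξ a) n} :=
  measurableSet_le ((measurable_runGrad hf hU hΞ n).sub
    (hf'.measurable.comp (measurable_run hf hU hΞ n).2.1)).norm measurable_const

lemma failsEscape_iff (u : ℕ → ℕ → Vec d) (k : ℕ) (x w : Vec d) :
    FailsEscape p f u k x w ↔
      ‖w‖ ≤ p.r ∧ ‖gradEst p f (u k) x‖ ≤ p.gThres ∧
      ‖gradEst p f (u k) x - gradient f x‖ ≤ p.epsHat ∧
      (∃ v : Vec d, ‖v‖ = 1 ∧ ⟪hessian f (x + w) v, v⟫ < -√(p.ρ * p.ε)) ∧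
      (∀ s, s < p.tThres - 1 →
        ‖gradEst p f (u (k + 1 + s)) (traj p f (fun s => u (k + 1 + s))
            (x + w - p.eta • gradEst p f (u k) x) s) -
          gradient f (traj p f (fun s => u (k + 1 + s))
            (x + w - p.eta • gradEst p f (u k) x) s)‖ ≤ p.epsHat) ∧
      -p.fThres < f (traj p f (fun s => u (k + 1 + s))
        (x + w - p.eta • gradEst p f (u k) x) (p.tThres - 1)) - f (x + w) :=
  ⟨fun h => ⟨h.1, h.2, h.3, h.4, h.5, h.6⟩,
    fun ⟨h1, h2, h3, h4, h5, h6⟩ => ⟨h1, h2, h3, h4, h5, h6⟩⟩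

lemma measurableSet_failsEscape (hf : Continuous f) (hf' : Continuous (gradient f))
    (hf'' : Continuous (hessian f)) (hU : ∀ j i, Measurable fun a => U a j i)
    {x w : α → Vec d} (hx : Measurable x) (hw : Measurable w) (k : ℕ) :
    MeasurableSet {a | FailsEscape p f (U a) k (x a) (w a)} := by
  simp only [failsEscape_iff]
  have hg : Measurable fun a => gradEst p f (U a k) (x a) := measurable_gradEst hf (hU k) hx
  have hy : ∀ s, Measurable fun a => traj p f (fun s => U a (k + 1 + s))
      (x a + w a - p.eta • gradEst p f (U a k) (x a)) s := fun s =>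
    measurable_traj hf (fun j i => hU _ i) ((hx.add hw).sub (hg.const_smul p.eta)) s
  -- The existential ranges over uncountably many directions, but it describes a union of open sets,
  -- since the Hessian is continuous.
  have hopen : IsOpen {y : Vec d | ∃ v : Vec d, ‖v‖ = 1 ∧ ⟪hessian f y v, v⟫ < -√(p.ρ * p.ε)} := by
    have : {y : Vec d | ∃ v : Vec d, ‖v‖ = 1 ∧ ⟪hessian f y v, v⟫ < -√(p.ρ * p.ε)} =
        ⋃ v ∈ {v : Vec d | ‖v‖ = 1}, {y | ⟪hessian f y v, v⟫ < -√(p.ρ * p.ε)} := by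
      ext y; simp
    rw [this]
    refine isOpen_biUnion fun v _ => isOpen_lt ?_ continuous_const
    exact (hf''.clm_apply continuous_const).inner continuous_const
  refine (measurableSet_le hw.norm measurable_const).inter
    ((measurableSet_le hg.norm measurable_const).inter
    ((measurableSet_le (hg.sub (hf'.measurable.comp hx)).norm measurable_const).inter
    (((hx.add hw) hopen.measurableSet).inter (MeasurableSet.inter ?_ ?_))))
  · have : {a | ∀ s, s < p.tThres - 1 →
        ‖gradEst p f (U a (k + 1 + s)) (traj p f (fun s => U a (k + 1 + s))
            (x a + w a - p.eta • gradEst p f (U a k) (x a)) s) -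
          gradient f (traj p f (fun s => U a (k + 1 + s))
            (x a + w a - p.eta • gradEst p f (U a k) (x a)) s)‖ ≤ p.epsHat} =
        ⋂ s, ⋂ (_ : s < p.tThres - 1), {a |
        ‖gradEst p f (U a (k + 1 + s)) (traj p f (fun s => U a (k + 1 + s))
            (x a + w a - p.eta • gradEst p f (U a k) (x a)) s) -
          gradient f (traj p f (fun s => U a (k + 1 + s))
            (x a + w a - p.eta • gradEst p f (U a k) (x a)) s)‖ ≤ p.epsHat} := by
      ext a; simp
    refine (congrArg MeasurableSet this).mpr (MeasurableSet.iInter fun s =>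
      MeasurableSet.iInter fun _ => measurableSet_le
        ((measurable_gradEst hf (fun i => hU _ i) (hy s)).sub
        (hf'.measurable.comp (hy s))).norm measurable_const)
  · exact measurableSet_lt measurable_const
      ((hf.measurable.comp (hy _)).sub (hf.measurable.comp (hx.add hw)))

end Measurability

/-! ### Conditioning on an independent part of the inputs -/

section Independence

variable {Ω : Type*} [MeasurableSpace Ω] {P : Measure Ω}

/-- Disjoint parts of an independent family are independent. -/
lemma indepFun_indicator {ι E : Type*} [MeasurableSpace E] [Zero E] {Z : ι → Ω → E}
    (hZ : ∀ i, Measurable (Z i)) (hind : iIndepFun Z P) {S T : Set ι} (hST : Disjoint S T) :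
    IndepFun (fun ω => S.indicator fun i => Z i ω) (fun ω => T.indicator fun i => Z i ω) P := by
  have h := indep_iSup_of_disjoint (fun i => (hZ i).comap_le) hind.iIndep hST
  have hle : ∀ S : Set ι, MeasurableSpace.comap (fun ω => S.indicator fun i => Z i ω)
      MeasurableSpace.pi ≤ ⨆ i ∈ S, MeasurableSpace.comap (Z i) inferInstance := by
    intro S
    rw [← measurable_iff_comap_le]
    refine @measurable_pi_lambda _ _ _ (⨆ i ∈ S, MeasurableSpace.comap (Z i) inferInstance) _ _
      fun i => ?_
    by_cases hi : i ∈ S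
    · simp only [Set.indicator_of_mem hi]
      rw [measurable_iff_comap_le]
      exact le_iSup₂ (f := fun i (_ : i ∈ S) => MeasurableSpace.comap (Z i) inferInstance) i hi
    · simp only [Set.indicator_of_notMem hi]
      exact measurable_const
  rw [IndepFun_iff_Indep]
  exact indep_of_indep_of_le_left (indep_of_indep_of_le_right h (hle T)) (hle S)

/-- A conditional probability bound in integrated form: by independence the joint law is a product,
and Fubini integrates the bound on the sections. The set `D` keeps track of the probability that an
attempt takes place. -/
lemma measure_le_of_sections [IsProbabilityMeasure P] {S S' : Type*} [MeasurableSpace S]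
    [MeasurableSpace S'] {X : Ω → S} {Y : Ω → S'} (hX : Measurable X) (hY : Measurable Y)
    (hind : IndepFun X Y P) {E : Set (S × S')} (hE : MeasurableSet E) {D : Set S}
    (hD : MeasurableSet D) {q : ℝ≥0∞}
    (hsec : ∀ s, P.map Y {y | (s, y) ∈ E} ≤ D.indicator (fun _ => q) s) :
    P {ω | (X ω, Y ω) ∈ E} ≤ q * P {ω | X ω ∈ D} := by
  have h1 : P {ω | (X ω, Y ω) ∈ E} = P.map (fun ω => (X ω, Y ω)) E :=
    (Measure.map_apply (hX.prodMk hY) hE).symm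
  have : IsProbabilityMeasure (P.map Y) := Measure.isProbabilityMeasure_map hY.aemeasurable
  rw [h1, (indepFun_iff_map_prod_eq_prod_map_map hX.aemeasurable hY.aemeasurable).1 hind,
    Measure.prod_apply hE]
  calc _ ≤ ∫⁻ s, D.indicator (fun _ => q) s ∂(P.map X) := lintegral_mono hsec
    _ = q * P {ω | X ω ∈ D} := by
        rw [lintegral_indicator_const hD, Measure.map_apply hX hD]; rfl

end Independence

/-! ### Probability of one inaccurate estimate or one failed escape -/

section FailureProbability

variable {d : ℕ} {p : Params d} {f : Vec d → ℝ} {x₀ : Vec d}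
  {Ω : Type*} [MeasurableSpace Ω] {P : Measure Ω} [IsProbabilityMeasure P]
  {u : ℕ → ℕ → Ω → Vec d} {ξ : ℕ → Ω → Vec d}

/-- All random inputs of the algorithm as one family. -/
abbrev inputs (u : ℕ → ℕ → Ω → Vec d) (ξ : ℕ → Ω → Vec d) : (ℕ × ℕ) ⊕ ℕ → Ω → Vec d :=
  Sum.elim (fun q : ℕ × ℕ => u q.1 q.2) ξ

/-- Gaussian samples among a family of inputs. -/
abbrev samplesOf (z : (ℕ × ℕ) ⊕ ℕ → Vec d) : ℕ → ℕ → Vec d := fun t i => z (Sum.inl (t, i))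

/-- Perturbations among a family of inputs. -/
abbrev perturbationsOf (z : (ℕ × ℕ) ⊕ ℕ → Vec d) : ℕ → Vec d := fun t => z (Sum.inr t)

lemma measurable_inputs (hu : ∀ t i, Measurable (u t i)) (hξ : ∀ t, Measurable (ξ t)) (i) :
    Measurable (inputs u ξ i) := by
  rcases i with ⟨t, i⟩ | t
  · exact hu t i
  · exact hξ t

lemma measurable_indicator_inputs (hu : ∀ t i, Measurable (u t i)) (hξ : ∀ t, Measurable (ξ t))
    (S : Set ((ℕ × ℕ) ⊕ ℕ)) : Measurable fun ω => S.indicator fun i => inputs u ξ i ω := by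
  refine measurable_pi_lambda _ fun i => ?_
  by_cases hi : i ∈ S
  · simpa only [Set.indicator_of_mem hi] using measurable_inputs hu hξ i
  · simp only [Set.indicator_of_notMem hi]
    exact measurable_const

/-- Each gradient estimate along the run is accurate with high probability. -/
lemma measure_not_accurate_le (hu : ∀ t i, Measurable (u t i)) (hξ : ∀ t, Measurable (ξ t))
    (hR : IsRandomness p P u ξ)
    (hs : IsSmooth p.l f) (hgrad : ∀ x, ‖gradient f x‖ ≤ p.B) (hd : 1 ≤ d) (hl : 0 < p.l)
    (hB : 1 ≤ p.B) (hc' : 100 ≤ p.c') (hê0 : 0 < p.epsHat) (hê : p.epsHat ≤ 1 / 2) (t : ℕ) :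
    P {ω | ¬ Accurate p f x₀ (fun t i => u t i ω) (fun t => ξ t ω) t} ≤
      ENNReal.ofReal p.epsHat := by
  -- The inputs of the iterations before `t` determine the query point; those in `T` are the fresh
  -- samples of iteration `t`.
  set S : Set ((ℕ × ℕ) ⊕ ℕ) := {i | Sum.elim (fun q : ℕ × ℕ => q.1) id i < t} with hS
  set T : Set ((ℕ × ℕ) ⊕ ℕ) := Set.range fun i => Sum.inl (t, i) with hT
  have hST : Disjoint S T := by
    rw [Set.disjoint_left]
    rintro _ h ⟨i, rfl⟩
    exact lt_irrefl t h
  have hcont := hs.1.continuous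
  have hcont' := hs.continuous_gradient
  set E : Set (((ℕ × ℕ) ⊕ ℕ → Vec d) × ((ℕ × ℕ) ⊕ ℕ → Vec d)) :=
    {q | p.epsHat < ‖gradEst p f (fun i => q.2 (Sum.inl (t, i)))
        (run p f x₀ (samplesOf q.1) (perturbationsOf q.1) t).x -
      gradient f (run p f x₀ (samplesOf q.1) (perturbationsOf q.1) t).x‖} with hE
  have hEm : MeasurableSet E := by
    have hx := (measurable_run (p := p) (x₀ := x₀) hcont
      (U := fun q : ((ℕ × ℕ) ⊕ ℕ → Vec d) × ((ℕ × ℕ) ⊕ ℕ → Vec d) => samplesOf q.1)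
      (Ξ := fun q => perturbationsOf q.1)
      (fun j i => (measurable_pi_apply (Sum.inl (j, i))).comp measurable_fst)
      (fun j => (measurable_pi_apply (Sum.inr j)).comp measurable_fst) t).2.1
    have hg : Measurable fun q : ((ℕ × ℕ) ⊕ ℕ → Vec d) × ((ℕ × ℕ) ⊕ ℕ → Vec d) =>
        gradEst p f (fun i => q.2 (Sum.inl (t, i)))
          (run p f x₀ (samplesOf q.1) (perturbationsOf q.1) t).x :=
      measurable_gradEst hcont
        (fun i => (measurable_pi_apply (Sum.inl (t, i))).comp measurable_snd) hx
    exact measurableSet_lt measurable_const (hg.sub (hcont'.measurable.comp hx)).norm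
  have h := measure_le_of_sections (measurable_indicator_inputs hu hξ S)
    (measurable_indicator_inputs hu hξ T)
    (indepFun_indicator (measurable_inputs hu hξ) hR.indep hST) hEm MeasurableSet.univ
    (q := ENNReal.ofReal p.epsHat) (fun z => by
      rw [Set.indicator_univ]
      refine (Measure.map_apply (measurable_indicator_inputs hu hξ T)
        (measurable_prodMk_left hEm)).trans_le ?_
      refine le_trans (le_of_eq ?_) (measure_gradEst_error_le (u := u t) (fun i => hR.gaussian t i)
        (hR.indep.precomp (g := fun i : ℕ => Sum.inl (t, i))
          (fun i j hij => by simpa using hij)) hs hgrad hd hl hB hc' hê0 hê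
        (run p f x₀ (samplesOf z) (perturbationsOf z) t).x)
      congr 1
      ext ω
      have : ∀ i, T.indicator (fun i => inputs u ξ i ω) (Sum.inl (t, i)) = u t i ω := fun i =>
        Set.indicator_of_mem (Set.mem_range_self i) _
      simp only [hE, Set.mem_preimage, Set.mem_ofPred_eq, this])
  simp only [Set.mem_univ, Set.ofPred_true, measure_univ, mul_one] at h
  refine le_trans (le_of_eq ?_) h
  congr 1
  ext ω
  have h1 : ∀ i, T.indicator (fun i => inputs u ξ i ω) (Sum.inl (t, i)) = u t i ω := fun i =>
    Set.indicator_of_mem (Set.mem_range_self i) _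
  have h2 : run p f x₀ (samplesOf (S.indicator fun i => inputs u ξ i ω))
      (perturbationsOf (S.indicator fun i => inputs u ξ i ω)) t =
      run p f x₀ (fun t i => u t i ω) (fun t => ξ t ω) t :=
    run_congr (fun j hj i => Set.indicator_of_mem (by exact hj) _)
      (fun j hj => Set.indicator_of_mem (by exact hj) _)
  simp only [hE, Set.mem_ofPred_eq, h1, h2, Accurate, runGrad, not_le]

/-- Iteration `t` perturbs the iterate, and all gradient estimates so far are accurate. -/
def Attempt (p : Params d) (f : Vec d → ℝ) (x₀ : Vec d) (u : ℕ → ℕ → Vec d) (ξ : ℕ → Vec d)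
    (t : ℕ) : Prop :=
  Perturbs p f x₀ u ξ t ∧ ∀ j ≤ t, Accurate p f x₀ u ξ j

lemma attempt_congr {u u' : ℕ → ℕ → Vec d} {ξ ξ' : ℕ → Vec d} {t : ℕ} (hu : u = u')
    (hξ : ∀ j < t, ξ j = ξ' j) : Attempt p f x₀ u ξ t ↔ Attempt p f x₀ u' ξ' t := by
  subst hu
  have h : ∀ j ≤ t, run p f x₀ u ξ j = run p f x₀ u ξ' j := fun j hj =>
    run_congr (fun _ _ _ => rfl) fun i hi => hξ i (hi.trans_le hj)
  unfold Attempt Perturbs Accurate runGrad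
  rw [h t le_rfl]
  refine and_congr_right fun _ => forall₂_congr fun j hj => ?_
  rw [h j hj]

lemma measurableSet_attempt {α : Type*} [MeasurableSpace α] {U : α → ℕ → ℕ → Vec d}
    {Ξ : α → ℕ → Vec d} (hf : Continuous f) (hf' : Continuous (gradient f))
    (hU : ∀ j i, Measurable fun a => U a j i) (hΞ : ∀ j, Measurable fun a => Ξ a j) (n : ℕ) :
    MeasurableSet {a | Attempt p f x₀ (U a) (Ξ a) n} := by
  have : {a | Attempt p f x₀ (U a) (Ξ a) n} = {a | Perturbs p f x₀ (U a) (Ξ a) n} ∩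
      ⋂ j, ⋂ (_ : j ≤ n), {a | Accurate p f x₀ (U a) (Ξ a) j} := by
    ext a; simp [Attempt]
  rw [this]
  exact (measurableSet_perturbs hf hU hΞ n).inter (MeasurableSet.iInter fun j =>
    MeasurableSet.iInter fun _ => measurableSet_accurate hf hf' hU hΞ j)

/-- Bound for the probability that a perturbation fails to escape. -/
def Params.escapeFailure (p : Params d) : ℝ :=
  1 / 8 * d * (p.l / √(p.ρ * p.ε)) * Real.exp (-p.chi)

lemma volume_failsEscape_le (hp : p.InRegime) (hs : IsSmooth p.l f)
    (hf : IsHessianLipschitz p.ρ f) (u : ℕ → ℕ → Vec d) (k : ℕ) (x : Vec d) :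
    volume {w | FailsEscape p f u k x w} ≤
      ENNReal.ofReal p.escapeFailure * volume (Metric.closedBall (0 : Vec d) p.r) := by
  rcases Set.eq_empty_or_nonempty {w | FailsEscape p f u k x w} with he | ⟨w, hw⟩
  · rw [he, measure_empty]; exact zero_le
  have hm : MeasurableSet {w | FailsEscape p f u k x w} :=
    measurableSet_failsEscape hs.1.continuous hs.continuous_gradient hf.continuous_hessian
      (U := fun _ => u) (fun _ _ => measurable_const) measurable_const measurable_id k
  obtain ⟨e, he, hthin⟩ := Params.InRegime.exists_thin_direction hp hs hf hw
  have hr := Params.InRegime.r_pos hp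
  refine (volume_le_of_thin hm hr (fun w hw => by simpa using hw.norm_le) he
    (fun w₁ h₁ w₂ h₂ => hthin w₁ w₂ h₁ h₂)).trans (le_of_eq ?_)
  congr 2
  rw [Params.escapeFailure]
  have h1 : √(d : ℝ) * (1 / 8 * √(d : ℝ) * (p.l / √(p.ρ * p.ε)) * Real.exp (-p.chi) * p.r) / p.r =
      1 / 8 * (√(d : ℝ) * √(d : ℝ)) * (p.l / √(p.ρ * p.ε)) * Real.exp (-p.chi) := by
    field_simp
  rw [h1, Real.mul_self_sqrt (by positivity)]

/-- Each escape attempt fails with small conditional probability. -/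
lemma measure_attempt_fails_le (hp : p.InRegime) (hs : IsSmooth p.l f)
    (hf : IsHessianLipschitz p.ρ f) (hu : ∀ t i, Measurable (u t i)) (hξ : ∀ t, Measurable (ξ t))
    (hR : IsRandomness p P u ξ) (t : ℕ) :
    P {ω | Attempt p f x₀ (fun t i => u t i ω) (fun t => ξ t ω) t ∧
        FailsEscape p f (fun t i => u t i ω) t
          (run p f x₀ (fun t i => u t i ω) (fun t => ξ t ω) t).x (ξ t ω)} ≤
      ENNReal.ofReal p.escapeFailure *
        P {ω | Attempt p f x₀ (fun t i => u t i ω) (fun t => ξ t ω) t} := by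
  -- Conditioning is on everything except the current perturbation, including future inputs: the
  -- escape event depends on the samples of the following window, which are frozen in the coupling.
  set S : Set ((ℕ × ℕ) ⊕ ℕ) := {Sum.inr t}ᶜ with hS
  have hcont := hs.1.continuous
  have hcont' := hs.continuous_gradient
  have hcont'' := hf.continuous_hessian
  have hind : IndepFun (fun ω => S.indicator fun i => inputs u ξ i ω) (ξ t) P := by
    have h := indepFun_indicator (measurable_inputs hu hξ) hR.indep
      (S := S) (T := {Sum.inr t}) disjoint_compl_left
    have h2 := h.comp measurable_id (measurable_pi_apply (Sum.inr t))
    have e : ((fun z : (ℕ × ℕ) ⊕ ℕ → Vec d => z (Sum.inr t)) ∘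
        fun ω => ({Sum.inr t} : Set ((ℕ × ℕ) ⊕ ℕ)).indicator fun i => inputs u ξ i ω) = ξ t := by
      funext ω
      exact Set.indicator_of_mem (Set.mem_singleton (Sum.inr t)) (fun i => inputs u ξ i ω)
    rw [e] at h2
    exact h2
  set D : Set ((ℕ × ℕ) ⊕ ℕ → Vec d) :=
    {z | Attempt p f x₀ (samplesOf z) (perturbationsOf z) t} with hD
  set E : Set (((ℕ × ℕ) ⊕ ℕ → Vec d) × Vec d) :=
    {q | Attempt p f x₀ (samplesOf q.1) (perturbationsOf q.1) t ∧
      FailsEscape p f (samplesOf q.1) t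
        (run p f x₀ (samplesOf q.1) (perturbationsOf q.1) t).x q.2} with hE
  have hDm : MeasurableSet D := measurableSet_attempt hcont hcont'
    (fun j i => measurable_pi_apply (Sum.inl (j, i)))
    (fun j => measurable_pi_apply (Sum.inr j)) t
  have hEm : MeasurableSet E := by
    have h1 : ∀ j i, Measurable fun q : ((ℕ × ℕ) ⊕ ℕ → Vec d) × Vec d => samplesOf q.1 j i :=
      fun j i => (measurable_pi_apply (Sum.inl (j, i))).comp measurable_fst
    have h2 : ∀ j, Measurable fun q : ((ℕ × ℕ) ⊕ ℕ → Vec d) × Vec d => perturbationsOf q.1 j :=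
      fun j => (measurable_pi_apply (Sum.inr j)).comp measurable_fst
    exact (measurableSet_attempt hcont hcont' h1 h2 t).inter
      (measurableSet_failsEscape hcont hcont' hcont'' h1 (measurable_run hcont h1 h2 t).2.1
        measurable_snd t)
  have hr := Params.InRegime.r_pos hp
  have hv0 : volume (Metric.closedBall (0 : Vec d) p.r) ≠ 0 :=
    (Metric.measure_closedBall_pos _ _ hr).ne'
  have hvt : volume (Metric.closedBall (0 : Vec d) p.r) ≠ ⊤ := measure_closedBall_lt_top.ne
  have h := measure_le_of_sections (measurable_indicator_inputs hu hξ S) (hξ t) hind hEm hDm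
    (q := ENNReal.ofReal p.escapeFailure) (fun z => by
      by_cases hz : z ∈ D
      · rw [Set.indicator_of_mem hz, (hR.uniform t).map_eq,
          cond_apply measurableSet_closedBall, ENNReal.inv_mul_le_iff hv0 hvt, mul_comm]
        refine le_trans (measure_mono ?_) (volume_failsEscape_le hp hs hf (samplesOf z) t
          (run p f x₀ (samplesOf z) (perturbationsOf z) t).x)
        exact fun w hw => hw.2.2
      · have : {y | (z, y) ∈ E} = ∅ := Set.eq_empty_of_forall_notMem fun y hy => hz hy.1
        rw [this, measure_empty]
        exact zero_le)
  have hsam : ∀ ω, samplesOf (S.indicator fun i => inputs u ξ i ω) = fun t i => u t i ω :=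
    fun ω => by
      funext j i
      exact Set.indicator_of_mem (by simp [hS]) _
  have hper : ∀ ω, ∀ j < t, perturbationsOf (S.indicator fun i => inputs u ξ i ω) j = ξ j ω :=
    fun ω j hj => Set.indicator_of_mem (by simp [hS, hj.ne]) _
  have hatt : ∀ ω, Attempt p f x₀ (samplesOf (S.indicator fun i => inputs u ξ i ω))
      (perturbationsOf (S.indicator fun i => inputs u ξ i ω)) t ↔
      Attempt p f x₀ (fun t i => u t i ω) (fun t => ξ t ω) t := fun ω =>
    attempt_congr (hsam ω) (hper ω)
  have hrun : ∀ ω, run p f x₀ (samplesOf (S.indicator fun i => inputs u ξ i ω))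
      (perturbationsOf (S.indicator fun i => inputs u ξ i ω)) t =
      run p f x₀ (fun t i => u t i ω) (fun t => ξ t ω) t := fun ω =>
    run_congr (fun j _ i => congrFun (congrFun (hsam ω) j) i) (hper ω)
  have e1 : {ω | ((S.indicator fun i => inputs u ξ i ω), ξ t ω) ∈ E} =
      {ω | Attempt p f x₀ (fun t i => u t i ω) (fun t => ξ t ω) t ∧
        FailsEscape p f (fun t i => u t i ω) t
          (run p f x₀ (fun t i => u t i ω) (fun t => ξ t ω) t).x (ξ t ω)} := by
    ext ω
    exact and_congr (hatt ω) (by rw [hrun ω, hsam ω])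
  have e2 : {ω | (S.indicator fun i => inputs u ξ i ω) ∈ D} =
      {ω | Attempt p f x₀ (fun t i => u t i ω) (fun t => ξ t ω) t} := by
    ext ω
    exact hatt ω
  rwa [e1, e2] at h

open Classical in
/-- The number of escape attempts is bounded. -/
lemma card_attempts_le (hp : p.InRegime) (hs : IsSmooth p.l f) (hbdd : BddBelow (Set.range f))
    {u : ℕ → ℕ → Vec d} {ξ : ℕ → Vec d} (hξ : ∀ k, ‖ξ k‖ ≤ p.r) (N : ℕ) :
    (((Finset.range N).filter (Attempt p f x₀ u ξ)).card : ℝ) ≤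
      2 * (f x₀ - ⨅ x, f x) / p.fThres + 3 := by
  have hft := Params.InRegime.fThres_pos hp
  have hF : 0 ≤ f x₀ - ⨅ x, f x := sub_nonneg.2 (ciInf_le hbdd x₀)
  rcases Finset.eq_empty_or_nonempty ((Finset.range N).filter (Attempt p f x₀ u ξ)) with he | hne
  · rw [he]; simp; positivity
  -- Accuracy is known only up to the last attempt `k`, so perturbations are counted there: those
  -- before `k`, plus `k` itself.
  set k := ((Finset.range N).filter (Attempt p f x₀ u ξ)).max' hne with hk
  have hk' : Attempt p f x₀ u ξ k := (Finset.mem_filter.1 (Finset.max'_mem _ hne)).2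
  have hcount := perturbCount_le_of_running hp hs hbdd hξ hk'.1.1 (fun j hj => hk'.2 j hj.le)
  have hsub : (Finset.range N).filter (Attempt p f x₀ u ξ) ⊆
      (Finset.range (k + 1)).filter (Perturbs p f x₀ u ξ) := fun j hj => by
    have h1 := Finset.le_max' _ j hj
    have h2 := (Finset.mem_filter.1 hj).2.1
    exact Finset.mem_filter.2 ⟨Finset.mem_range.2 (Nat.lt_succ_of_le h1), h2⟩
  have h1 : (((Finset.range N).filter (Attempt p f x₀ u ξ)).card : ℝ) ≤
      perturbCount p f x₀ u ξ (k + 1) := by exact_mod_cast Finset.card_le_card hsub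
  rw [perturbCount_succ_of_perturbs hk'.1] at h1
  push_cast at h1
  have h2 : (perturbCount p f x₀ u ξ k : ℝ) ≤ 2 * (f x₀ - ⨅ x, f x) / p.fThres + 2 := by
    rw [← sub_le_iff_le_add, le_div_iff₀ hft]
    linarith
  linarith

end FailureProbability

/-! ### Probability that the whole run is good -/

section TotalFailure

variable {d : ℕ} {p : Params d} {f : Vec d → ℝ} {x₀ : Vec d}
  {Ω : Type*} [MeasurableSpace Ω] {P : Measure Ω}
  {u : ℕ → ℕ → Ω → Vec d} {ξ : ℕ → Ω → Vec d}

/-- The perturbations stay in their ball, and during the first `N` iterations all gradient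
estimates are accurate and all perturbations escape from points of negative curvature. -/
structure GoodRun (p : Params d) (f : Vec d → ℝ) (x₀ : Vec d) (u : ℕ → ℕ → Vec d)
    (ξ : ℕ → Vec d) (N : ℕ) : Prop where
  norm_le : ∀ k, ‖ξ k‖ ≤ p.r
  accurate : ∀ j < N, Accurate p f x₀ u ξ j
  escapes : ∀ k < N, Perturbs p f x₀ u ξ k → ¬ FailsEscape p f u k (run p f x₀ u ξ k).x (ξ k)

lemma ae_norm_le (hr : 0 < p.r) (hR : IsRandomness p P u ξ) : ∀ᵐ ω ∂P, ∀ k, ‖ξ k ω‖ ≤ p.r := by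
  rw [ae_all_iff]
  intro k
  have h1 : MeasurableSet {w : Vec d | ‖w‖ ≤ p.r} :=
    measurableSet_le measurable_norm measurable_const
  have hv0 : volume (Metric.closedBall (0 : Vec d) p.r) ≠ 0 :=
    (Metric.measure_closedBall_pos _ _ hr).ne'
  have h2 : ∀ᵐ w ∂(ProbabilityTheory.cond volume (Metric.closedBall (0 : Vec d) p.r)),
      ‖w‖ ≤ p.r := by
    filter_upwards [ae_cond_mem (μ := volume) (s := Metric.closedBall (0 : Vec d) p.r)
      measurableSet_closedBall] with w hw
    simpa using hw
  rw [← (hR.uniform k).map_eq, ae_map_iff (hR.uniform k).aemeasurable h1] at h2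
  exact h2

variable [IsProbabilityMeasure P]

/-- The expected number of escape attempts is bounded. -/
lemma sum_measure_attempt_le (hp : p.InRegime) (hs : IsSmooth p.l f)
    (hbdd : BddBelow (Set.range f)) (hu : ∀ t i, Measurable (u t i)) (hξ : ∀ t, Measurable (ξ t))
    (hR : IsRandomness p P u ξ) (N : ℕ) :
    ∑ t ∈ Finset.range N, P {ω | Attempt p f x₀ (fun t i => u t i ω) (fun t => ξ t ω) t} ≤
      ENNReal.ofReal (2 * (f x₀ - ⨅ x, f x) / p.fThres + 3) := by
  classical
  have hm : ∀ t, MeasurableSet {ω | Attempt p f x₀ (fun t i => u t i ω) (fun t => ξ t ω) t} :=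
    fun t => measurableSet_attempt hs.1.continuous hs.continuous_gradient hu hξ t
  calc ∑ t ∈ Finset.range N, P {ω | Attempt p f x₀ (fun t i => u t i ω) (fun t => ξ t ω) t}
      = ∫⁻ ω, ∑ t ∈ Finset.range N,
          {ω | Attempt p f x₀ (fun t i => u t i ω) (fun t => ξ t ω) t}.indicator 1 ω ∂P := by
        rw [lintegral_finsetSum _ fun t _ => measurable_one.indicator (hm t)]
        exact Finset.sum_congr rfl fun t _ => (lintegral_indicator_one (hm t)).symm
    _ ≤ ∫⁻ _, ENNReal.ofReal (2 * (f x₀ - ⨅ x, f x) / p.fThres + 3) ∂P := by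
        refine lintegral_mono_ae ?_
        filter_upwards [ae_norm_le (Params.InRegime.r_pos hp) hR] with ω hω
        have h := card_attempts_le (x₀ := x₀) hp hs hbdd (u := fun t i => u t i ω) hω N
        have e : ∑ t ∈ Finset.range N, {ω | Attempt p f x₀ (fun t i => u t i ω)
            (fun t => ξ t ω) t}.indicator (1 : Ω → ℝ≥0∞) ω =
            (((Finset.range N).filter
              (Attempt p f x₀ (fun t i => u t i ω) (fun t => ξ t ω))).card : ℝ≥0∞) := by
          rw [Finset.card_filter]
          push_cast
          refine Finset.sum_congr rfl fun t _ => ?_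
          simp only [Set.indicator_apply, Set.mem_ofPred_eq, Pi.one_apply]
        rw [e, ← ENNReal.ofReal_natCast]
        exact ENNReal.ofReal_le_ofReal h
    _ = _ := by simp

/-- A union bound over all `N` iterations would be too costly for the escapes. Summing conditional
failure probability times probability of an attempt instead gives the failure probability times the
expected number of attempts, which does not grow with `N`. -/
lemma measure_not_goodRun_le_of_measurable (hp : p.InRegime) (hs : IsSmooth p.l f)
    (hf : IsHessianLipschitz p.ρ f) (hgrad : ∀ x, ‖gradient f x‖ ≤ p.B)
    (hbdd : BddBelow (Set.range f)) (hB : 1 ≤ p.B) (hc' : 100 ≤ p.c') (hê0 : 0 < p.epsHat)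
    (hê : p.epsHat ≤ 1 / 2) (hu : ∀ t i, Measurable (u t i)) (hξ : ∀ t, Measurable (ξ t))
    (hR : IsRandomness p P u ξ) (N : ℕ) {q : ℝ}
    (hq : √(p.ε ^ 3 / p.ρ) / 16 ≤ f x₀ - (⨅ x, f x) + 2 / 5 * p.fThres →
      p.escapeFailure * (2 * (f x₀ - ⨅ x, f x) / p.fThres + 3) ≤ q) :
    P {ω | ¬ GoodRun p f x₀ (fun t i => u t i ω) (fun t => ξ t ω) N} ≤
      N * ENNReal.ofReal p.epsHat + ENNReal.ofReal q := by
  set A : ℕ → Set Ω := fun t => {ω | ¬ Accurate p f x₀ (fun t i => u t i ω) (fun t => ξ t ω) t}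
  set D : ℕ → Set Ω := fun t => {ω | Attempt p f x₀ (fun t i => u t i ω) (fun t => ξ t ω) t ∧
    FailsEscape p f (fun t i => u t i ω) t
      (run p f x₀ (fun t i => u t i ω) (fun t => ξ t ω) t).x (ξ t ω)} with hD
  set Z : Set Ω := {ω | ¬ ∀ k, ‖ξ k ω‖ ≤ p.r}
  have hZ : P Z = 0 := ae_norm_le (Params.InRegime.r_pos hp) hR
  have hA : P (⋃ t ∈ Finset.range N, A t) ≤ N * ENNReal.ofReal p.epsHat := by
    refine (measure_biUnion_finset_le _ _).trans ((Finset.sum_le_card_nsmul _ _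
      (ENNReal.ofReal p.epsHat) fun t _ =>
      measure_not_accurate_le hu hξ hR hs hgrad hp.d_pos hp.l_pos hB hc' hê0 hê t).trans ?_)
    simp
  have hDle : P ((⋃ t ∈ Finset.range N, D t) \ Z) ≤ ENNReal.ofReal q := by
    by_cases hcase : √(p.ε ^ 3 / p.ρ) / 16 ≤ f x₀ - (⨅ x, f x) + 2 / 5 * p.fThres
    · have hesc : 0 ≤ p.escapeFailure := by
        have := hp.l_pos
        unfold Params.escapeFailure
        positivity
      calc P ((⋃ t ∈ Finset.range N, D t) \ Z) ≤ P (⋃ t ∈ Finset.range N, D t) :=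
            measure_mono Set.sdiff_subset
        _ ≤ ∑ t ∈ Finset.range N, P (D t) := measure_biUnion_finset_le _ _
        _ ≤ ∑ t ∈ Finset.range N, ENNReal.ofReal p.escapeFailure *
              P {ω | Attempt p f x₀ (fun t i => u t i ω) (fun t => ξ t ω) t} :=
            Finset.sum_le_sum fun t _ => measure_attempt_fails_le hp hs hf hu hξ hR t
        _ ≤ ENNReal.ofReal p.escapeFailure *
              ENNReal.ofReal (2 * (f x₀ - ⨅ x, f x) / p.fThres + 3) := by
            rw [← Finset.mul_sum]
            exact mul_le_mul_right (sum_measure_attempt_le hp hs hbdd hu hξ hR N) _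
        _ ≤ ENNReal.ofReal q := by
            rw [← ENNReal.ofReal_mul hesc]
            exact ENNReal.ofReal_le_ofReal (hq hcase)
    -- When the initial gap is too small, a failing attempt is impossible: the value at a perturbed
    -- point exceeds `f x₀` by at most `2/5 * fThres`, whereas negative curvature puts it at least
    -- `√(ε³/ρ)/16` above the infimum.
    · have : (⋃ t ∈ Finset.range N, D t) \ Z = ∅ := by
        refine Set.eq_empty_of_forall_notMem ?_
        rintro ω ⟨h1, h2⟩
        obtain ⟨t, -, hatt, hfail⟩ := Set.mem_iUnion₂.1 h1
        have hω : ∀ k, ‖ξ k ω‖ ≤ p.r := not_not.1 h2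
        have h3 := value_perturbed_le hp hs hω hatt.1 hatt.2
        have h4 := iInf_add_le_of_negative_curvature hp hf hbdd hfail.curvature
        exact hcase (by linarith)
      rw [this, measure_empty]
      exact zero_le
  have hsub : {ω | ¬ GoodRun p f x₀ (fun t i => u t i ω) (fun t => ξ t ω) N} ⊆
      Z ∪ ((⋃ t ∈ Finset.range N, A t) ∪ ((⋃ t ∈ Finset.range N, D t) \ Z)) := by
    intro ω hω
    by_contra hcon
    simp only [Set.mem_union, not_or, Set.mem_sdiff, Set.mem_iUnion, Finset.mem_range,
      exists_prop, not_exists, not_and] at hcon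
    obtain ⟨h1, h2, h3⟩ := hcon
    have hω1 : ∀ k, ‖ξ k ω‖ ≤ p.r := not_not.1 h1
    have hω2 : ∀ j < N, Accurate p f x₀ (fun t i => u t i ω) (fun t => ξ t ω) j :=
      fun j hj => not_not.1 (h2 j hj)
    refine hω ⟨hω1, hω2, fun k hk hper hfail => h3 ?_ h1⟩
    exact ⟨k, hk, ⟨hper, fun j hj => hω2 j (hj.trans_lt hk)⟩, hfail⟩
  calc _ ≤ P Z + (P (⋃ t ∈ Finset.range N, A t) + P ((⋃ t ∈ Finset.range N, D t) \ Z)) :=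
        (measure_mono hsub).trans ((measure_union_le _ _).trans
          (add_le_add le_rfl (measure_union_le _ _)))
    _ ≤ 0 + (N * ENNReal.ofReal p.epsHat + ENNReal.ofReal q) :=
        add_le_add hZ.le (add_le_add hA hDle)
    _ = _ := zero_add _

/-- With high probability the first `N` iterations are good. -/
lemma le_measureReal_goodRun (hp : p.InRegime) (hs : IsSmooth p.l f)
    (hf : IsHessianLipschitz p.ρ f) (hgrad : ∀ x, ‖gradient f x‖ ≤ p.B)
    (hbdd : BddBelow (Set.range f)) (hB : 1 ≤ p.B) (hc' : 100 ≤ p.c') (hê0 : 0 < p.epsHat)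
    (hê : p.epsHat ≤ 1 / 2) (hR : IsRandomness p P u ξ) (N : ℕ) {q : ℝ} (hq0 : 0 ≤ q)
    (hq : √(p.ε ^ 3 / p.ρ) / 16 ≤ f x₀ - (⨅ x, f x) + 2 / 5 * p.fThres →
      p.escapeFailure * (2 * (f x₀ - ⨅ x, f x) / p.fThres + 3) ≤ q) :
    1 - (N * p.epsHat + q) ≤
      P.real {ω | GoodRun p f x₀ (fun t i => u t i ω) (fun t => ξ t ω) N} := by
  have hu := fun t i => (hR.gaussian t i).aemeasurable
  have hξ := fun t => (hR.uniform t).aemeasurable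
  set u' : ℕ → ℕ → Ω → Vec d := fun t i => (hu t i).mk (u t i)
  set ξ' : ℕ → Ω → Vec d := fun t => (hξ t).mk (ξ t)
  have hR' : IsRandomness p P u' ξ' :=
    ⟨fun t i => (hR.gaussian t i).congr (hu t i).ae_eq_mk.symm,
      fun t => (hR.uniform t).congr (hξ t).ae_eq_mk.symm,
      hR.indep.congr fun i => by
        rcases i with ⟨t, i⟩ | t
        · exact (hu t i).ae_eq_mk
        · exact (hξ t).ae_eq_mk⟩
  have h := measure_not_goodRun_le_of_measurable hp hs hf hgrad hbdd hB hc' hê0 hê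
    (fun t i => (hu t i).measurable_mk) (fun t => (hξ t).measurable_mk) hR' N hq
  have hae : ∀ᵐ ω ∂P, (∀ t i, u t i ω = u' t i ω) ∧ ∀ t, ξ t ω = ξ' t ω :=
    (ae_all_iff.2 fun t => ae_all_iff.2 fun i => (hu t i).ae_eq_mk).and
      (ae_all_iff.2 fun t => (hξ t).ae_eq_mk)
  have heq : P {ω | ¬ GoodRun p f x₀ (fun t i => u t i ω) (fun t => ξ t ω) N} =
      P {ω | ¬ GoodRun p f x₀ (fun t i => u' t i ω) (fun t => ξ' t ω) N} := by
    refine measure_congr ?_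
    filter_upwards [hae] with ω hω
    have h1 : (fun t i => u t i ω) = fun t i => u' t i ω := by funext t i; exact hω.1 t i
    have h2 : (fun t => ξ t ω) = fun t => ξ' t ω := by funext t; exact hω.2 t
    show (¬ GoodRun p f x₀ (fun t i => u t i ω) (fun t => ξ t ω) N) =
      ¬ GoodRun p f x₀ (fun t i => u' t i ω) (fun t => ξ' t ω) N
    rw [h1, h2]
  rw [← heq] at h
  have h3 : P.real {ω | ¬ GoodRun p f x₀ (fun t i => u t i ω) (fun t => ξ t ω) N} ≤
      N * p.epsHat + q := by
    refine ENNReal.toReal_le_of_le_ofReal (by positivity) (h.trans (le_of_eq ?_))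
    rw [ENNReal.ofReal_add (by positivity) hq0, ENNReal.ofReal_mul (by positivity),
      ENNReal.ofReal_natCast]
  -- Subadditivity suffices, so measurability of the good event is not required.
  have h4 : (1 : ℝ) ≤ P.real {ω | GoodRun p f x₀ (fun t i => u t i ω) (fun t => ξ t ω) N} +
      P.real {ω | ¬ GoodRun p f x₀ (fun t i => u t i ω) (fun t => ξ t ω) N} := by
    refine le_trans (le_of_eq ?_) (measureReal_union_le _ _)
    have : {ω | GoodRun p f x₀ (fun t i => u t i ω) (fun t => ξ t ω) N} ∪
      {ω | ¬ GoodRun p f x₀ (fun t i => u t i ω) (fun t => ξ t ω) N} = Set.univ := by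
      ext ω; simp [em]
    rw [this]
    exact probReal_univ.symm
  linarith

end TotalFailure

/-! ### Estimates for `χ`, the accuracy and the query rate -/

section Scalars

variable {d : ℕ} {a l ρ c θ χ₁ δ Δf ε : ℝ}

/-- Otherwise the hypothesis applies at `χ = 4` and gives `64 exp (-4) ≤ 1`, while `exp 4 < 64`. -/
lemma four_le_of_exp_bound (hθ : 0 < θ)
    (h : ∀ χ : ℝ, χ₁ ≤ χ → χ ^ 3 * Real.exp (-χ) ≤ Real.exp (-χ / (1 + θ / 4))) : 4 ≤ χ₁ := by
  by_contra! hlt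
  have h1 := h 4 hlt.le
  have h2 : Real.exp (-4 / (1 + θ / 4)) ≤ 1 :=
    Real.exp_le_one_iff.2 (div_nonpos_of_nonpos_of_nonneg (by norm_num) (by positivity))
  have h3 : Real.exp (-4) * Real.exp 4 = 1 := by rw [← Real.exp_add]; norm_num
  have h4 : Real.exp 4 < 64 := by
    have : Real.exp 4 = Real.exp 1 ^ 4 := by rw [← Real.exp_nat_mul]; norm_num
    rw [this]
    have h5 : Real.exp 1 < 2.8 := Real.exp_one_lt_d9.trans (by norm_num)
    calc Real.exp 1 ^ 4 < 2.8 ^ 4 := by gcongr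
      _ < 64 := by norm_num
  nlinarith [Real.exp_pos (-4)]

lemma chi_le (hc : 0 < c) (hc1 : c ≤ 1) (hθ : 0 < θ) (hχ₁ : 0 ≤ χ₁)
    (hX : 0 < d * l * Δf / (ε ^ 2 * δ)) :
    chi d l c θ χ₁ δ Δf ε ≤ ((1 + θ / 4) * (Real.log (2 / c) + 1) + χ₁) *
      max 1 (Real.log (d * l * Δf / (ε ^ 2 * δ))) := by
  have hlog : 0 ≤ Real.log (2 / c) := Real.log_nonneg ((one_le_div hc).2 (by linarith))
  have e : 2 * d * l * Δf / (c * ε ^ 2 * δ) = 2 / c * (d * l * Δf / (ε ^ 2 * δ)) := by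
    rw [div_mul_div_comm]; ring_nf
  unfold chi
  rw [e, Real.log_mul (by positivity) hX.ne']
  set L := Real.log (d * l * Δf / (ε ^ 2 * δ))
  have h1 : 1 ≤ max 1 L := le_max_left _ _
  have h2 : L ≤ max 1 L := le_max_right _ _
  refine max_le ?_ ?_
  · calc (1 + θ / 4) * (Real.log (2 / c) + L)
        ≤ (1 + θ / 4) * (Real.log (2 / c) * max 1 L + max 1 L) := by
          gcongr
          exact le_mul_of_one_le_right hlog h1
      _ ≤ _ := by nlinarith
  · have : 0 ≤ (1 + θ / 4) * (Real.log (2 / c) + 1) := by positivity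
    nlinarith

/-- The hypothesis on `χ₁` trades the factor `χ³`, which comes from `1 / fThres`, for the exponent
`1 / (1 + θ/4)`; the factor `1 + θ/4` in `χ` compensates for it exactly. -/
lemma chi_cube_mul_exp_le (hd : 1 ≤ d) (hl : 0 < l) (hc : 0 < c) (hθ : 0 < θ) (hδ : 0 < δ)
    (hΔf : 0 < Δf) (hε : 0 < ε)
    (h : ∀ χ : ℝ, χ₁ ≤ χ → χ ^ 3 * Real.exp (-χ) ≤ Real.exp (-χ / (1 + θ / 4))) :
    chi d l c θ χ₁ δ Δf ε ^ 3 * Real.exp (-chi d l c θ χ₁ δ Δf ε) ≤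
      c * ε ^ 2 * δ / (2 * d * l * Δf) := by
  have hd' : (0 : ℝ) < d := by exact_mod_cast hd
  refine (h _ (le_max_right _ _)).trans ?_
  have h1 : Real.log (2 * d * l * Δf / (c * ε ^ 2 * δ)) ≤
      chi d l c θ χ₁ δ Δf ε / (1 + θ / 4) := by
    rw [le_div_iff₀ (by positivity), mul_comm]
    exact le_max_left _ _
  rw [neg_div]
  calc Real.exp (-(chi d l c θ χ₁ δ Δf ε / (1 + θ / 4)))
      ≤ Real.exp (-Real.log (2 * d * l * Δf / (c * ε ^ 2 * δ))) := by gcongr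
    _ = _ := by rw [Real.exp_neg, Real.exp_log (by positivity), inv_div]

lemma epsHatBound_le (ha : 0 ≤ a) {χ : ℝ} (hχ : chi d l c θ χ₁ δ Δf ε = χ) :
    epsHatBound a d l ρ c θ χ₁ δ Δf ε ≤ a ∧
    epsHatBound a d l ρ c θ χ₁ δ Δf ε ≤ a * (ε / χ ^ 2) ∧
    epsHatBound a d l ρ c θ χ₁ δ Δf ε ≤ a * (√(d : ℝ) * ε / χ ^ 3 * Real.exp (-χ)) ∧
    epsHatBound a d l ρ c θ χ₁ δ Δf ε ≤ a * (ε ^ 2 * δ / (χ ^ 4 * l * Δf)) ∧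
    epsHatBound a d l ρ c θ χ₁ δ Δf ε ≤ a * (δ * √(ρ * ε) / (χ * l)) := by
  subst hχ
  unfold epsHatBound
  refine ⟨(mul_le_mul_of_nonneg_left (min_le_left _ _) ha).trans_eq (mul_one a),
    mul_le_mul_of_nonneg_left ?_ ha, mul_le_mul_of_nonneg_left ?_ ha,
    mul_le_mul_of_nonneg_left ?_ ha, mul_le_mul_of_nonneg_left ?_ ha⟩
  · exact (min_le_right _ _).trans (min_le_left _ _)
  · exact (min_le_right _ _).trans ((min_le_right _ _).trans (min_le_left _ _))
  · exact (min_le_right _ _).trans ((min_le_right _ _).trans ((min_le_right _ _).trans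
      (min_le_left _ _)))
  · exact (min_le_right _ _).trans ((min_le_right _ _).trans ((min_le_right _ _).trans
      (min_le_right _ _)))

/-- The order of the accuracy of the gradient estimates, `ε ^ (3 + θ/2) / d ^ ((1 + θ/2) / 2)`. -/
def accuracyOrder (d : ℕ) (θ ε : ℝ) : ℝ := ε ^ (3 + θ / 2) / (d : ℝ) ^ (1 / 2 * (1 + θ / 2))

lemma accuracyOrder_pos (hd : 1 ≤ d) (hε : 0 < ε) : 0 < accuracyOrder d θ ε := by
  have hd' : (0 : ℝ) < d := by exact_mod_cast hd
  unfold accuracyOrder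
  positivity

lemma accuracyOrder_le (hd : 1 ≤ d) (hθ : 0 < θ) (hε : 0 < ε) (hε1 : ε ≤ 1) :
    accuracyOrder d θ ε ≤ ε ^ 2 := by
  have hd' : (1 : ℝ) ≤ d := by exact_mod_cast hd
  unfold accuracyOrder
  have h1 : ε ^ (3 + θ / 2) ≤ ε ^ 2 := by
    rw [← Real.rpow_natCast]
    exact Real.rpow_le_rpow_of_exponent_ge hε hε1 (by push_cast; linarith)
  have h2 : 1 ≤ (d : ℝ) ^ (1 / 2 * (1 + θ / 2)) := Real.one_le_rpow hd' (by positivity)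
  exact (div_le_self (by positivity) h2).trans h1

/-- The form in which the rate arises: `d / Y²` samples per estimate, with `Y` the accuracy, times
`1 / ε²` iterations. -/
lemma queryRate_eq (hd : 1 ≤ d) (hε : 0 < ε) :
    queryRate d θ ε = d / (accuracyOrder d θ ε ^ 2 * ε ^ 2) := by
  have hd' : (0 : ℝ) < d := by exact_mod_cast hd
  unfold queryRate accuracyOrder
  have h1 : ε ^ (8 + θ) = (ε ^ (3 + θ / 2)) ^ 2 * ε ^ 2 := by
    rw [← Real.rpow_natCast, ← Real.rpow_natCast, ← Real.rpow_mul hε.le, ← Real.rpow_add hε]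
    congr 1; push_cast; ring
  have h2 : (d : ℝ) ^ (2 + θ / 2) = d * ((d : ℝ) ^ (1 / 2 * (1 + θ / 2))) ^ 2 := by
    conv_rhs => rw [← Real.rpow_natCast, ← Real.rpow_mul hd'.le]
    conv_rhs => lhs; rw [← Real.rpow_one (d : ℝ)]
    rw [← Real.rpow_add hd']
    congr 1; push_cast; ring
  rw [h1, h2]
  field_simp

lemma log_queryRate (hd : 1 ≤ d) (hε : 0 < ε) :
    Real.log (queryRate d θ ε) = (2 + θ / 2) * Real.log d + (8 + θ) * (-Real.log ε) := by
  have hd' : (0 : ℝ) < d := by exact_mod_cast hd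
  unfold queryRate
  rw [Real.log_div (by positivity) (by positivity), Real.log_rpow hd', Real.log_rpow hε]
  ring

lemma one_le_neg_log (hε : 0 < ε) (hε1 : ε ≤ Real.exp (-1)) : 1 ≤ -Real.log ε := by
  have := Real.log_le_log hε hε1
  rw [Real.log_exp] at this
  linarith

lemma one_le_log_queryRate (hd : 1 ≤ d) (hθ : 0 < θ) (hε : 0 < ε) (hε1 : ε ≤ Real.exp (-1)) :
    1 ≤ Real.log (queryRate d θ ε) := by
  have h1 := one_le_neg_log hε hε1
  have h2 : 0 ≤ Real.log d := Real.log_natCast_nonneg d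
  rw [log_queryRate hd hε]
  nlinarith [mul_nonneg hθ.le h2, mul_nonneg hθ.le (by linarith : 0 ≤ -Real.log ε)]

lemma neg_log_accuracyOrder_le (hd : 1 ≤ d) (hθ : 0 < θ) (hε : 0 < ε) (hε1 : ε ≤ Real.exp (-1)) :
    -Real.log (accuracyOrder d θ ε) ≤ Real.log (queryRate d θ ε) := by
  have hd' : (0 : ℝ) < d := by exact_mod_cast hd
  have h1 := one_le_neg_log hε hε1
  have h2 : 0 ≤ Real.log d := Real.log_natCast_nonneg d
  rw [log_queryRate hd hε, accuracyOrder, Real.log_div (by positivity) (by positivity),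
    Real.log_rpow hd', Real.log_rpow hε]
  nlinarith [mul_nonneg hθ.le h2, mul_nonneg hθ.le (by linarith : 0 ≤ -Real.log ε)]

/-- The logarithm entering `χ` is at most of the order of the logarithm of the query rate. -/
lemma max_one_log_le (hd : 1 ≤ d) (hθ : 0 < θ) (hl : 0 < l) (hδ : 0 < δ) (hΔf : 0 < Δf)
    (hε : 0 < ε) (hε1 : ε ≤ Real.exp (-1)) :
    max 1 (Real.log (d * l * Δf / (ε ^ 2 * δ))) ≤
      (1 + |Real.log (l * Δf / δ)|) * Real.log (queryRate d θ ε) := by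
  have hd' : (0 : ℝ) < d := by exact_mod_cast hd
  have h0 := one_le_log_queryRate hd hθ hε hε1
  have h1 := one_le_neg_log hε hε1
  have h2 : 0 ≤ Real.log d := Real.log_natCast_nonneg d
  have h3 := abs_nonneg (Real.log (l * Δf / δ))
  have h4 := le_abs_self (Real.log (l * Δf / δ))
  refine max_le (by nlinarith) ?_
  have e : d * l * Δf / (ε ^ 2 * δ) = d / ε ^ 2 * (l * Δf / δ) := by
    rw [div_mul_div_comm]; ring_nf
  rw [e, Real.log_mul (by positivity) (by positivity), Real.log_div (by positivity)
    (by positivity), Real.log_pow]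
  have h5 : Real.log d + 2 * (-Real.log ε) ≤ Real.log (queryRate d θ ε) := by
    rw [log_queryRate hd hε]
    nlinarith [mul_nonneg hθ.le h2, mul_nonneg hθ.le (by linarith : 0 ≤ -Real.log ε)]
  push_cast
  nlinarith

/-- The upper bound for the accuracy is of order `accuracyOrder` up to powers of `χ`. -/
lemma exists_accuracyOrder_le (ha : 0 < a) (hl : 0 < l) (hρ : 0 < ρ) (hc : 0 < c) (hθ : 0 < θ)
    (hδ : 0 < δ) (hΔf : 0 < Δf) (hχ₁ : 1 ≤ χ₁) :
    ∃ C : ℝ, 0 < C ∧ ∀ (d : ℕ) (ε : ℝ), 1 ≤ d → 0 < ε → ε ≤ 1 →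
      accuracyOrder d θ ε ≤
        C * chi d l c θ χ₁ δ Δf ε ^ 4 * epsHatBound a d l ρ c θ χ₁ δ Δf ε := by
  set A : ℝ := (c * δ / (2 * l * Δf)) ^ (1 + θ / 4) with hA
  have hA0 : 0 < A := by positivity
  -- One summand per entry of the minimum; the summand `1` serves the first two.
  set C₀ : ℝ := 1 + (Real.exp χ₁ + 1 / A) + l * Δf / δ + l / (δ * √ρ) with hC₀
  have hρ' := Real.sqrt_pos.2 hρ
  have e1 : 0 < Real.exp χ₁ + 1 / A := by positivity
  have e2 : 0 < l * Δf / δ := by positivity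
  have e3 : 0 < l / (δ * √ρ) := by positivity
  refine ⟨C₀ / a, by positivity, fun d ε hd hε hε1 => ?_⟩
  have hd' : (1 : ℝ) ≤ d := by exact_mod_cast hd
  set χ := chi d l c θ χ₁ δ Δf ε with hχ
  have hχ1 : 1 ≤ χ := hχ₁.trans (le_max_right _ _)
  have hY0 := accuracyOrder_pos (θ := θ) hd hε
  have hY := accuracyOrder_le hd hθ hε hε1
  set Y := accuracyOrder d θ ε with hYdef
  have hexp : Y ≤ (Real.exp χ₁ + 1 / A) * (√(d : ℝ) * ε * Real.exp (-χ)) := by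
    have hsq : 1 ≤ √(d : ℝ) := Real.one_le_sqrt.2 hd'
    -- If the logarithm attains the maximum, `√d ε exp (-χ)` equals `A * Y` exactly; if `χ₁` does,
    -- `exp (-χ)` is a constant and `Y ≤ √d ε` suffices.
    rcases max_choice ((1 + θ / 4) * Real.log (2 * d * l * Δf / (c * ε ^ 2 * δ))) χ₁ with h | h
    · have h1 : Real.exp (-χ) = (c * ε ^ 2 * δ / (2 * d * l * Δf)) ^ (1 + θ / 4) := by
        rw [hχ, chi, h, Real.rpow_def_of_pos (by positivity), ← inv_div (2 * d * l * Δf),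
          Real.log_inv]
        congr 1; ring
      have h2 : √(d : ℝ) * ε * Real.exp (-χ) = A * Y := by
        have h3 : c * ε ^ 2 * δ / (2 * d * l * Δf) = c * δ / (2 * l * Δf) * (ε ^ 2 / d) := by
          rw [div_mul_div_comm]; ring_nf
        rw [h1, h3, Real.mul_rpow (by positivity) (by positivity), ← hA,
          Real.div_rpow (by positivity) (by positivity), hYdef, accuracyOrder]
        have h4 : ε ^ (3 + θ / 2) = ε * (ε ^ 2) ^ (1 + θ / 4) := by
          conv_rhs => rw [← Real.rpow_natCast, ← Real.rpow_mul hε.le]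
          conv_rhs => lhs; rw [← Real.rpow_one ε]
          rw [← Real.rpow_add hε]
          congr 1; push_cast; ring
        have h5 : (d : ℝ) ^ (1 + θ / 4) = √(d : ℝ) * (d : ℝ) ^ (1 / 2 * (1 + θ / 2)) := by
          rw [Real.sqrt_eq_rpow, ← Real.rpow_add (by positivity)]
          congr 1; ring
        rw [h4, h5]
        field_simp
      rw [h2]
      have h6 : 0 < Real.exp χ₁ * (A * Y) := by positivity
      calc Y = 1 / A * (A * Y) := by field_simp
        _ ≤ _ := by rw [add_mul]; linarith
    · have h1 : χ = χ₁ := h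
      rw [h1]
      have h2 : Y ≤ √(d : ℝ) * ε := by nlinarith
      have h3 : 0 ≤ 1 / A * (√(d : ℝ) * ε * Real.exp (-χ₁)) := by positivity
      have h4 : Real.exp χ₁ * (√(d : ℝ) * ε * Real.exp (-χ₁)) = √(d : ℝ) * ε := by
        rw [mul_comm, mul_assoc, ← Real.exp_add]; simp
      rw [add_mul, h4]
      linarith
  have hC0 : 0 < C₀ := by positivity
  have hχp : ∀ j ≤ 4, χ ^ j ≤ χ ^ 4 := fun j hj => pow_le_pow_right₀ hχ1 hj
  have hsq2 : ε ^ 2 ≤ √ε := by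
    have : ε ≤ √ε := Real.le_sqrt_of_sq_le (by nlinarith)
    nlinarith
  have key : Y / (C₀ * χ ^ 4) ≤ min 1 (min (ε / χ ^ 2) (min (√(d : ℝ) * ε / χ ^ 3 * Real.exp (-χ))
      (min (ε ^ 2 * δ / (χ ^ 4 * l * Δf)) (δ * √(ρ * ε) / (χ * l))))) := by
    have hχ0 : 0 < χ := by linarith
    refine le_min ?_ (le_min ?_ (le_min ?_ (le_min ?_ ?_))) <;> rw [div_le_iff₀ (by positivity)]
    · have := hχp 0 (by norm_num)
      nlinarith
    · calc Y ≤ ε := by nlinarith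
        _ = ε / χ ^ 2 * (1 * χ ^ 2) := by field_simp
        _ ≤ _ := by
          gcongr
          · linarith
          · norm_num
    · calc Y ≤ (Real.exp χ₁ + 1 / A) * (√(d : ℝ) * ε * Real.exp (-χ)) := hexp
        _ = √(d : ℝ) * ε / χ ^ 3 * Real.exp (-χ) * ((Real.exp χ₁ + 1 / A) * χ ^ 3) := by
          field_simp
        _ ≤ _ := by
          gcongr
          · linarith
          · norm_num
    · calc Y ≤ ε ^ 2 := hY
        _ = ε ^ 2 * δ / (χ ^ 4 * l * Δf) * (l * Δf / δ * χ ^ 4) := by field_simp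
        _ ≤ _ := by
          gcongr
          linarith
    · calc Y ≤ √ε := hY.trans hsq2
        _ = δ * √(ρ * ε) / (χ * l) * (l / (δ * √ρ) * χ ^ 1) := by
          rw [Real.sqrt_mul hρ.le]; field_simp
        _ ≤ _ := by
          gcongr
          · linarith
          · norm_num
  have h := mul_le_mul_of_nonneg_left key ha.le
  have h2 : a * (Y / (C₀ * χ ^ 4)) * (C₀ / a * χ ^ 4) = Y := by
    field_simp
  calc Y = a * (Y / (C₀ * χ ^ 4)) * (C₀ / a * χ ^ 4) := h2.symm
    _ ≤ epsHatBound a d l ρ c θ χ₁ δ Δf ε * (C₀ / a * χ ^ 4) := by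
        refine mul_le_mul_of_nonneg_right ?_ (by positivity)
        exact h
    _ = _ := mul_comm _ _

end Scalars

/-! ### Iteration count and total failure probability -/

section Complexity

variable {d : ℕ} {p : Params d} {f : Vec d → ℝ} {x₀ : Vec d}

lemma inRegime_of_le_epsHatBound (hd : 1 ≤ d) (hl : 0 < p.l) (hρ : 0 < p.ρ) (hε : 0 < p.ε)
    (hc : 0 < p.c) (hc7 : p.c ≤ 1 / 10 ^ 7) (hχ₁ : 4 ≤ p.χ₁) (hγ : √(p.ρ * p.ε) ≤ p.l)
    (hê0 : 0 < p.epsHat)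
    (hê : p.epsHat ≤ epsHatBound (p.c ^ 3 / 1000) d p.l p.ρ p.c p.θ p.χ₁ p.δ p.Δf p.ε) :
    p.InRegime := by
  have hχ : 4 ≤ p.chi := hχ₁.trans (le_max_right _ _)
  obtain ⟨-, h2, h3, -, -⟩ := epsHatBound_le (d := d) (a := p.c ^ 3 / 1000) (l := p.l) (ρ := p.ρ)
    (c := p.c) (θ := p.θ) (χ₁ := p.χ₁) (δ := p.δ) (Δf := p.Δf) (ε := p.ε) (χ := p.chi)
    (by positivity) rfl
  have ha : p.c ^ 3 / 1000 ≤ p.c / 1000 := by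
    have : p.c ^ 3 ≤ p.c ^ 1 := pow_le_pow_of_le_one hc.le (by linarith) (by norm_num)
    linarith
  exact ⟨hl, hρ, hε, hc, hc7, hχ, Real.sqrt_pos.2 (by positivity), hγ, Real.sq_sqrt (by positivity),
    hê0.le, (hê.trans h2).trans (mul_le_mul_of_nonneg_right ha (by positivity)),
    (hê.trans h3).trans (mul_le_mul_of_nonneg_right ha (by positivity)), hd⟩

/-- Number of iterations within which the algorithm stops in the absence of failures. -/
def iterationBound (p : Params d) (F : ℝ) : ℕ := ⌊(F + p.fThres) / p.rate⌋₊ + 1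

lemma lt_rate_mul_iterationBound (hp : p.InRegime) (F : ℝ) :
    F + p.fThres < p.rate * iterationBound p F := by
  rw [mul_comm, ← div_lt_iff₀ (Params.InRegime.rate_pos hp), iterationBound]
  push_cast
  exact Nat.lt_floor_add_one _

/-- The gap `F` and `fThres` are divided by `rate`; the latter gives `8 (χ/c²)(l/γ)`, and the
rounding unit is absorbed because `(χ/c²)(l/γ) ≥ 1`. -/
lemma iterationBound_le (hp : p.InRegime) {F : ℝ} (hF : 0 ≤ F) :
    (iterationBound p F : ℝ) ≤ 8 * p.chi ^ 4 * p.l * F / (p.c ^ 3 * p.ε ^ 2) +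
      9 * p.chi * p.l / (p.c ^ 2 * √(p.ρ * p.ε)) := by
  have hr := Params.InRegime.rate_pos hp
  have hft := Params.InRegime.fThres_pos hp
  have hl := hp.l_pos
  have hc := hp.c_pos
  have hε := hp.ε_pos
  have hγ := hp.γ_pos
  have hχ := Regime.χ_pos hp
  have h1 := Regime.one_le_window hp
  have h2 : (⌊(F + p.fThres) / p.rate⌋₊ : ℝ) ≤ (F + p.fThres) / p.rate :=
    Nat.floor_le (by positivity)
  have h3 : (F + p.fThres) / p.rate = 8 * p.chi ^ 4 * p.l * F / (p.c ^ 3 * p.ε ^ 2) +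
      8 * (p.chi / p.c ^ 2 * (p.l / √(p.ρ * p.ε))) := by
    rw [Params.InRegime.fThres_eq hp, Params.rate]
    field_simp
  have h4 : 9 * p.chi * p.l / (p.c ^ 2 * √(p.ρ * p.ε)) =
      9 * (p.chi / p.c ^ 2 * (p.l / √(p.ρ * p.ε))) := by field_simp
  rw [iterationBound, h4]
  push_cast
  linarith

lemma iterationBound_le_pow (hp : p.InRegime) {F : ℝ} (hF : 0 ≤ F) :
    (iterationBound p F : ℝ) ≤
      9 / p.c ^ 3 * p.chi ^ 4 * (p.l * F / p.ε ^ 2 + p.l / √(p.ρ * p.ε)) := by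
  have hl := hp.l_pos
  have hc := hp.c_pos
  have hε := hp.ε_pos
  have hγ := hp.γ_pos
  have hχ := hp.χ_ge
  have hc1 : p.c ≤ 1 := hp.c_le.trans (by norm_num)
  refine (iterationBound_le hp hF).trans ?_
  rw [mul_add]
  refine add_le_add ?_ ?_
  · calc 8 * p.chi ^ 4 * p.l * F / (p.c ^ 3 * p.ε ^ 2)
        = 8 / p.c ^ 3 * p.chi ^ 4 * (p.l * F / p.ε ^ 2) := by field_simp
      _ ≤ _ := by gcongr; norm_num
  · calc 9 * p.chi * p.l / (p.c ^ 2 * √(p.ρ * p.ε))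
        = 9 / p.c ^ 2 * p.chi ^ 1 * (p.l / √(p.ρ * p.ε)) := by field_simp
      _ ≤ 9 / p.c ^ 3 * p.chi ^ 4 * (p.l / √(p.ρ * p.ε)) := by
        have h1 : p.c ^ 3 ≤ p.c ^ 2 := pow_le_pow_of_le_one hc.le hc1 (by norm_num)
        have h2 : p.chi ^ 1 ≤ p.chi ^ 4 := pow_le_pow_right₀ (by linarith) (by norm_num)
        gcongr

lemma iterationBound_le_max {d : ℕ} {p : Params d} {F K L : ℝ} (hp : p.InRegime)
    (hF : 0 ≤ F) (hK : p.chi ≤ K * max 1 L) :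
    (iterationBound p F : ℝ) ≤
      9 / p.c ^ 3 * K ^ 4 * (p.l * F / p.ε ^ 2 + p.l / √(p.ρ * p.ε)) * max 1 L ^ 4 := by
  have hl := hp.l_pos
  have hc := hp.c_pos
  have hχ := Regime.χ_pos hp
  refine (iterationBound_le_pow hp hF).trans ?_
  calc 9 / p.c ^ 3 * p.chi ^ 4 * (p.l * F / p.ε ^ 2 + p.l / √(p.ρ * p.ε))
      ≤ 9 / p.c ^ 3 * (K * max 1 L) ^ 4 * (p.l * F / p.ε ^ 2 + p.l / √(p.ρ * p.ε)) := by
        gcongr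
    _ = _ := by ring

/-- The gradient estimates are rarely inaccurate. -/
lemma iterationBound_mul_le (hp : p.InRegime) (hδ : 0 < p.δ) (hΔf : 0 < p.Δf)
    (hê : p.epsHat ≤ epsHatBound (p.c ^ 3 / 1000) d p.l p.ρ p.c p.θ p.χ₁ p.δ p.Δf p.ε)
    {F : ℝ} (hF : 0 ≤ F) (hFΔ : F ≤ p.Δf) :
    iterationBound p F * p.epsHat ≤ p.δ / 2 := by
  have hl := hp.l_pos
  have hc := hp.c_pos
  have hε := hp.ε_pos
  have hγ := hp.γ_pos
  have hχ := Regime.χ_pos hp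
  obtain ⟨-, -, -, h4, h5⟩ := epsHatBound_le (d := d) (a := p.c ^ 3 / 1000) (l := p.l) (ρ := p.ρ)
    (c := p.c) (θ := p.θ) (χ₁ := p.χ₁) (δ := p.δ) (Δf := p.Δf) (ε := p.ε) (χ := p.chi)
    (by positivity) rfl
  calc iterationBound p F * p.epsHat
      ≤ (8 * p.chi ^ 4 * p.l * F / (p.c ^ 3 * p.ε ^ 2) +
          9 * p.chi * p.l / (p.c ^ 2 * √(p.ρ * p.ε))) * p.epsHat :=
        mul_le_mul_of_nonneg_right (iterationBound_le hp hF) hp.ê_nonneg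
    _ ≤ 8 * p.chi ^ 4 * p.l * p.Δf / (p.c ^ 3 * p.ε ^ 2) *
          (p.c ^ 3 / 1000 * (p.ε ^ 2 * p.δ / (p.chi ^ 4 * p.l * p.Δf))) +
        9 * p.chi * p.l / (p.c ^ 2 * √(p.ρ * p.ε)) *
          (p.c ^ 3 / 1000 * (p.δ * √(p.ρ * p.ε) / (p.chi * p.l))) := by
        rw [add_mul]
        have := hp.ê_nonneg
        gcongr
        · exact hê.trans h4
        · exact hê.trans h5
    _ = 8 / 1000 * p.δ + p.c * (9 / 1000 * p.δ) := by
        generalize √(p.ρ * p.ε) = γ at hγ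
        field_simp
    _ ≤ 8 / 1000 * p.δ + 1 * (9 / 1000 * p.δ) := by
        have := hp.c_le
        gcongr
        linarith
    _ ≤ _ := by linarith

/-- The escape attempts rarely fail. -/
lemma escapeFailure_mul_le (hp : p.InRegime) (hθ : 0 < p.θ) (hδ : 0 < p.δ) (hΔf : 0 < p.Δf)
    (hχ₁ : ∀ χ : ℝ, p.χ₁ ≤ χ → χ ^ 3 * Real.exp (-χ) ≤ Real.exp (-χ / (1 + p.θ / 4)))
    {F : ℝ} (hFΔ : F ≤ p.Δf) (hF : √(p.ε ^ 3 / p.ρ) / 16 ≤ F + 2 / 5 * p.fThres) :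
    p.escapeFailure * (2 * F / p.fThres + 3) ≤ p.δ / 2 := by
  have hl := hp.l_pos
  have hc := hp.c_pos
  have hε := hp.ε_pos
  have hγ := hp.γ_pos
  have hχ := Regime.χ_pos hp
  have hft := Params.InRegime.fThres_pos hp
  have hd : (0 : ℝ) < d := by exact_mod_cast hp.d_pos
  have hS : p.fThres ≤ 1 / 10 ^ 7 * √(p.ε ^ 3 / p.ρ) := by
    rw [Params.fThres]
    have : 1 ≤ p.chi ^ 3 := one_le_pow₀ (by linarith [hp.χ_ge])
    exact mul_le_mul_of_nonneg_right ((div_le_self hc.le this).trans hp.c_le) (Real.sqrt_nonneg _)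
  have hS0 := Real.sqrt_nonneg (p.ε ^ 3 / p.ρ)
  -- The lower bound on `F` forces `Δf` to be much larger than `fThres`, since `c` is tiny. The
  -- additive `3` in the number of attempts is then harmless.
  have h1 : 3 ≤ 2 * p.Δf / p.fThres := by
    rw [le_div_iff₀ hft]
    linarith
  have h2 : 2 * F / p.fThres + 3 ≤ 4 * p.Δf / p.fThres := by
    have : 2 * F / p.fThres ≤ 2 * p.Δf / p.fThres := by gcongr
    have e : 4 * p.Δf / p.fThres = 2 * p.Δf / p.fThres + 2 * p.Δf / p.fThres := by ring
    linarith
  have h3 := chi_cube_mul_exp_le (d := d) hp.d_pos hl hc hθ hδ hΔf hε hχ₁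
  change p.chi ^ 3 * Real.exp (-p.chi) ≤ _ at h3
  have hesc : 0 ≤ p.escapeFailure := by unfold Params.escapeFailure; positivity
  calc p.escapeFailure * (2 * F / p.fThres + 3) ≤ p.escapeFailure * (4 * p.Δf / p.fThres) := by
        gcongr
    _ = d * p.l * p.Δf / (2 * p.c * p.ε ^ 2) * (p.chi ^ 3 * Real.exp (-p.chi)) := by
        rw [Params.InRegime.fThres_eq hp, Params.escapeFailure]
        field_simp
        norm_num
    _ ≤ d * p.l * p.Δf / (2 * p.c * p.ε ^ 2) *
          (p.c * p.ε ^ 2 * p.δ / (2 * d * p.l * p.Δf)) := by gcongr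
    _ = p.δ / 4 := by field_simp; norm_num
    _ ≤ _ := by linarith

/-- The number of samples of a gradient estimate. -/
lemma m_le (hd : 1 ≤ d) (hê0 : 0 < p.epsHat) (hê1 : p.epsHat ≤ 1) :
    (p.m : ℝ) ≤
      320 * p.c' ^ 2 * p.B ^ 2 * d / p.epsHat ^ 2 * (Real.log (1 / p.epsHat) + 1) + 1 := by
  have hd' : (1 : ℝ) ≤ d := by exact_mod_cast hd
  have hlog : 0 ≤ Real.log (1 / p.epsHat) := Real.log_nonneg ((one_le_div hê0).2 hê1)
  have hσ : 0 ≤ p.sigmaSq := by unfold Params.sigmaSq; positivity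
  refine (Nat.ceil_lt_add_one (by positivity)).le.trans ?_
  have : 32 * p.sigmaSq ≤ 320 * p.c' ^ 2 * p.B ^ 2 * d := by
    have h0 : 0 ≤ p.c' ^ 2 * p.B ^ 2 := by positivity
    unfold Params.sigmaSq
    nlinarith
  gcongr
  norm_num

end Complexity

/-! ### Total number of queries -/

section QueryComplexity

/-- If the accuracy is at least of order `accuracyOrder`, the number of queries is of the order of
`queryRate`, up to logarithms. -/
lemma exists_queries_le {l ρ c θ Δf B c' κ D : ℝ} (hl : 0 < l) (hρ : 0 < ρ) (hc : 0 < c)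
    (hθ : 0 < θ) (hΔf : 0 < Δf) (hκ : 0 < κ) (hD : 1 ≤ D) :
    ∃ C : ℝ, 0 < C ∧ ∀ (d : ℕ) (ε : ℝ) (p : Params d) (F : ℝ) (T Q : ℕ), p.InRegime →
      p.l = l → p.ρ = ρ → p.c = c → p.c' = c' → p.B = B → p.ε = ε →
      ε ≤ Real.exp (-1) → 0 < p.epsHat → p.epsHat ≤ 1 → 0 ≤ F → F ≤ Δf →
      p.chi ≤ D * Real.log (queryRate d θ ε) →
      accuracyOrder d θ ε ≤ κ * Real.log (queryRate d θ ε) ^ 4 * p.epsHat →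
      T ≤ iterationBound p F → Q ≤ T * (2 * p.m + 2) →
      (Q : ℝ) ≤ C * queryRate d θ ε * Real.log (queryRate d θ ε) ^ 13 := by
  set C₁ : ℝ := 9 / c ^ 3 * D ^ 4 * (l * Δf + l / √ρ) with hC₁
  set C₂ : ℝ := 320 * c' ^ 2 * B ^ 2 * κ ^ 2 * (|Real.log κ| + 6) with hC₂
  have hρ' := Real.sqrt_pos.2 hρ
  refine ⟨C₁ * (2 * C₂ + 4), by positivity, ?_⟩
  rintro d ε p F T Q hp rfl rfl rfl rfl rfl rfl hε1 hê0 hê1 hF hFΔ hχ hY hT hQ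
  have hd := hp.d_pos
  have hε := hp.ε_pos
  have hd' : (1 : ℝ) ≤ d := by exact_mod_cast hd
  have hΛ := one_le_log_queryRate hd hθ hε hε1
  have hY0 := accuracyOrder_pos (θ := θ) hd hε
  have hεle : p.ε ≤ 1 := hε1.trans (Real.exp_le_one_iff.2 (by norm_num))
  have hYle := accuracyOrder_le hd hθ hε hεle
  have hYlog := neg_log_accuracyOrder_le hd hθ hε hε1
  rw [queryRate_eq hd hε]
  rw [queryRate_eq hd hε] at hΛ hχ hY hYlog
  set Y := accuracyOrder d θ p.ε
  set Λ := Real.log (d / (Y ^ 2 * p.ε ^ 2))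
  have hχ0 := Regime.χ_pos hp
  have hTle : (T : ℝ) ≤ C₁ * Λ ^ 4 / p.ε ^ 2 := by
    have h1 : (T : ℝ) ≤ iterationBound p F := by exact_mod_cast hT
    refine h1.trans ((iterationBound_le_pow hp hF).trans ?_)
    have h2 : p.l / √(p.ρ * p.ε) ≤ p.l / √p.ρ / p.ε ^ 2 := by
      rw [div_div]
      have h3 : p.ε ^ 2 ≤ √p.ε := by
        have : p.ε ≤ √p.ε := Real.le_sqrt_of_sq_le (by nlinarith)
        nlinarith
      rw [Real.sqrt_mul hρ.le]
      gcongr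
    calc 9 / p.c ^ 3 * p.chi ^ 4 * (p.l * F / p.ε ^ 2 + p.l / √(p.ρ * p.ε))
        ≤ 9 / p.c ^ 3 * (D * Λ) ^ 4 * (p.l * Δf / p.ε ^ 2 + p.l / √p.ρ / p.ε ^ 2) := by
          have := Real.sqrt_nonneg (p.ρ * p.ε)
          gcongr
      _ = _ := by rw [hC₁]; ring
  have hinv : 1 / p.epsHat ≤ κ * Λ ^ 4 / Y := by
    rw [div_le_div_iff₀ hê0 hY0]
    linarith
  have hlog : Real.log (1 / p.epsHat) + 1 ≤ (|Real.log κ| + 6) * Λ := by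
    have h1 : Real.log (1 / p.epsHat) ≤ Real.log (κ * Λ ^ 4 / Y) :=
      Real.log_le_log (by positivity) hinv
    have hΛ0 : 0 < Λ := by linarith
    rw [Real.log_div (by positivity) hY0.ne', Real.log_mul hκ.ne' (by positivity),
      Real.log_pow] at h1
    have h2 : Real.log Λ ≤ Λ - 1 := Real.log_le_sub_one_of_pos hΛ0
    have h3 := le_abs_self (Real.log κ)
    have h4 := abs_nonneg (Real.log κ)
    push_cast at h1
    nlinarith
  have hm : (p.m : ℝ) ≤ C₂ * (d * Λ ^ 9 / Y ^ 2) + 1 := by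
    refine (m_le hd hê0 hê1).trans ?_
    have h1 : 0 ≤ Real.log (1 / p.epsHat) := Real.log_nonneg ((one_le_div hê0).2 hê1)
    calc 320 * p.c' ^ 2 * p.B ^ 2 * d / p.epsHat ^ 2 * (Real.log (1 / p.epsHat) + 1) + 1
        = 320 * p.c' ^ 2 * p.B ^ 2 * d * (1 / p.epsHat) ^ 2 *
            (Real.log (1 / p.epsHat) + 1) + 1 := by
          field_simp
      _ ≤ 320 * p.c' ^ 2 * p.B ^ 2 * d * (κ * Λ ^ 4 / Y) ^ 2 * ((|Real.log κ| + 6) * Λ) + 1 := by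
          gcongr
      _ = _ := by rw [hC₂]; ring
  have hone : 1 ≤ d * Λ ^ 9 / Y ^ 2 := by
    rw [one_le_div (by positivity)]
    have h1 : 1 ≤ Λ ^ 9 := one_le_pow₀ hΛ
    have h2 : Y ^ 2 ≤ 1 := pow_le_one₀ hY0.le (hYle.trans (pow_le_one₀ hε.le hεle))
    nlinarith
  have hQ' : (Q : ℝ) ≤ T * (2 * p.m + 2) := by exact_mod_cast hQ
  -- The exponent `13` of the logarithm is `4` from `χ⁴` in the iteration count, `8` from `1 /
  -- epsHat²`, and `1` from the logarithm in the sample size.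
  calc (Q : ℝ) ≤ T * (2 * p.m + 2) := hQ'
    _ ≤ C₁ * Λ ^ 4 / p.ε ^ 2 * ((2 * C₂ + 4) * (d * Λ ^ 9 / Y ^ 2)) := by
        have : 2 * (p.m : ℝ) + 2 ≤ (2 * C₂ + 4) * (d * Λ ^ 9 / Y ^ 2) := by linarith
        have hΛ0 : 0 ≤ Λ := by linarith
        have h0 : 0 ≤ C₁ := by positivity
        gcongr
    _ = _ := by field_simp

end QueryComplexity

end EGD

end

/-! ### Choice of the constants and conclusion -/

open EGD MeasureTheory in
theorem theorem1 :
    ∃ cMax : ℝ, 0 < cMax ∧ ∃ cMin' : ℝ, 0 < cMin' ∧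
    ∀ c c' θ χ₁ : ℝ, 0 < c → c ≤ cMax → cMin' ≤ c' → 0 < θ →
      (∀ χ : ℝ, χ₁ ≤ χ → χ ^ 3 * Real.exp (-χ) ≤ Real.exp (-χ / (1 + θ / 4))) →
    ∃ a : ℝ, 0 < a ∧ ∃ M : ℝ, 0 < M ∧
    ∀ l ρ B δ Δf b : ℝ, 0 < l → 0 < ρ → 3 / 2 < B → 0 < δ → 0 < Δf → 0 < b → b ≤ 1 →
    ∃ C : ℝ, 0 < C ∧ ∃ k : ℕ, ∃ ε₀ : ℝ, 0 < ε₀ ∧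
      (∀ (d : ℕ) (ε : ℝ), 1 ≤ d → 0 < ε → ε ≤ ε₀ →
        ε ^ (3 + θ / 2) / (d : ℝ) ^ (1 / 2 * (1 + θ / 2)) ≤
          C * Real.log (EGD.queryRate d θ ε) ^ k *
            EGD.epsHatBound a d l ρ c θ χ₁ δ Δf ε) ∧
      ∀ (d : ℕ) (f : EGD.Vec d → ℝ) (x₀ : EGD.Vec d) (ε epsHat : ℝ),
        1 ≤ d →
        EGD.IsSmooth l f →
        EGD.IsHessianLipschitz ρ f →
        (∀ x, ‖gradient f x‖ ≤ B) →
        BddBelow (Set.range f) →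
        f x₀ - (⨅ x, f x) ≤ Δf →
        0 < ε →
        √(ρ * ε) ≤ l →
        0 < epsHat →
        epsHat ≤ EGD.epsHatBound a d l ρ c θ χ₁ δ Δf ε →
        ∀ (p : EGD.Params d),
          p = { l := l, B := B, χ₁ := χ₁, θ := θ, ρ := ρ, ε := ε, epsHat := epsHat,
                c := c, c' := c', δ := δ, Δf := Δf } →
        ∀ (Ω : Type*) [MeasurableSpace Ω] (P : MeasureTheory.Measure Ω)
          [MeasureTheory.IsProbabilityMeasure P]
          (u : ℕ → ℕ → Ω → EGD.Vec d) (ξ : ℕ → Ω → EGD.Vec d),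
          EGD.IsRandomness p P u ξ →
          1 - δ ≤ P.real {ω | ∃ (y : EGD.Vec d) (T Q : ℕ),
            EGD.Returns p f x₀ (fun t i => u t i ω) (fun t => ξ t ω) y T Q ∧
            EGD.IsSOSP ρ ε f y ∧
            (T : ℝ) ≤ M * (l * (f x₀ - ⨅ x, f x) / ε ^ 2 + l / √(ρ * ε)) *
              max 1 (Real.log (d * l * Δf / (ε ^ 2 * δ))) ^ 4 ∧
            (√(ε ^ 3 / ρ) ≤ f x₀ - (⨅ x, f x) →
              1 ≤ Real.log (d * l * Δf / (ε ^ 2 * δ)) →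
              (T : ℝ) ≤ M * (l * (f x₀ - ⨅ x, f x) / ε ^ 2) *
                Real.log (d * l * Δf / (ε ^ 2 * δ)) ^ 4) ∧
            (ε ≤ ε₀ → b * EGD.epsHatBound a d l ρ c θ χ₁ δ Δf ε ≤ epsHat →
              (Q : ℝ) ≤ C * EGD.queryRate d θ ε *
                Real.log (EGD.queryRate d θ ε) ^ k)} := by
  refine ⟨1 / 10 ^ 7, by norm_num, 100, by norm_num, ?_⟩
  intro c c' θ χ₁ hc hc7 hc' hθ hexp
  have hχ₁ := EGD.four_le_of_exp_bound hθ hexp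
  have hc1 : c ≤ 1 := hc7.trans (by norm_num)
  have hlogc : 0 ≤ Real.log (2 / c) := Real.log_nonneg ((one_le_div hc).2 (by linarith))
  set K : ℝ := (1 + θ / 4) * (Real.log (2 / c) + 1) + χ₁ with hKdef
  have hK : 4 ≤ K := by
    have : 0 ≤ (1 + θ / 4) * (Real.log (2 / c) + 1) := by positivity
    linarith
  have hK0 : 0 < K := by linarith
  have ha : 0 < c ^ 3 / 1000 := by positivity
  -- The factor `c³` in `a` cancels the `c⁻³` of the iteration bound. The factor `2` in `M` merges
  -- the two terms of that bound in the regime `√(ε³/ρ) ≤ F`.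
  refine ⟨c ^ 3 / 1000, ha, 2 * (9 / c ^ 3 * K ^ 4), by positivity, ?_⟩
  intro l ρ B δ Δf b hl hρ hB hδ hΔf hb hb1
  obtain ⟨C₁, hC₁, hacc⟩ := EGD.exists_accuracyOrder_le ha hl hρ hc hθ hδ hΔf
    (by linarith : 1 ≤ χ₁)
  set D : ℝ := K * (1 + |Real.log (l * Δf / δ)|) with hD
  have habs := abs_nonneg (Real.log (l * Δf / δ))
  have hD1 : 1 ≤ D := by nlinarith
  have hD0 : 0 < D := by linarith
  -- The factor `1 / b` in `κ` accounts for `epsHat` being only a fraction `b` of its upper bound.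
  obtain ⟨C₂, hC₂, hquery⟩ := EGD.exists_queries_le (B := B) (c' := c')
    (κ := C₁ * D ^ 4 / b) hl hρ hc hθ hΔf (by positivity) hD1
  have hchi : ∀ (d : ℕ) (ε : ℝ), 1 ≤ d → 0 < ε → chi d l c θ χ₁ δ Δf ε ≤
      K * max 1 (Real.log (d * l * Δf / (ε ^ 2 * δ))) := fun d ε hd hε => by
    have hd' : (0 : ℝ) < d := by exact_mod_cast hd
    exact EGD.chi_le hc hc1 hθ (by linarith) (by positivity)
  have hchiΛ : ∀ (d : ℕ) (ε : ℝ), 1 ≤ d → 0 < ε → ε ≤ Real.exp (-1) →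
      chi d l c θ χ₁ δ Δf ε ≤ D * Real.log (queryRate d θ ε) := fun d ε hd hε hε1 => by
    refine (hchi d ε hd hε).trans ?_
    rw [hD, mul_assoc K]
    exact mul_le_mul_of_nonneg_left (max_one_log_le hd hθ hl hδ hΔf hε hε1) hK0.le
  have hexp1 : Real.exp (-1) ≤ 1 := Real.exp_le_one_iff.2 (by norm_num)
  have hBound0 : ∀ (d : ℕ) (ε : ℝ), 1 ≤ d → 0 < ε →
      0 < epsHatBound (c ^ 3 / 1000) d l ρ c θ χ₁ δ Δf ε := fun d ε hd hε => by
    have hd' : (0 : ℝ) < d := by exact_mod_cast hd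
    have hχ : 0 < chi d l c θ χ₁ δ Δf ε := lt_of_lt_of_le (by linarith) (le_max_right _ _)
    unfold epsHatBound
    positivity
  have hacc' : ∀ (d : ℕ) (ε : ℝ), 1 ≤ d → 0 < ε → ε ≤ Real.exp (-1) →
      accuracyOrder d θ ε ≤ C₁ * D ^ 4 * Real.log (queryRate d θ ε) ^ 4 *
        epsHatBound (c ^ 3 / 1000) d l ρ c θ χ₁ δ Δf ε := fun d ε hd hε hε1 => by
    refine (hacc d ε hd hε (hε1.trans hexp1)).trans ?_
    rw [mul_assoc C₁ (D ^ 4), ← mul_pow]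
    have hχ : 0 ≤ chi d l c θ χ₁ δ Δf ε := le_trans (by linarith) (le_max_right _ _)
    have := (hBound0 d ε hd hε).le
    have := hchiΛ d ε hd hε hε1
    gcongr
  -- The threshold `ε₀ = exp (-1)` makes the logarithm of the query rate at least `1` in every
  -- dimension, so its powers are monotone in the exponent and one `k` serves both estimates.
  refine ⟨C₁ * D ^ 4 + C₂, by positivity, 13, Real.exp (-1), Real.exp_pos _, ?_, ?_⟩
  · intro d ε hd hε hε1
    refine (hacc' d ε hd hε hε1).trans ?_
    have hΛ := one_le_log_queryRate hd hθ hε hε1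
    have := (hBound0 d ε hd hε).le
    gcongr
    · linarith
    · norm_num
  intro d f x₀ ε epsHat hd hs hf hgrad hbdd hF hε hγ hê0 hê p hpdef Ω _ P _ u ξ hR
  have el : p.l = l := by rw [hpdef]
  have eB : p.B = B := by rw [hpdef]
  have eχ : p.χ₁ = χ₁ := by rw [hpdef]
  have eθ : p.θ = θ := by rw [hpdef]
  have eρ : p.ρ = ρ := by rw [hpdef]
  have eε : p.ε = ε := by rw [hpdef]
  have eê : p.epsHat = epsHat := by rw [hpdef]
  have ec : p.c = c := by rw [hpdef]
  have ec' : p.c' = c' := by rw [hpdef]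
  have eδ : p.δ = δ := by rw [hpdef]
  have eΔ : p.Δf = Δf := by rw [hpdef]
  clear hpdef
  subst el eB eχ eθ eρ eε eê ec ec' eδ eΔ
  have hp := inRegime_of_le_epsHatBound hd hl hρ hε hc hc7 hχ₁ hγ hê0 hê
  have hF0 : 0 ≤ f x₀ - ⨅ x, f x := sub_nonneg.2 (ciInf_le hbdd x₀)
  have hêa : p.epsHat ≤ p.c ^ 3 / 1000 := hê.trans (epsHatBound_le ha.le rfl).1
  have hê2 : p.epsHat ≤ 1 / 2 := by
    have : p.c ^ 3 ≤ 1 := pow_le_one₀ hc.le hc1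
    linarith
  set F := f x₀ - ⨅ x, f x with hFdef
  set N := iterationBound p F with hN
  have hprob := le_measureReal_goodRun (P := P) hp hs hf hgrad hbdd (by linarith) hc' hê0 hê2 hR N
    (q := p.δ / 2) (by positivity) (fun h => escapeFailure_mul_le hp hθ hδ hΔf hexp hF h)
  have hNê := iterationBound_mul_le hp hδ hΔf hê hF0 hF
  refine (by linarith : 1 - p.δ ≤ 1 - (N * p.epsHat + p.δ / 2)).trans (hprob.trans ?_)
  refine measureReal_mono fun ω hω => ?_
  obtain ⟨y, T, Q, hret, hsosp, hT, hQ⟩ := exists_returns hp hs hbdd hω.norm_le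
    (lt_rate_mul_iterationBound hp F) hω.accurate hω.escapes
  have hTr : (T : ℝ) ≤ N := by exact_mod_cast hT
  have hTb := hTr.trans (iterationBound_le_max hp hF0 (hchi d p.ε hd hε))
  refine ⟨y, T, Q, hret, hsosp, ?_, ?_, ?_⟩
  · refine hTb.trans ?_
    have hlγ : 0 ≤ p.l * F / p.ε ^ 2 + p.l / √(p.ρ * p.ε) := by positivity
    have : 9 / p.c ^ 3 * K ^ 4 ≤ 2 * (9 / p.c ^ 3 * K ^ 4) :=
      le_mul_of_one_le_left (by positivity) (by norm_num)
    gcongr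
  · intro hS hL
    rw [max_eq_right hL] at hTb
    refine hTb.trans ?_
    have h1 : p.l / √(p.ρ * p.ε) ≤ p.l * F / p.ε ^ 2 := by
      calc p.l / √(p.ρ * p.ε) = p.l * √(p.ε ^ 3 / p.ρ) / p.ε ^ 2 := by
            rw [Params.InRegime.sqrt_cube_div hp]
            have := hp.γ_pos
            field_simp
        _ ≤ _ := by gcongr
    calc _ ≤ 9 / p.c ^ 3 * K ^ 4 * (p.l * F / p.ε ^ 2 + p.l * F / p.ε ^ 2) *
          Real.log (d * p.l * p.Δf / (p.ε ^ 2 * p.δ)) ^ 4 := by gcongr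
      _ = _ := by ring
  · intro hε1 hbE
    have hΛ := one_le_log_queryRate hd hθ hε hε1
    have hY : accuracyOrder d p.θ p.ε ≤
        C₁ * D ^ 4 / b * Real.log (queryRate d p.θ p.ε) ^ 4 * p.epsHat := by
      refine (hacc' d p.ε hd hε hε1).trans ?_
      have h1 := (le_div_iff₀' hb).2 hbE
      calc _ ≤ C₁ * D ^ 4 * Real.log (queryRate d p.θ p.ε) ^ 4 * (p.epsHat / b) := by gcongr
        _ = _ := by ring
    have h := hquery d p.ε p F T Q hp rfl rfl rfl rfl rfl rfl hε1 hê0 (by linarith) hF0 hF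
      (hchiΛ d p.ε hd hε hε1) hY hT hQ
    refine h.trans ?_
    have hq : 0 ≤ queryRate d p.θ p.ε := by unfold queryRate; positivity
    gcongr
    have : 0 < C₁ * D ^ 4 := by positivity
    linarith
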